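/- **Theorem.** There is an abstract simplicial complex $K$ with exactly 23 vertices and of dimension 2, which is $\mathbb{Z}$-acyclic (all its reduced integral simplicial homology groups vanish) but not contractible, and which has a polyhedral realization in $\mathbb{R}^4$ with small integer coordinates. That is, there are pairwise distinct points $x_v\in\mathbb{Z}^4$, one for each vertex $v$ of $K$, all of whose coordinates lie between $-4$ and $4$, such that the convex hulls of the sets $\{x_v : v\in\sigma\}$, for the faces $\sigma$ of $K$, are simplices with $\sigma$ as vertex set and form a geometric simplicial complex $G$ in $\mathbb{R}^4$ (any two of them meet exactly in the convex hull of their common vertices, so that the underlying space $|G|$ is a geometric realization of $K$). Moreover $K$ and the points $x_v$ can be chosen such that the following hold. 1. $K$ is a subdivision of the 2-skeleton of the spherical dodecahedral space. Here the spherical dodecahedral space is the quotient of the solid regular dodecahedron in which every pentagonal face is identified with the opposite face by the translation along their common axis followed by a rotation by $\pi/5$ about this axis (in the right-handed sense with respect to the outer normal of the first face), and its 2-skeleton is the image of the boundary of the dodecahedron. Subdivision means that there is a homeomorphism from $|G|$ onto this 2-skeleton which maps every simplex of $G$ affinely, in the coordinates of the dodecahedron, into one of the pentagonal faces. 2. The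 fundamental group of $K$ (that is, of $|G|$, at any base point) is isomorphic to the binary icosahedral group, the group of unit quaternions generated by $\frac12(1+i+j+k)$ and $\frac12(\varphi+\varphi^{-1}i+j)$, where $\varphi=\frac{1+\sqrt5}{2}$. 3. There is a vertex $A$ of $K$ with $x_A=(0,0,0,1)$, and all other vertices, hence all simplices outside the open star of $A$, lie in $\mathbb{R}^3=\mathbb{R}^3\times\{0\}$. -/

import Mathlib

open scoped Quaternion goldenRatio InnerProductSpace

noncomputable section

/-! ### Reduced simplicial homology with integer coefficients -/

/-- The boundary of the simplex `s = {v₀ < ⋯ < vₖ}`, namely `∑ᵢ (-1)ⁱ [v₀, …, v̂ᵢ, …, vₖ]`.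
The boundary of a vertex is the empty simplex, the generator in degree `-1` of the augmented
chain complex. -/
def simplexBoundary {V : Type*} [LinearOrder V] (s : Finset V) : Finset V →₀ ℤ :=
  ∑ v ∈ s, Finsupp.single (s.erase v) ((-1) ^ (s.filter (· < v)).card)

/-- The boundary operator, extended linearly from simplices to integral chains. -/
def chainBoundary (V : Type*) [LinearOrder V] : (Finset V →₀ ℤ) →ₗ[ℤ] (Finset V →₀ ℤ) :=
  Finsupp.linearCombination ℤ simplexBoundary

/-- The integral simplicial chains of `K` spanned by the simplices with `k` vertices (that is, of
dimension `k - 1`), where the empty simplex is admitted: the augmented chain complex. -/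
def augmentedChains {V : Type*} (K : AbstractSimplicialComplex V) (k : ℕ) :
    Submodule ℤ (Finset V →₀ ℤ) :=
  Finsupp.supported ℤ ℤ {s : Finset V | (s ∈ K.faces ∨ s = ∅) ∧ s.card = k}

/-- `K` is `ℤ`-acyclic: all its reduced integral simplicial homology groups vanish, that is, every
cycle of the augmented simplicial chain complex is a boundary. -/
def IsZAcyclic {V : Type*} [LinearOrder V] (K : AbstractSimplicialComplex V) : Prop :=
  ∀ (k : ℕ), ∀ c ∈ augmentedChains K k, chainBoundary V c = 0 →
    ∃ d ∈ augmentedChains K (k + 1), chainBoundary V d = c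

/-- The dimension of `K` is exactly `n`. -/
def HasDimension {V : Type*} (K : AbstractSimplicialComplex V) (n : ℕ) : Prop :=
  (∀ s ∈ K.faces, s.card ≤ n + 1) ∧ ∃ s ∈ K.faces, s.card = n + 1

/-- The geometric simplicial complex `G` in `E` is a polyhedral realization of the abstract complex
`K`, with the vertex `v` placed at the point `x v`. -/
def IsPolyhedralRealization {V E : Type*} [AddCommGroup E] [Module ℝ E]
    (K : AbstractSimplicialComplex V) (x : V → E) (G : Geometry.SimplicialComplex ℝ E) : Prop :=
  ∃ hx : Function.Injective x,
    G.faces = {t | ∃ s ∈ K.faces, t = s.map ⟨x, hx⟩}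

/-! ### The spherical dodecahedral space -/

/-- The twelve vertices of a regular icosahedron centred at the origin. -/
def icosahedronVertices : Set (EuclideanSpace ℝ (Fin 3)) :=
  {n | ∃ a b : ℝ, (a = 1 ∨ a = -1) ∧ (b = 1 ∨ b = -1) ∧
    (n = !₂[0, a * φ, b] ∨ n = !₂[b, 0, a * φ] ∨ n = !₂[a * φ, b, 0])}

/-- The solid regular dodecahedron dual to this icosahedron; its twenty vertices are
`(±1, ±1, ±1)` and the cyclic permutations of `(±φ, 0, ±φ⁻¹)`. -/
def solidDodecahedron : Set (EuclideanSpace ℝ (Fin 3)) :=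
  {x | ∀ n ∈ icosahedronVertices, ⟪n, x⟫_ℝ ≤ φ ^ 2}

/-- The closed pentagonal face of the dodecahedron with outer normal vector `n`. -/
def dodecahedronFace (n : EuclideanSpace ℝ (Fin 3)) : Set (EuclideanSpace ℝ (Fin 3)) :=
  {x | x ∈ solidDodecahedron ∧ ⟪n, x⟫_ℝ = φ ^ 2}

/-- The rotation of `ℝ³` by the angle `θ` (in the right-handed sense) about the oriented axis
spanned by the unit vector `u` (Rodrigues' formula). -/
def axisRotation (u : EuclideanSpace ℝ (Fin 3)) (θ : ℝ) (x : EuclideanSpace ℝ (Fin 3)) :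
    EuclideanSpace ℝ (Fin 3) :=
  Real.cos θ • x + Real.sin θ • WithLp.toLp 2 (crossProduct u.ofLp x.ofLp) +
    ((1 - Real.cos θ) * ⟪u, x⟫_ℝ) • u

/-- The gluing of the face with outer normal vector `n` to the opposite face: translate along the
axis `n` onto the plane of the opposite face and turn about this axis by `π / 5`. -/
def oppositeFaceGluing (n x : EuclideanSpace ℝ (Fin 3)) : EuclideanSpace ℝ (Fin 3) :=
  axisRotation (‖n‖⁻¹ • n) (Real.pi / 5) (x - (2 * φ ^ 2 / ‖n‖ ^ 2) • n)

/-- The spherical dodecahedral space: the solid regular dodecahedron, every face of which is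
identified with the opposite face after a turn by `π / 5`, with the quotient topology. -/
def SphericalDodecahedralSpace : Type :=
  Quot fun x y : solidDodecahedron =>
    ∃ n ∈ icosahedronVertices, x.1 ∈ dodecahedronFace n ∧ y.1 = oppositeFaceGluing n x.1

instance : TopologicalSpace SphericalDodecahedralSpace :=
  inferInstanceAs (TopologicalSpace (Quot _))

/-- The quotient map. -/
def SphericalDodecahedralSpace.mk (x : solidDodecahedron) : SphericalDodecahedralSpace :=
  Quot.mk _ x

/-- The 2-skeleton of the spherical dodecahedral space: the image of the boundary of the
dodecahedron, i.e. of the union of its twelve pentagonal faces. -/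
def dodecahedralTwoSkeleton : Set SphericalDodecahedralSpace :=
  {p | ∃ n ∈ icosahedronVertices, ∃ x : solidDodecahedron,
    x.1 ∈ dodecahedronFace n ∧ SphericalDodecahedralSpace.mk x = p}

/-- The geometric simplicial complex `G` is a (simplicial) subdivision of the 2-skeleton of the
spherical dodecahedral space: up to a homeomorphism `h` it has the same underlying space, and every
simplex of `G` is a straight simplex contained in one of the pentagonal cells, i.e. `h` carries it
affinely (in the coordinates of the dodecahedron) into a pentagon. -/
def SubdividesDodecahedralTwoSkeleton {E : Type*} [AddCommGroup E] [Module ℝ E]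
    [TopologicalSpace E] (G : Geometry.SimplicialComplex ℝ E) : Prop :=
  ∃ h : G.space ≃ₜ dodecahedralTwoSkeleton,
    ∀ s ∈ G.faces, ∃ n ∈ icosahedronVertices, ∃ g : E →ᵃ[ℝ] EuclideanSpace ℝ (Fin 3),
      ∀ y : G.space, y.1 ∈ convexHull ℝ (s : Set E) →
        ∃ x : solidDodecahedron, x.1 = g y.1 ∧ x.1 ∈ dodecahedronFace n ∧
          (h y).1 = SphericalDodecahedralSpace.mk x

/-! ### The binary icosahedral group -/

/-- The binary icosahedral group, as the group of unit quaternions generated by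
`(1 + i + j + k) / 2` and `(φ + φ⁻¹ i + j) / 2`. -/
def binaryIcosahedralGroup : Subgroup ℍ[ℝ]ˣ :=
  Subgroup.closure {q | (q : ℍ[ℝ]) = ⟨1 / 2, 1 / 2, 1 / 2, 1 / 2⟩ ∨
    (q : ℍ[ℝ]) = ⟨φ / 2, φ⁻¹ / 2, 1 / 2, 0⟩}

end

/-! Gluing opposite pentagons of the dodecahedron leaves five vertices, ten edges (the complete
graph on five vertices) and six pentagons, each a Hamiltonian cycle of this graph. Coning each
pentagon from its centre gives a complex with 11 vertices. Trisecting the six edges that avoid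
vertex 0 adds 12 more, hence 23. All spaces in between are handled as sets of barycentric
coordinates (`barycentricRealization`), where compactness makes continuous bijections into Hausdorff
spaces homeomorphisms.

Embedding. Triangles embed if each is nondegenerate and any two are separated by a linear form that
is strict except between common vertices (`isEmbeddedPlacement_of_separated`). For the 23 points a
table of integral forms is verified; the same criterion is used for the triangulated boundary of the
dodecahedron.

Fundamental group. The open vertex stars form a cover in which paths can be cut into short pieces,
so the loops crossing from one star to the next generate (`StarCover.closure_edge_eq_top`), and they
multiply as a cocycle. Conversely, every group-valued cocycle trivial at the base star is the
holonomy of a covering, hence comes from a homomorphism (`StarCover.exists_hom`). The six pentagon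
relations make the group a quotient of `⟨a, b | aba = bab, ba²b = a³⟩`. The quaternions `a = T`, `b
= T⁻¹S` satisfy these relations, so there is a homomorphism onto the subgroup which they generate.
It is injective because a coset enumeration by powers of `a` (`IcosahedralPair.normalForm`) leaves
no room for a kernel (`IcosahedralPair.injective`). Nontriviality of the group rules out
contractibility.

Acyclicity. An explicit integral chain contraction of the augmented complex is tabulated and
checked.

Subdivision. The boundary of the dodecahedron, triangulated from the face centres, maps both to the
quotient space and, by vertex labels, to the combinatorial skeleton. Both maps have the same fibres:
a gluing preserves labels, and equal labels are always explained by at most one gluing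
(`isRelated_of_label`). The coordinates lie in `ℤ[φ]`, so all the finite checks are exact. -/

open Path.Homotopic

/-! ### Generators of the fundamental group from a cover -/

/-- In a simply connected subset, two paths with the same endpoints are homotopic. -/
theorem IsSimplyConnected.homotopic {X : Type*} [TopologicalSpace X] {s : Set X}
    (hs : IsSimplyConnected s) {x y : X} (p q : Path x y) (hp : ∀ t, p t ∈ s) (hq : ∀ t, q t ∈ s) :
    p.Homotopic q := by
  have := hs.simplyConnectedSpace
  have hx : x ∈ s := by simpa using hp 0
  have hy : y ∈ s := by simpa using hp 1
  let lift : (r : Path x y) → (∀ t, r t ∈ s) → Path (⟨x, hx⟩ : s) ⟨y, hy⟩ := fun r hr =>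
    { toFun := fun t => ⟨r t, hr t⟩
      continuous_toFun := r.continuous.subtype_mk _
      source' := Subtype.ext r.source
      target' := Subtype.ext r.target }
  exact (SimplyConnectedSpace.paths_homotopic (lift p hp) (lift q hq)).map ⟨_, continuous_subtype_val⟩

/-- A family of simply connected open sets covering `X`, with connected pairwise intersections, the
member `U o` of which meets all the others. -/
structure StarCover {X : Type*} [TopologicalSpace X] {ι : Type*} (U : ι → Set X) (o : ι) : Prop where
  isOpen : ∀ i, IsOpen (U i)
  cover : ∀ x, ∃ i, x ∈ U i
  simplyConnected : ∀ i, IsSimplyConnected (U i)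
  joinedIn : ∀ i j, ∀ x ∈ U i ∩ U j, ∀ y ∈ U i ∩ U j, JoinedIn (U i ∩ U j) x y
  meets : ∀ i, (U o ∩ U i).Nonempty

namespace StarCover

variable {X : Type*} [TopologicalSpace X] {ι : Type*} {U : ι → Set X} {o : ι} (hU : StarCover U o)

/-- The homotopy class of the paths inside `U i` from `x` to `y`. -/
noncomputable def inner (i : ι) {x y : X} (hx : x ∈ U i) (hy : y ∈ U i) :
    Path.Homotopic.Quotient x y :=
  .mk ((hU.simplyConnected i).isPathConnected.joinedIn x hx y hy).somePath

theorem mk_eq_inner {i : ι} {x y : X} (hx : x ∈ U i) (hy : y ∈ U i) (p : Path x y)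
    (hp : ∀ t, p t ∈ U i) : .mk p = hU.inner i hx hy :=
  Path.Homotopic.Quotient.eq.2 <| (hU.simplyConnected i).homotopic _ _ hp
    (JoinedIn.somePath_mem _)

theorem inner_trans {i : ι} {x y z : X} (hx : x ∈ U i) (hy : y ∈ U i) (hz : z ∈ U i) :
    (hU.inner i hx hy).trans (hU.inner i hy hz) = hU.inner i hx hz := by
  rw [inner, inner, ← Quotient.mk_trans]
  refine hU.mk_eq_inner hx hz _ fun t => ?_
  have : (((hU.simplyConnected i).isPathConnected.joinedIn x hx y hy).somePath.trans
    ((hU.simplyConnected i).isPathConnected.joinedIn y hy z hz).somePath) t ∈ Set.range _ :=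
    Set.mem_range_self t
  rw [Path.trans_range] at this
  rcases this with ⟨s, hs⟩ | ⟨s, hs⟩ <;> rw [← hs] <;> exact JoinedIn.somePath_mem _ _

theorem inner_self {i : ι} {x : X} (hx : x ∈ U i) : hU.inner i hx hx = .refl x :=
  (hU.mk_eq_inner hx hx (Path.refl x) fun _ => hx).symm

/-- Connectedness of `U i ∩ U j` enters here: a path inside the intersection represents both
classes. -/
theorem inner_eq_inner {i j : ι} {x y : X} (hx : x ∈ U i) (hy : y ∈ U i) (hx' : x ∈ U j)
    (hy' : y ∈ U j) : hU.inner i hx hy = hU.inner j hx' hy' := by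
  have h := hU.joinedIn i j x ⟨hx, hx'⟩ y ⟨hy, hy'⟩
  rw [← hU.mk_eq_inner hx hy h.somePath fun t => (h.somePath_mem t).1,
    ← hU.mk_eq_inner hx' hy' h.somePath fun t => (h.somePath_mem t).2]

/-- A chosen point of `U o ∩ U i`. -/
noncomputable def link (i : ι) : X := (hU.meets i).some

theorem link_mem_base (i : ι) : hU.link i ∈ U o := (hU.meets i).some_mem.1

theorem link_mem (i : ι) : hU.link i ∈ U i := (hU.meets i).some_mem.2

/-- The class of a path from `x₀` through `U o` and then through `U i` to `x`. -/
noncomputable def tail {x₀ : X} (h₀ : x₀ ∈ U o) (i : ι) {x : X} (hx : x ∈ U i) :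
    Path.Homotopic.Quotient x₀ x :=
  (hU.inner o h₀ (hU.link_mem_base i)).trans (hU.inner i (hU.link_mem i) hx)

variable {x₀ : X} (h₀ : x₀ ∈ U o)

theorem tail_trans_inner {i : ι} {x y : X} (hx : x ∈ U i) (hy : y ∈ U i) :
    (hU.tail h₀ i hx).trans (hU.inner i hx hy) = hU.tail h₀ i hy := by
  rw [tail, Quotient.trans_assoc, inner_trans, tail]

theorem tail_base {x : X} (hx : x ∈ U o) : hU.tail h₀ o hx = hU.inner o h₀ hx := by
  rw [tail, inner_trans]

theorem tail_eq_of_mem_base {i : ι} {x : X} (hx : x ∈ U i) (hx' : x ∈ U o) :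
    hU.tail h₀ i hx = hU.inner o h₀ hx' := by
  rw [tail, hU.inner_eq_inner _ hx (hU.link_mem_base i) hx', inner_trans]

/-- The loop at `x₀` which runs through `U i` to `a`, along `γ`, and back through `U j`. -/
noncomputable def loop {i j : ι} {a b : X} (ha : a ∈ U i) (hb : b ∈ U j)
    (γ : Path.Homotopic.Quotient a b) : FundamentalGroup X x₀ :=
  (((hU.tail h₀ i ha).trans γ).trans (hU.tail h₀ j hb).symm : Path.Homotopic.Quotient x₀ x₀)

/-- The return tail to `b` cancels against the outgoing one. The path traversed first is the right
factor of the product, which fixes the order in all the cocycle conditions below. -/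
theorem loop_mul_loop {i j k : ι} {a b c : X} (ha : a ∈ U i) (hb : b ∈ U j) (hc : c ∈ U k)
    (γ : Path.Homotopic.Quotient a b) (δ : Path.Homotopic.Quotient b c) :
    hU.loop h₀ hb hc δ * hU.loop h₀ ha hb γ = hU.loop h₀ ha hc (γ.trans δ) := by
  rw [FundamentalGroup.mul_def, loop, loop, loop]
  simp only [Quotient.trans_assoc]
  rw [← Quotient.trans_assoc (hU.tail h₀ j hb).symm, Quotient.symm_trans, Quotient.refl_trans]

theorem loop_inner {i : ι} {a b : X} (ha : a ∈ U i) (hb : b ∈ U i) :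
    hU.loop h₀ ha hb (hU.inner i ha hb) = 1 := by
  rw [loop, tail_trans_inner, Quotient.trans_symm, FundamentalGroup.one_def]

open Classical in
/-- The loop at `x₀` which runs through `U i` and comes back through `U j`. -/
noncomputable def edge (i j : ι) : FundamentalGroup X x₀ :=
  if h : (U i ∩ U j).Nonempty then hU.loop h₀ h.some_mem.1 h.some_mem.2 (.refl _) else 1

/-- Moving the crossing point inside the connected intersection does not change the loop, so the
chosen point may be replaced by any other. -/
theorem edge_eq {i j : ι} {x : X} (hi : x ∈ U i) (hj : x ∈ U j) :
    hU.edge h₀ i j = hU.loop h₀ hi hj (.refl x) := by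
  have h : (U i ∩ U j).Nonempty := ⟨x, hi, hj⟩
  rw [edge, dif_pos h]
  have h1 := hU.loop_mul_loop h₀ hi h.some_mem.1 h.some_mem.2 (hU.inner i hi h.some_mem.1) (.refl _)
  have h2 := hU.loop_mul_loop h₀ hi hj h.some_mem.2 (.refl _) (hU.inner j hj h.some_mem.2)
  rw [loop_inner, mul_one, Quotient.trans_refl] at h1
  rw [loop_inner, one_mul, Quotient.refl_trans] at h2
  rw [h1, h2, hU.inner_eq_inner]

/-- All three loops can be computed at a single common point. -/
theorem edge_mul_edge {i j k : ι} (h : (U i ∩ U j ∩ U k).Nonempty) :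
    hU.edge h₀ j k * hU.edge h₀ i j = hU.edge h₀ i k := by
  obtain ⟨x, ⟨hi, hj⟩, hk⟩ := h
  rw [hU.edge_eq h₀ hj hk, hU.edge_eq h₀ hi hj, hU.edge_eq h₀ hi hk, loop_mul_loop,
    Quotient.trans_refl]

theorem edge_base (i : ι) : hU.edge h₀ o i = 1 := by
  rw [hU.edge_eq h₀ (hU.link_mem_base i) (hU.link_mem i), loop, tail_base, Quotient.trans_refl,
    hU.tail_eq_of_mem_base h₀ (hU.link_mem i) (hU.link_mem_base i), Quotient.trans_symm,
    FundamentalGroup.one_def]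

/-- Switching to the chart `k` at both ends costs one edge element each, and in that chart the path
contributes nothing. -/
theorem loop_mem_closure_of_mem {k i j : ι} {a b : X} (ha : a ∈ U i) (hb : b ∈ U j) (p : Path a b)
    (hp : ∀ t, p t ∈ U k) :
    hU.loop h₀ ha hb (.mk p) ∈ Subgroup.closure
      {x | ∃ i j, (U i ∩ U j).Nonempty ∧ hU.edge h₀ i j = x} := by
  have hak : a ∈ U k := by simpa using hp 0
  have hbk : b ∈ U k := by simpa using hp 1
  have h1 := hU.loop_mul_loop h₀ ha hak hbk (.refl a) (.mk p)
  have h2 := hU.loop_mul_loop h₀ ha hbk hb (.mk p) (.refl b)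
  rw [Quotient.refl_trans, hU.mk_eq_inner hak hbk p hp, loop_inner, one_mul,
    ← hU.edge_eq h₀ ha hak] at h1
  rw [Quotient.trans_refl, hU.mk_eq_inner hak hbk p hp, ← h1, ← hU.edge_eq h₀ hbk hb] at h2
  rw [hU.mk_eq_inner hak hbk p hp, ← h2]
  exact mul_mem (Subgroup.subset_closure ⟨_, _, ⟨b, hbk, hb⟩, rfl⟩)
    (Subgroup.subset_closure ⟨_, _, ⟨a, ha, hak⟩, rfl⟩)

/-- By compactness of the interval the path is cut into finitely many pieces, each inside one member
of the cover. -/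
theorem loop_mem_closure {i j : ι} {a b : X} (ha : a ∈ U i) (hb : b ∈ U j) (p : Path a b) :
    hU.loop h₀ ha hb (.mk p) ∈ Subgroup.closure
      {x | ∃ i j, (U i ∩ U j).Nonempty ∧ hU.edge h₀ i j = x} := by
  obtain ⟨t, ht0, hmono, ⟨n, hn⟩, hcov⟩ := exists_monotone_Icc_subset_open_cover_unitInterval
    (c := fun i => p ⁻¹' U i) (fun i => (hU.isOpen i).preimage p.continuous)
    (fun s _ => Set.mem_iUnion.2 (hU.cover (p s)))
  -- The final chart is arbitrary, so that the induction can hand over to the chart of the next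
  -- piece.
  have key : ∀ m, ∀ j, ∀ hb : p (t m) ∈ U j,
      ∀ ha : p (t 0) ∈ U i, hU.loop h₀ ha hb (.mk (p.subpath (t 0) (t m))) ∈ Subgroup.closure
        {x | ∃ i j, (U i ∩ U j).Nonempty ∧ hU.edge h₀ i j = x} := by
    intro m
    induction m with
    | zero =>
      intro j hb ha
      refine hU.loop_mem_closure_of_mem h₀ (k := i) ha hb _ fun s => ?_
      rw [Path.subpath_self]
      exact ha
    | succ m ih =>
      intro j hb ha
      obtain ⟨k, hk⟩ := hcov m
      have hm : p (t m) ∈ U k := hk ⟨le_rfl, hmono m.le_succ⟩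
      have h := hU.loop_mul_loop h₀ ha hm hb (.mk (p.subpath (t 0) (t m)))
        (.mk (p.subpath (t m) (t (m + 1))))
      have h3 : Path.Homotopic.Quotient.trans (.mk (p.subpath (t 0) (t m)))
          (.mk (p.subpath (t m) (t (m + 1)))) = .mk (p.subpath (t 0) (t (m + 1))) := by
        rw [← Quotient.mk_trans]
        exact Path.Homotopic.Quotient.eq.2 ⟨Path.Homotopy.subpathTransSubpath p _ _ _⟩
      rw [← h3, ← h]
      refine mul_mem (hU.loop_mem_closure_of_mem h₀ (k := k) hm hb _ fun s => ?_) (ih k hm ha)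
      have hs : p.subpath (t m) (t (m + 1)) s ∈ Set.range (p.subpath (t m) (t (m + 1))) :=
        Set.mem_range_self s
      rw [Path.range_subpath_of_le _ _ _ (hmono m.le_succ)] at hs
      obtain ⟨r, hr, hrs⟩ := hs
      rw [← hrs]
      exact hk hr
  have h1 : t n = 1 := hn n le_rfl
  have ha' : p (t 0) ∈ U i := by rw [ht0]; simpa using ha
  have hb' : p (t n) ∈ U j := by rw [h1]; simpa using hb
  have := key n j hb' ha'
  have e0 : p (t 0) = a := by rw [ht0]; simp
  have e1 : p (t n) = b := by rw [h1]; simp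
  have hc : p.subpath (t 0) (t n) = p.cast e0 e1 := by
    ext s
    have h : Set.Icc.convexComb (t 0) (t n) s = s := by
      rw [h1, ht0]
      simp
    exact congrArg p h
  rw [hc] at this
  -- The endpoints of the subpath equal `a` and `b` only propositionally; generalizing them removes
  -- the cast.
  clear hc key
  revert ha' hb' this
  generalize p (t 0) = a', p (t n) = b' at e0 e1
  subst e0 e1
  intro _ _ h
  exact h

theorem closure_edge_eq_top : Subgroup.closure
    {x | ∃ i j, (U i ∩ U j).Nonempty ∧ hU.edge h₀ i j = x} = ⊤ := by
  refine eq_top_iff.2 fun γ _ => ?_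
  obtain ⟨p, rfl⟩ := Path.Homotopic.Quotient.mk_surjective γ
  have := hU.loop_mem_closure h₀ h₀ h₀ p
  rwa [loop, tail_base, inner_self, Quotient.refl_trans,
    show (Quotient.refl x₀).symm = Quotient.refl x₀ from by
      rw [← Quotient.mk_refl, ← Quotient.mk_symm, Path.refl_symm], Quotient.trans_refl] at this

end StarCover

/-! ### Homomorphisms out of the fundamental group from holonomy -/

open Path.Homotopic

namespace StarCover

variable {X : Type*} [TopologicalSpace X] {ι : Type*} {U : ι → Set X} {o : ι} (hU : StarCover U o)
variable {G : Type*} [Group G] {g : ι → ι → G}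

/-- The principal bundle with discrete fibre `G` defined by a constant cocycle `g`. -/
noncomputable def bundleCore [TopologicalSpace G] [DiscreteTopology G]
    (hg : ∀ i j k, (U i ∩ U j ∩ U k).Nonempty → g j k * g i j = g i k) :
    FiberBundleCore ι X G where
  baseSet := U
  isOpen_baseSet := hU.isOpen
  indexAt x := (hU.cover x).choose
  mem_baseSet_at x := (hU.cover x).choose_spec
  coordChange i j _ v := g i j * v
  coordChange_self i x hx v := by
    have := hg i i i ⟨x, ⟨hx, hx⟩, hx⟩
    rw [mul_eq_right] at this
    simp [this]
  continuousOn_coordChange i j :=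
    ((continuous_of_discreteTopology (f := fun v : G => g i j * v)).comp continuous_snd).continuousOn
  coordChange_comp i j k x hx v := by
    rw [← mul_assoc, hg i j k ⟨x, hx⟩]

section

variable [TopologicalSpace G] [DiscreteTopology G]
  (hg : ∀ i j k, (U i ∩ U j ∩ U k).Nonempty → g j k * g i j = g i k)

theorem isCoveringMap_bundleCore : IsCoveringMap (hU.bundleCore hg).proj :=
  FiberBundle.isCoveringMap

/-- The homotopy class `γ` acts on the fibres, in the charts `i` and `j`, as left multiplication by
the group element `h`. -/
def HasHolonomy (i j : ι) {a b : X} (γ : Path.Homotopic.Quotient a b) (h : G) : Prop :=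
  ∀ e : (hU.bundleCore hg).proj ⁻¹' {a},
    ((hU.bundleCore hg).localTriv j ((hU.isCoveringMap_bundleCore hg).monodromy γ e).1).2 =
      h * ((hU.bundleCore hg).localTriv i e.1).2

variable {hU hg}

theorem HasHolonomy.trans {i j k : ι} {a b c : X} {γ : Path.Homotopic.Quotient a b}
    {δ : Path.Homotopic.Quotient b c} {h h' : G} (H : hU.HasHolonomy hg i j γ h)
    (H' : hU.HasHolonomy hg j k δ h') : hU.HasHolonomy hg i k (γ.trans δ) (h' * h) := fun e => by
  rw [IsCoveringMap.monodromy_trans_apply, H', H, mul_assoc]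

theorem HasHolonomy.symm {i j : ι} {a b : X} {γ : Path.Homotopic.Quotient a b} {h : G}
    (H : hU.HasHolonomy hg i j γ h) : hU.HasHolonomy hg j i γ.symm h⁻¹ := fun e => by
  have := H ((hU.isCoveringMap_bundleCore hg).monodromy γ.symm e)
  rw [← IsCoveringMap.monodromy_trans_apply, Quotient.symm_trans,
    IsCoveringMap.monodromy_refl, id] at this
  rw [this, inv_mul_cancel_left]

variable (hU hg)

/-- Only the change of chart remains; the preferred chart of the bundle at `x` drops out by the
cocycle condition. -/
theorem hasHolonomy_refl {i j : ι} {x : X} (hi : x ∈ U i) (hj : x ∈ U j) :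
    hU.HasHolonomy hg i j (.refl x) (g i j) := fun e => by
  rw [IsCoveringMap.monodromy_refl, id]
  have he : e.1.1 = x := e.2
  rw [FiberBundleCore.localTriv_apply, FiberBundleCore.localTriv_apply]
  change g _ j * _ = g i j * (g _ i * _)
  have key : ∀ v : G, g (hU.cover e.1.1).choose j * v = g i j * (g (hU.cover e.1.1).choose i * v) := by
    intro v
    rw [← mul_assoc, hg _ i j ⟨x, ⟨by simpa only [he] using (hU.cover e.1.1).choose_spec, hi⟩, hj⟩]
  exact key e.1.2

/-- A path inside `U i` lifts to a path that is constant in the fibre coordinate of the chart `i`;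
uniqueness of lifts identifies this with the monodromy. -/
theorem hasHolonomy_inner {i : ι} {x y : X} (hx : x ∈ U i) (hy : y ∈ U i) :
    hU.HasHolonomy hg i i (hU.inner i hx hy) 1 := fun e => by
  let Z := hU.bundleCore hg
  have hj := (hU.simplyConnected i).isPathConnected.joinedIn x hx y hy
  let p : Path x y := hj.somePath
  have hp : ∀ t, p t ∈ U i := hj.somePath_mem
  have hpx : ∀ t v, ((p t, v) : X × G) ∈ (Z.localTriv i).target := fun t v => by
    rw [(Z.localTriv i).mem_target]
    exact hp t
  have he : e.1.1 = x := e.2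
  let v := (Z.localTriv i e.1).2
  let Γ : C(unitInterval, Z.TotalSpace) :=
    ⟨fun t => (Z.localTriv i).toOpenPartialHomeomorph.symm (p t, v), by
      refine (Z.localTriv i).toOpenPartialHomeomorph.symm.continuousOn.comp_continuous
        (p.continuous.prodMk continuous_const) fun t => hpx t v⟩
  have h0 : Γ 0 = e.1 := by
    have : ((p 0, v) : X × G) = Z.localTriv i e.1 := by
      refine Prod.ext ?_ rfl
      rw [p.source]
      exact he.symm
    change (Z.localTriv i).toOpenPartialHomeomorph.symm (p 0, v) = e.1
    rw [this]
    exact (Z.localTriv i).symm_apply_mk_proj (x := e.1) ((Z.localTriv i).mem_source.2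
      (show e.1.1 ∈ U i from he.symm ▸ hx))
  have hl : Γ = (hU.isCoveringMap_bundleCore hg).liftPath p e.1 (p.source.trans e.2.symm) := by
    rw [IsCoveringMap.eq_liftPath_iff']
    refine ⟨?_, h0⟩
    ext t
    exact (Z.localTriv i).proj_symm_apply (hpx t v)
  have : ((hU.isCoveringMap_bundleCore hg).monodromy (hU.inner i hx hy) e).1 = Γ 1 := by
    rw [hl]
    rfl
  rw [this, one_mul]
  have h1 := (Z.localTriv i).apply_symm_apply (hpx 1 v)
  have h2 := congrArg Prod.snd h1
  exact h2

variable {x₀ : X} (h₀ : x₀ ∈ U o)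

theorem hasHolonomy_tail (hgo : ∀ i, g o i = 1) {i : ι} {x : X} (hx : x ∈ U i) :
    hU.HasHolonomy hg o i (hU.tail h₀ i hx) 1 := by
  have := ((hU.hasHolonomy_inner hg h₀ (hU.link_mem_base i)).trans
    (hU.hasHolonomy_refl hg (hU.link_mem_base i) (hU.link_mem i))).trans
    (hU.hasHolonomy_inner hg (hU.link_mem i) hx)
  rwa [Quotient.trans_refl, hgo, one_mul, one_mul] at this

theorem hasHolonomy_edge (hgo : ∀ i, g o i = 1) {i j : ι} (h : (U i ∩ U j).Nonempty) :
    hU.HasHolonomy hg o o (hU.edge h₀ i j) (g i j) := by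
  obtain ⟨x, hi, hj⟩ := h
  have := ((hU.hasHolonomy_tail hg h₀ hgo hi).trans (hU.hasHolonomy_refl hg hi hj)).trans
    (hU.hasHolonomy_tail hg h₀ hgo hj).symm
  rw [inv_one, one_mul, mul_one] at this
  rwa [hU.edge_eq h₀ hi hj, loop]

/-- The edge elements have known holonomy and generate, and holonomies compose and invert. -/
theorem exists_hasHolonomy {x₀ : X} (h₀ : x₀ ∈ U o) (hgo : ∀ i, g o i = 1) (γ : FundamentalGroup X x₀) :
    ∃ h, hU.HasHolonomy hg o o γ h := by
  have hγ : γ ∈ Subgroup.closure {x | ∃ i j, (U i ∩ U j).Nonempty ∧ hU.edge h₀ i j = x} := by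
    rw [closure_edge_eq_top]
    trivial
  induction hγ using Subgroup.closure_induction with
  | mem x hx =>
    obtain ⟨i, j, h, rfl⟩ := hx
    exact ⟨_, hU.hasHolonomy_edge hg h₀ hgo h⟩
  | one =>
    exact ⟨_, hU.hasHolonomy_refl hg h₀ h₀⟩
  | mul x y _ _ hx hy =>
    obtain ⟨⟨a, ha⟩, b, hb⟩ := And.intro hx hy
    exact ⟨_, hb.trans ha⟩
  | inv x _ hx =>
    obtain ⟨a, ha⟩ := hx
    exact ⟨_, ha.symm⟩

/-- Left multiplications that agree at one point of the nonempty fibre come from the same group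
element. -/
theorem HasHolonomy.unique {γ : FundamentalGroup X x₀} {h h' : G}
    (H : hU.HasHolonomy hg o o γ h) (H' : hU.HasHolonomy hg o o γ h') : h = h' := by
  have := (H ⟨⟨x₀, (1 : G)⟩, rfl⟩).symm.trans (H' ⟨⟨x₀, (1 : G)⟩, rfl⟩)
  exact mul_right_cancel this

end

/-- The holonomy homomorphism of a constant cocycle `g` which is trivial on the base star. -/
theorem exists_hom (hg : ∀ i j k, (U i ∩ U j ∩ U k).Nonempty → g j k * g i j = g i k)
    (hgo : ∀ i, g o i = 1) {x₀ : X} (h₀ : x₀ ∈ U o) :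
    ∃ Φ : FundamentalGroup X x₀ →* G, ∀ i j, (U i ∩ U j).Nonempty → Φ (hU.edge h₀ i j) = g i j := by
  -- With discrete fibre the bundle is a covering.
  let _ : TopologicalSpace G := ⊥
  have : DiscreteTopology G := ⟨rfl⟩
  choose Φ hΦ using hU.exists_hasHolonomy hg h₀ hgo
  exact ⟨MonoidHom.mk' Φ fun x y =>
    HasHolonomy.unique hU hg (hΦ (x * y)) ((hΦ y).trans (hΦ x)),
    fun i j h => HasHolonomy.unique hU hg (hΦ _) (hU.hasHolonomy_edge hg h₀ hgo h)⟩

end StarCover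

/-! ### The group `⟨a, b | aba = bab, ba²b = a³⟩` -/

/-- Two elements of a group satisfying the relations of a presentation of the binary icosahedral
group. -/
structure IcosahedralPair {H : Type*} [Group H] (a b : H) : Prop where
  braid : a * b * a = b * a * b
  cube : b * a ^ 2 * b = a ^ 3

namespace IcosahedralPair

variable {H : Type*} [Group H] {a b : H}

theorem pow_five_eq (h : IcosahedralPair a b) : a ^ 5 = (a * b * a) * (a * b * a) := by
  calc a ^ 5 = a * a ^ 3 * a := by simp [pow_succ, mul_assoc]
    _ = a * (b * a ^ 2 * b) * a := by rw [h.cube]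
    _ = _ := by simp only [pow_two, mul_assoc]

/-- With `conj_right`: by the braid relation, conjugation by `a * b * a` exchanges `a` and `b`. -/
theorem conj_left (h : IcosahedralPair a b) : a * b * a * a * (a * b * a)⁻¹ = b := by
  rw [mul_inv_eq_iff_eq_mul, show b * (a * b * a) = (b * a * b) * a by simp [mul_assoc], ← h.braid]

theorem conj_right (h : IcosahedralPair a b) : a * b * a * b * (a * b * a)⁻¹ = a := by
  rw [mul_inv_eq_iff_eq_mul, show a * b * a * b = a * (b * a * b) by simp [mul_assoc], ← h.braid]

/-- Conjugation by `a * b * a` carries the cube relation to the one with `a` and `b` exchanged, so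
every consequence holds symmetrically. -/
theorem swap (h : IcosahedralPair a b) : IcosahedralPair b a where
  braid := h.braid.symm
  cube := by
    have e := congrArg (MulAut.conj (a * b * a)) h.cube
    rw [map_mul, map_mul, map_pow, map_pow] at e
    simp only [MulAut.conj_apply] at e
    rwa [h.conj_left, h.conj_right] at e

/-- Both are the square of `aba = bab`; hence `a ^ 5` commutes with both generators. -/
theorem pow_five_eq_pow_five (h : IcosahedralPair a b) : b ^ 5 = a ^ 5 := by
  rw [h.swap.pow_five_eq, h.pow_five_eq, h.braid]

theorem commute (h : IcosahedralPair a b) : Commute (a ^ 5) b := by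
  rw [← h.pow_five_eq_pow_five]
  exact Commute.pow_self b 5

theorem inv_mul_mul (h : IcosahedralPair a b) : b⁻¹ * a * b = a * b * a⁻¹ := by
  rw [eq_mul_inv_iff_mul_eq, mul_assoc b⁻¹, mul_assoc b⁻¹, h.braid]
  group

/-- This and the next two lemmas rewrite `b * a ^ r * b` for `r = -1, 3, 4`. Together with the two
defining relations (`r = 1, 2`) and centrality of `a ^ 5` they drive the coset enumeration. -/
theorem mul_inv_mul (h : IcosahedralPair a b) : b * a⁻¹ * b = a⁻¹ * b ^ 2 * a⁻¹ := by
  have e : a * b * a⁻¹ * b * a = b ^ 2 := by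
    calc a * b * a⁻¹ * b * a = (b⁻¹ * a * b) * b * a := by rw [h.inv_mul_mul]
      _ = b⁻¹ * (a * b ^ 2 * a) := by simp [pow_succ, mul_assoc]
      _ = b ^ 2 := by rw [h.swap.cube]; simp [pow_succ, mul_assoc]
  rw [← e]
  group

theorem mul_pow_three_mul (h : IcosahedralPair a b) : b * a ^ 3 * b = a ^ 4 * b * a⁻¹ := by
  calc b * a ^ 3 * b = (b * a ^ 2 * b) * (b⁻¹ * a * b) := by simp [pow_succ, mul_assoc]
    _ = a ^ 3 * (a * b * a⁻¹) := by rw [h.cube, h.inv_mul_mul]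
    _ = _ := by simp [pow_succ, mul_assoc]

theorem mul_pow_four_mul (h : IcosahedralPair a b) : b * a ^ 4 * b = a ^ 4 * b ^ 2 * a⁻¹ := by
  calc b * a ^ 4 * b = (b * a ^ 3 * b) * (b⁻¹ * a * b) := by simp [pow_succ, mul_assoc]
    _ = (a ^ 4 * b * a⁻¹) * (a * b * a⁻¹) := by rw [h.mul_pow_three_mul, h.inv_mul_mul]
    _ = _ := by simp [pow_succ, mul_assoc]

/-- The element `b²a⁻¹b` inverts `a` by conjugation, so its double coset modulo the powers of `a` is
a single coset. -/
theorem inverts (h : IcosahedralPair a b) : a * (b ^ 2 * a⁻¹ * b) = (b ^ 2 * a⁻¹ * b) * a⁻¹ := by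
  have e : b ^ 2 * a⁻¹ * b = a⁻¹ * (b ^ 2 * a⁻¹ * b) * a⁻¹ := by
    calc b ^ 2 * a⁻¹ * b = b * (b * a⁻¹ * b) := by simp [pow_succ, mul_assoc]
      _ = b * (a⁻¹ * b ^ 2 * a⁻¹) := by rw [h.mul_inv_mul]
      _ = (b * a⁻¹ * b) * b * a⁻¹ := by simp [pow_succ, mul_assoc]
      _ = (a⁻¹ * b ^ 2 * a⁻¹) * b * a⁻¹ := by rw [h.mul_inv_mul]
      _ = _ := by simp [pow_succ, mul_assoc]
  conv_lhs => rw [e]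
  group

theorem zpow_inverts (h : IcosahedralPair a b) (k : ℤ) : a ^ k * (b ^ 2 * a⁻¹ * b) = (b ^ 2 * a⁻¹ * b) * a ^ (-k) := by
  have : SemiconjBy (b ^ 2 * a⁻¹ * b) a⁻¹ a := h.inverts.symm
  rw [zpow_neg, ← inv_zpow]
  exact (this.zpow_right k).symm

/-- The power `a ^ 5` is central, but `b²a⁻¹b` inverts it. -/
theorem pow_ten (h : IcosahedralPair a b) : a ^ 10 = 1 := by
  have h1 : a ^ 5 * (b ^ 2 * a⁻¹ * b) = (b ^ 2 * a⁻¹ * b) * a ^ 5 :=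
    ((h.commute.pow_right 2).mul_right ((Commute.pow_self a 5).inv_right)).mul_right h.commute
  have h2 := h.zpow_inverts 5
  rw [show (a ^ (5 : ℤ)) = a ^ 5 from zpow_ofNat a 5, h1, mul_right_inj] at h2
  calc a ^ 10 = a ^ 5 * a ^ 5 := by simp [pow_succ, mul_assoc]
    _ = a ^ (-5 : ℤ) * a ^ 5 := by rw [← h2]
    _ = 1 := by simp [pow_succ, mul_assoc]

/-- The double cosets of the powers of `a`. -/
theorem normalForm (h : IcosahedralPair a b) {x : H} (hx : x ∈ Subgroup.closure {a, b}) :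
    (∃ k : ℤ, x = a ^ k) ∨ (∃ i k : ℤ, x = a ^ i * b * a ^ k) ∨
      (∃ i k : ℤ, x = a ^ i * b ^ 2 * a ^ k) ∨ ∃ k : ℤ, x = b ^ 2 * a⁻¹ * b * a ^ k := by
  set T : Set H := {x | (∃ k : ℤ, x = a ^ k) ∨ (∃ i k : ℤ, x = a ^ i * b * a ^ k) ∨
      (∃ i k : ℤ, x = a ^ i * b ^ 2 * a ^ k) ∨ ∃ k : ℤ, x = b ^ 2 * a⁻¹ * b * a ^ k} with hT
  have hl : ∀ j : ℤ, ∀ x ∈ T, a ^ j * x ∈ T := by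
    rintro j x (⟨k, rfl⟩ | ⟨i, k, rfl⟩ | ⟨i, k, rfl⟩ | ⟨k, rfl⟩)
    · exact .inl ⟨j + k, by rw [zpow_add]⟩
    · exact .inr (.inl ⟨j + i, k, by rw [zpow_add]; simp only [mul_assoc]⟩)
    · exact .inr (.inr (.inl ⟨j + i, k, by rw [zpow_add]; simp only [mul_assoc]⟩))
    · exact .inr (.inr (.inr ⟨-j + k, by rw [← mul_assoc, h.zpow_inverts, zpow_add, mul_assoc]⟩))
  have hr : ∀ j : ℤ, ∀ x ∈ T, x * a ^ j ∈ T := by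
    rintro j x (⟨k, rfl⟩ | ⟨i, k, rfl⟩ | ⟨i, k, rfl⟩ | ⟨k, rfl⟩)
    · exact .inl ⟨k + j, by rw [zpow_add]⟩
    · exact .inr (.inl ⟨i, k + j, by rw [zpow_add]; simp only [mul_assoc]⟩)
    · exact .inr (.inr (.inl ⟨i, k + j, by rw [zpow_add]; simp only [mul_assoc]⟩))
    · exact .inr (.inr (.inr ⟨k + j, by rw [zpow_add]; simp only [mul_assoc]⟩))
  have t0 : ∀ k : ℤ, a ^ k ∈ T := fun k => .inl ⟨k, rfl⟩
  have t1 : b ∈ T := .inr (.inl ⟨0, 0, by simp⟩)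
  have t2 : b ^ 2 ∈ T := .inr (.inr (.inl ⟨0, 0, by simp⟩))
  have t3 : b ^ 2 * a⁻¹ * b ∈ T := .inr (.inr (.inr ⟨0, by simp⟩))
  -- Since `a ^ 5` is central, the exponent between `b` and `y` matters only modulo 5.
  have mid : ∀ (i : ℤ) (y : H), (∀ r : ℤ, 0 ≤ r → r < 5 → b * a ^ r * y ∈ T) →
      b * a ^ i * y ∈ T := by
    intro i y hy
    have e : a ^ i = (a ^ 5) ^ (i / 5) * a ^ (i % 5) := by
      conv_lhs => rw [← Int.mul_ediv_add_emod i 5, zpow_add, zpow_mul, zpow_ofNat]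
    have := hl (5 * (i / 5)) _ (hy (i % 5) (Int.emod_nonneg _ (by norm_num))
      (Int.emod_lt_of_pos _ (by norm_num)))
    rw [zpow_mul, show a ^ (5 : ℤ) = a ^ 5 from zpow_ofNat a 5] at this
    rw [e, ← mul_assoc b, ← (h.commute.zpow_left (i / 5)).eq]
    simpa only [mul_assoc] using this
  -- The core of the enumeration: left multiplication by `b` permutes the listed double cosets into
  -- each other, with five cases for each of the two middle ones.
  have hb : ∀ x ∈ T, b * x ∈ T := by
    rintro x (⟨k, rfl⟩ | ⟨i, k, rfl⟩ | ⟨i, k, rfl⟩ | ⟨k, rfl⟩)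
    · exact hr _ _ t1
    · rw [← mul_assoc, ← mul_assoc]
      refine hr _ _ (mid i b fun r h0 h5 => ?_)
      interval_cases r
      · rw [zpow_zero, mul_one, ← pow_two]; exact t2
      · rw [zpow_one, ← h.braid]; simpa [mul_assoc] using hl 1 _ (hr 1 _ t1)
      · rw [show a ^ (2 : ℤ) = a ^ 2 from zpow_ofNat a 2, h.cube]; simpa using t0 3
      · rw [show a ^ (3 : ℤ) = a ^ 3 from zpow_ofNat a 3, h.mul_pow_three_mul]
        simpa [mul_assoc] using hl 4 _ (hr (-1) _ t1)
      · rw [show a ^ (4 : ℤ) = a ^ 4 from zpow_ofNat a 4, h.mul_pow_four_mul]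
        simpa [mul_assoc] using hl 4 _ (hr (-1) _ t2)
    · rw [← mul_assoc, ← mul_assoc]
      refine hr _ _ (mid i (b ^ 2) fun r h0 h5 => ?_)
      interval_cases r
      · rw [zpow_zero, mul_one, ← pow_succ', ← h.swap.cube]
        simpa [mul_assoc] using hl 1 _ (hr 1 _ t2)
      · rw [zpow_one, show b * a * b ^ 2 = (b * a * b) * b by simp [pow_succ, mul_assoc], ← h.braid,
          show a * b * a * b = a * (b * a * b) by simp [mul_assoc], ← h.braid,
          show a * (a * b * a) = a ^ (2 : ℤ) * (b * a ^ (1 : ℤ)) by simp [pow_succ, mul_assoc]]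
        exact hl 2 _ (hr 1 _ t1)
      · rw [show b * a ^ (2 : ℤ) * b ^ 2 = (b * a ^ 2 * b) * b by simp [pow_succ, mul_assoc], h.cube]
        simpa [mul_assoc] using hl 3 _ t1
      · rw [show b * a ^ (3 : ℤ) * b ^ 2 = (b * a ^ 3 * b) * b by simp [pow_succ, mul_assoc], h.mul_pow_three_mul,
          show a ^ 4 * b * a⁻¹ * b = a ^ 4 * (b * a⁻¹ * b) by simp [pow_succ, mul_assoc], h.mul_inv_mul,
          show a ^ 4 * (a⁻¹ * b ^ 2 * a⁻¹) = a ^ (3 : ℤ) * (b ^ 2 * a ^ (-1 : ℤ)) by simp [pow_succ, mul_assoc]]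
        exact hl 3 _ (hr (-1) _ t2)
      · rw [show b * a ^ (4 : ℤ) * b ^ 2 = (b * a ^ 4 * b) * b by simp [pow_succ, mul_assoc], h.mul_pow_four_mul,
          show a ^ 4 * b ^ 2 * a⁻¹ * b = a ^ (4 : ℤ) * (b ^ 2 * a⁻¹ * b) by simp [pow_succ, mul_assoc]]
        exact hl 4 _ t3
    · rw [← mul_assoc]
      refine hr _ _ ?_
      rw [show b * (b ^ 2 * a⁻¹ * b) = b ^ 3 * a⁻¹ * b by simp [pow_succ, mul_assoc], ← h.swap.cube,
        show a * b ^ 2 * a * a⁻¹ * b = a * b ^ 3 by simp [pow_succ, mul_assoc], ← h.swap.cube,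
        show a * (a * b ^ 2 * a) = a ^ (2 : ℤ) * (b ^ 2 * a ^ (1 : ℤ)) by simp [pow_succ, mul_assoc]]
      exact hl 2 _ (hr 1 _ t2)
  have hbn : ∀ n : ℕ, ∀ x ∈ T, b ^ n * x ∈ T := by
    intro n
    induction n with
    | zero => simp
    | succ n ih =>
      intro x hx
      rw [pow_succ', mul_assoc]
      exact hb _ (ih x hx)
  -- As `b ^ 10 = 1`, the inverse of `b` is a positive power.
  have hbi : ∀ x ∈ T, b⁻¹ * x ∈ T := fun x hx => by
    rw [show b⁻¹ = b ^ 9 by rw [inv_eq_iff_mul_eq_one, ← pow_succ', h.swap.pow_ten]]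
    exact hbn 9 x hx
  change x ∈ T
  induction hx using Subgroup.closure_induction_left with
  | one => simpa using t0 0
  | mul_left x hx y _ hy =>
    rcases hx with rfl | rfl
    · simpa [mul_assoc] using hl 1 y hy
    · exact hb y hy
  | inv_mul_cancel x hx y _ hy =>
    rcases hx with rfl | rfl
    · simpa [mul_assoc] using hl (-1) y hy
    · exact hbi y hy

/-- The relations present the binary icosahedral group: a homomorphism from a group generated by
such a pair is injective as soon as the images of the generators are sufficiently independent. -/
theorem injective (h : IcosahedralPair a b) (hgen : Subgroup.closure {a, b} = ⊤) {G : Type*} [Group G] (Φ : H →* G)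
    (h5 : Φ a ^ 5 ≠ 1) (h2 : Φ a ^ 2 ≠ 1) (hab : Φ a * Φ b ≠ Φ b * Φ a)
    (hab2 : Φ a * Φ b ^ 2 ≠ Φ b ^ 2 * Φ a) : Function.Injective Φ := by
  -- If `a ^ i * y * a ^ k` lies in the kernel, then `Φ y` is a power of `Φ a`.
  have double : ∀ (i k : ℤ) (y : H), Φ (a ^ i * y * a ^ k) = 1 → Commute (Φ a) (Φ y) := by
    intro i k y hy
    have : Φ y = Φ a ^ (-i - k) := by
      rw [map_mul, map_mul, map_zpow, map_zpow] at hy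
      rw [show -i - k = -i + -k by ring, zpow_add, zpow_neg, zpow_neg, eq_mul_inv_iff_mul_eq,
        eq_comm, inv_eq_iff_mul_eq_one, ← mul_assoc, hy]
    rw [this]
    exact Commute.self_zpow _ _
  refine (injective_iff_map_eq_one Φ).2 fun x hx => ?_
  rcases h.normalForm (x := x) (hgen ▸ Subgroup.mem_top x) with
    ⟨k, rfl⟩ | ⟨i, k, rfl⟩ | ⟨i, k, rfl⟩ | ⟨k, rfl⟩
  -- In the first coset, `Φ a` has full order 10, while `a ^ 10 = 1` already holds upstairs.
  · have ho : orderOf (Φ a) = 10 := by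
      refine orderOf_eq_of_pow_and_pow_div_prime (by norm_num)
        (by rw [← map_pow, h.pow_ten, map_one]) fun p hp hd => ?_
      have hp' : p ∈ Nat.primeFactors 10 := Nat.mem_primeFactors.2 ⟨hp, hd, by norm_num⟩
      rw [show Nat.primeFactors 10 = {2, 5} by decide +kernel] at hp'
      rcases Finset.mem_insert.1 hp' with rfl | hp'
      · exact h5
      · rw [Finset.mem_singleton.1 hp']
        exact h2
    rw [map_zpow, ← orderOf_dvd_iff_zpow_eq_one, ho] at hx
    obtain ⟨m, rfl⟩ := hx
    rw [zpow_mul, show a ^ ((10 : ℕ) : ℤ) = a ^ 10 from zpow_natCast a 10, h.pow_ten, one_zpow]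
  · exact absurd (double i k b hx) hab
  · exact absurd (map_pow Φ b 2 ▸ double i k (b ^ 2) hx) hab2
  -- In the last coset, `Φ (b²a⁻¹b)` would both commute with `Φ a` and invert it, forcing `Φ a ^ 2 =
  -- 1`.
  · have hc := double 0 k (b ^ 2 * a⁻¹ * b) (by simpa using hx)
    have hi := congrArg Φ h.inverts
    rw [map_mul Φ a, hc.eq, map_mul Φ _ a⁻¹, mul_right_inj, map_inv, eq_inv_iff_mul_eq_one,
      ← pow_two] at hi
    exact absurd hi h2

end IcosahedralPair

/-! ### Geometric realizations in barycentric coordinates -/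

/-- The geometric realization of the simplicial complex generated by a set `F` of simplices. -/
def barycentricRealization {ι : Type*} [Fintype ι] (F : Set (Finset ι)) : Set (ι → ℝ) :=
  {w | w ∈ stdSimplex ℝ ι ∧ ∃ S ∈ F, ∀ i ∉ S, w i = 0}

section Realization

variable {ι : Type*} [Fintype ι] {F : Set (Finset ι)}

theorem isCompact_barycentricRealization [DecidableEq ι] (F : Set (Finset ι)) :
    IsCompact (barycentricRealization F) := by
  have : barycentricRealization F =
      ⋃ S ∈ F, stdSimplex ℝ ι ∩ ⋂ i ∈ {i | i ∉ S}, {w : ι → ℝ | w i = 0} := by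
    ext w
    simp [barycentricRealization]
  rw [this]
  refine (Set.toFinite F).isCompact_biUnion fun S _ => (isCompact_stdSimplex ℝ ι).inter_right ?_
  exact isClosed_biInter fun i _ => isClosed_eq (continuous_apply i) continuous_const

-- A simplex whose weights include all of `T` contains the barycentre of `T`, so the segment to this
-- barycentre stays in the simplex and keeps the coordinates on `T` positive.
open Classical in
theorem starConvex_star (T : Finset ι) (hT : T.Nonempty) :
    StarConvex ℝ (fun i => if i ∈ T then ((T.card : ℝ))⁻¹ else 0)
      {w | w ∈ barycentricRealization F ∧ ∀ i ∈ T, 0 < w i} := by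
  rintro w ⟨⟨⟨h0, h1⟩, S, hS, hw⟩, hT'⟩ a b ha hb hab
  have hc : 0 < ((T.card : ℝ))⁻¹ := by simpa using hT.card_pos
  refine ⟨⟨⟨fun i => ?_, ?_⟩, S, hS, fun i hi => ?_⟩, fun i hi => ?_⟩
  · have : 0 ≤ (if i ∈ T then ((T.card : ℝ))⁻¹ else 0) := by split_ifs <;> positivity
    exact add_nonneg (mul_nonneg ha this) (mul_nonneg hb (h0 i))
  · simp only [Pi.add_apply, Pi.smul_apply, smul_eq_mul, Finset.sum_add_distrib, ← Finset.mul_sum,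
      h1]
    rw [Finset.sum_ite_mem, Finset.univ_inter, Finset.sum_const, nsmul_eq_mul,
      mul_inv_cancel₀ (inv_pos.1 hc).ne']
    linarith
  · have : i ∉ T := fun h => (hT' i h).ne' (hw i hi)
    simp [this, hw i hi]
  · simp only [Pi.add_apply, Pi.smul_apply, smul_eq_mul, hi, if_true]
    have := hT' i hi
    rcases ha.eq_or_lt with rfl | ha
    · have : b = 1 := by linarith
      subst this
      linarith
    · have := mul_pos ha hc
      have := mul_nonneg hb (hT' i hi).le
      linarith

theorem isSimplyConnected_star [DecidableEq ι] (T : Finset ι) (hT : T.Nonempty)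
    (hne : ∃ w : barycentricRealization F, ∀ i ∈ T, 0 < w.1 i) :
    IsSimplyConnected {w : barycentricRealization F | ∀ i ∈ T, 0 < w.1 i} := by
  rw [← Topology.IsEmbedding.subtypeVal.isSimplyConnected_image]
  have : (Subtype.val '' {w : barycentricRealization F | ∀ i ∈ T, 0 < w.1 i}) =
      {w | w ∈ barycentricRealization F ∧ ∀ i ∈ T, 0 < w i} := by
    ext w
    simp [and_comm]
  rw [this]
  have hne' : {w | w ∈ barycentricRealization F ∧ ∀ i ∈ T, 0 < w i}.Nonempty := by
    obtain ⟨w, hw⟩ := hne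
    exact ⟨w.1, w.2, hw⟩
  have := (starConvex_star (F := F) T hT).contractibleSpace hne'
  exact SimplyConnectedSpace.ofContractible _

/-- The vertex `i` of the geometric realization. -/
theorem single_mem_barycentricRealization [DecidableEq ι] {i : ι} (h : ∃ S ∈ F, i ∈ S) :
    Pi.single i 1 ∈ barycentricRealization F := by
  obtain ⟨S, hS, hi⟩ := h
  refine ⟨single_mem_stdSimplex ℝ i, S, hS, fun j hj => ?_⟩
  rw [Pi.single_eq_of_ne]
  rintro rfl
  exact hj hi

theorem mem_of_pos {w : ι → ℝ} (hw : w ∈ barycentricRealization F) :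
    ∃ S ∈ F, ∀ i, 0 < w i → i ∈ S := by
  obtain ⟨S, hS, h⟩ := hw.2
  exact ⟨S, hS, fun i hi => by_contra fun h' => hi.ne' (h i h')⟩

theorem exists_pos_on {S : Finset ι} (hS : S ∈ F) (hne : S.Nonempty) :
    ∃ w : barycentricRealization F, ∀ i ∈ S, 0 < w.1 i := by
  classical
  have hc : 0 < (S.card : ℝ)⁻¹ := by simpa using hne.card_pos
  refine ⟨⟨fun k => if k ∈ S then (S.card : ℝ)⁻¹ else 0, ⟨⟨fun k => ?_, ?_⟩, S, hS, fun k hk => ?_⟩⟩,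
    fun i hi => ?_⟩
  · dsimp only
    split_ifs
    exacts [hc.le, le_rfl]
  · rw [Finset.sum_ite_mem, Finset.univ_inter, Finset.sum_const, nsmul_eq_mul,
      mul_inv_cancel₀ (inv_pos.1 hc).ne']
  · exact if_neg hk
  · simpa only [hi, if_true] using hc

/-- The open stars of the vertices, if all vertices are adjacent to `o`. -/
theorem starCover_barycentricRealization [DecidableEq ι] {o : ι}
    (ho : ∀ i, ∃ S ∈ F, o ∈ S ∧ i ∈ S) :
    StarCover (fun i => {w : barycentricRealization F | 0 < w.1 i}) o where
  isOpen i := isOpen_lt continuous_const ((continuous_apply i).comp continuous_subtype_val)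
  cover w := by
    by_contra! h
    have h2 := w.2.1.2
    have : ∀ i, w.1 i = 0 := fun i => le_antisymm (not_lt.1 (h i)) (w.2.1.1 i)
    simp [this] at h2
  simplyConnected i := by
    obtain ⟨S, hS, -, hi⟩ := ho i
    obtain ⟨w, hw⟩ := exists_pos_on hS ⟨i, hi⟩
    simpa using isSimplyConnected_star (F := F) {i} (Finset.singleton_nonempty i)
      ⟨w, by simp [hw i hi]⟩
  joinedIn i j x hx y hy := by
    have := isSimplyConnected_star (F := F) {i, j} (Finset.insert_nonempty _ _)
      ⟨x, by simpa using hx⟩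
    have e : {w : barycentricRealization F | ∀ k ∈ ({i, j} : Finset ι), 0 < w.1 k} =
      {w : barycentricRealization F | 0 < w.1 i} ∩ {w | 0 < w.1 j} := by
      ext w
      simp
    rw [e] at this
    exact this.isPathConnected.joinedIn x hx y hy
  meets i := by
    obtain ⟨S, hS, h, hi⟩ := ho i
    obtain ⟨w, hw⟩ := exists_pos_on hS ⟨i, hi⟩
    exact ⟨w, hw o h, hw i hi⟩

/-- A continuous bijection from a geometric realization to a Hausdorff space is a homeomorphism. -/
noncomputable def barycentricHomeo [DecidableEq ι] {Y : Type*} [TopologicalSpace Y] [T2Space Y]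
    (f : barycentricRealization F → Y) (hf : Continuous f) (hb : Function.Bijective f) :
    barycentricRealization F ≃ₜ Y :=
  have : CompactSpace (barycentricRealization F) :=
    isCompact_iff_compactSpace.1 (isCompact_barycentricRealization F)
  Continuous.homeoOfEquivCompactToT2 (f := Equiv.ofBijective f hb) hf

end Realization

/-! ### The 2-skeleton of the spherical dodecahedral space as an abstract complex -/

/-- The vertices of the five-vertex cell structure and the centres of its six pentagons. -/
abbrev SkeletonVertex : Type := Fin 5 ⊕ Fin 6

/-- The five vertices of each of the six pentagons, in cyclic order. -/
def pentagonCycle : Fin 6 → Fin 5 → Fin 5 :=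
  ![![0, 2, 1, 4, 3], ![0, 3, 1, 2, 4], ![0, 2, 3, 1, 4],
    ![0, 1, 2, 3, 4], ![0, 1, 3, 4, 2], ![0, 1, 4, 2, 3]]

/-- The position of a vertex on the boundary of a pentagon. -/
def pentagonPosition : Fin 6 → Fin 5 → Fin 5 :=
  ![![0, 2, 1, 4, 3], ![0, 2, 3, 1, 4], ![0, 3, 1, 2, 4],
    ![0, 1, 2, 3, 4], ![0, 1, 4, 2, 3], ![0, 1, 3, 4, 2]]

/-- The triangle of the `j`-th pentagon over its `i`-th edge. -/
def skeletonTriangle (j : Fin 6) (i : Fin 5) : Finset SkeletonVertex :=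
  {.inr j, .inl (pentagonCycle j i), .inl (pentagonCycle j (i + 1))}

/-- The triangles of the 2-skeleton: every pentagon is subdivided from its centre. -/
def skeletonFacets : Set (Finset SkeletonVertex) :=
  Set.range fun t : Fin 6 × Fin 5 => skeletonTriangle t.1 t.2

theorem pentagonPosition_cycle (j : Fin 6) (i : Fin 5) :
    pentagonPosition j (pentagonCycle j i) = i := by
  revert j i
  decide

/-- Each pentagon visits all five vertices, so all can be listed from the base vertex. The edges at
0 serve as a maximal tree, and only the three middle edges of each pentagon enter its relation. -/
theorem pentagonCycle_zero (j : Fin 6) : pentagonCycle j 0 = 0 := by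
  revert j
  decide

theorem skeletonTriangle_mem (j : Fin 6) (i : Fin 5) : skeletonTriangle j i ∈ skeletonFacets :=
  ⟨(j, i), rfl⟩

theorem exists_skeletonFacet (u v : Fin 5) :
    ∃ S ∈ skeletonFacets, Sum.inl u ∈ S ∧ Sum.inl v ∈ S := by
  have : ∀ u v : Fin 5, ∃ j i, Sum.inl u ∈ skeletonTriangle j i ∧ Sum.inl v ∈ skeletonTriangle j i := by
    decide +kernel
  obtain ⟨j, i, h⟩ := this u v
  exact ⟨_, skeletonTriangle_mem j i, h⟩

theorem exists_skeletonFacet_base (v : SkeletonVertex) :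
    ∃ S ∈ skeletonFacets, Sum.inl 0 ∈ S ∧ v ∈ S := by
  have : ∀ v : SkeletonVertex, ∃ j i, Sum.inl 0 ∈ skeletonTriangle j i ∧
      v ∈ skeletonTriangle j i := by
    decide +kernel
  obtain ⟨j, i, h⟩ := this v
  exact ⟨_, skeletonTriangle_mem j i, h⟩

/-- The space of the 2-skeleton, in barycentric coordinates. -/
abbrev SkeletonSpace : Type := barycentricRealization skeletonFacets

theorem skeleton_starCover :
    StarCover (fun i => {w : SkeletonSpace | 0 < w.1 i}) (.inl 0) :=
  starCover_barycentricRealization exists_skeletonFacet_base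

/-! ### The six pentagon relations -/

section Algebra

variable {H : Type*} [Group H]

/-- The edge labels on the complete graph with five vertices belonging to a pair `(a, b)`. -/
def pairLabel (a b : H) : Fin 5 → Fin 5 → H :=
  ![![1, 1, 1, 1, 1],
    ![1, 1, a, b, a * b * a⁻¹],
    ![1, a⁻¹, 1, b * a * b⁻¹ * a⁻¹, b * a⁻¹],
    ![1, b⁻¹, a * b * a⁻¹ * b⁻¹, 1, b * a⁻¹ * b⁻¹],
    ![1, a * b⁻¹ * a⁻¹, a * b⁻¹, b * a * b⁻¹, 1]]

theorem pairLabel_symm (a b : H) (u v : Fin 5) : pairLabel a b v u = (pairLabel a b u v)⁻¹ := by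
  fin_cases u <;> fin_cases v <;> simp [pairLabel, mul_assoc]

theorem pairLabel_self (a b : H) (u : Fin 5) : pairLabel a b u u = 1 := by
  fin_cases u <;> simp [pairLabel]

theorem pairLabel_zero (a b : H) (u : Fin 5) : pairLabel a b 0 u = 1 := by
  fin_cases u <;> simp [pairLabel]

/-- The labels are chosen so that pentagons 1 to 4 close up identically. Pentagons 0 and 5 both
reduce, by the braid relation, to one form of the cube relation. -/
theorem IcosahedralPair.pairLabel_cycle {a b : H} (h : IcosahedralPair a b) (j : Fin 6) :
    pairLabel a b (pentagonCycle j 3) (pentagonCycle j 4) *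
      pairLabel a b (pentagonCycle j 2) (pentagonCycle j 3) *
      pairLabel a b (pentagonCycle j 1) (pentagonCycle j 2) = 1 := by
  have h3 : b * a * b⁻¹ = a⁻¹ * b * a := by
    rw [mul_inv_eq_iff_eq_mul, eq_comm, mul_assoc, mul_assoc, ← mul_assoc b, ← h.braid]
    simp [mul_assoc]
  have key : a⁻¹ * b * a * (a * b * a⁻¹) * a⁻¹ = 1 := by
    rw [show a⁻¹ * b * a * (a * b * a⁻¹) * a⁻¹ = a⁻¹ * (b * a ^ 2 * b) * a⁻¹ * a⁻¹ by
      simp [pow_succ, mul_assoc], h.cube]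
    simp [pow_succ, mul_assoc]
  fin_cases j
  · change b * a * b⁻¹ * (a * b * a⁻¹) * a⁻¹ = 1
    rw [h3]
    exact key
  · change b * a⁻¹ * a * b⁻¹ = 1
    simp
  · change a * b * a⁻¹ * b⁻¹ * (b * a * b⁻¹ * a⁻¹) = 1
    simp [mul_assoc]
  · change b * a⁻¹ * b⁻¹ * (b * a * b⁻¹ * a⁻¹) * a = 1
    simp [mul_assoc]
  · change a * b⁻¹ * (b * a⁻¹ * b⁻¹) * b = 1
    simp [mul_assoc]
  · change b * a * b⁻¹ * a⁻¹ * (a * b⁻¹) * (a * b * a⁻¹) = 1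
    rw [show b * a * b⁻¹ * a⁻¹ * (a * b⁻¹) * (a * b * a⁻¹) = b * a * b⁻¹ * (b⁻¹ * a * b) * a⁻¹ by
      simp [mul_assoc], h3, h.inv_mul_mul]
    exact key

/-- Pentagons 1 to 4 express the remaining four labels through `X 1 2` and `X 1 3`; pentagons 0 and
5 are then the relations between these two. -/
theorem icosahedralPair_of_cycle (X : Fin 5 → Fin 5 → H) (hs : ∀ u, X u u = 1)
    (hX : ∀ u v, X v u = (X u v)⁻¹)
    (hc : ∀ j, X (pentagonCycle j 3) (pentagonCycle j 4) *
      X (pentagonCycle j 2) (pentagonCycle j 3) * X (pentagonCycle j 1) (pentagonCycle j 2) = 1) :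
    IcosahedralPair (X 1 2) (X 1 3) ∧
      ∀ u v, u ≠ 0 → v ≠ 0 → X u v = pairLabel (X 1 2) (X 1 3) u v := by
  have r0 : X 4 3 * X 1 4 * X 2 1 = 1 := hc 0
  have r1 : X 2 4 * X 1 2 * X 3 1 = 1 := hc 1
  have r2 : X 1 4 * X 3 1 * X 2 3 = 1 := hc 2
  have r3 : X 3 4 * X 2 3 * X 1 2 = 1 := hc 3
  have r4 : X 4 2 * X 3 4 * X 1 3 = 1 := hc 4
  have r5 : X 2 3 * X 4 2 * X 1 4 = 1 := hc 5
  rw [hX 3 4, hX 1 2] at r0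
  rw [hX 1 3] at r1 r2
  rw [hX 2 4] at r4 r5
  have h21 := hX 1 2
  have h31 := hX 1 3
  have h41 := hX 1 4
  have h32 := hX 2 3
  have h42 := hX 2 4
  have h43 := hX 3 4
  generalize h12 : X 1 2 = a at *
  generalize h13 : X 1 3 = b at *
  have hf : X 2 4 = b * a⁻¹ := by
    rw [mul_inv_eq_one] at r1
    rw [eq_mul_inv_iff_mul_eq, r1]
  have he : X 3 4 = a⁻¹ * (X 2 3)⁻¹ := by
    rw [mul_assoc, mul_eq_one_iff_eq_inv] at r3
    rw [r3, mul_inv_rev]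
  rw [hf, he] at r4
  have hc' : X 2 3 = b * a * b⁻¹ * a⁻¹ := by
    have : a⁻¹ * (X 2 3)⁻¹ = b * a⁻¹ * b⁻¹ := by
      rw [eq_mul_inv_iff_mul_eq, eq_comm, ← inv_mul_eq_one, ← mul_assoc]
      exact r4
    rw [inv_mul_eq_iff_eq_mul, inv_eq_iff_eq_inv] at this
    rw [this]
    simp [mul_assoc]
  rw [hc'] at he r2 r5
  have hd : X 1 4 = a * b * a⁻¹ := by
    rw [mul_assoc, mul_eq_one_iff_eq_inv] at r2
    rw [r2]
    simp [mul_assoc]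
  have he' : X 3 4 = b * a⁻¹ * b⁻¹ := by
    rw [he]
    simp [mul_assoc]
  rw [hd, he'] at r0
  rw [hd, hf] at r5
  -- Pentagon 0 after elimination. Inserted into pentagon 5 it gives the braid relation, and with
  -- that it turns into the cube relation.
  have q0 : b * a * b⁻¹ = a ^ 2 * b⁻¹ * a⁻¹ := by
    rw [eq_mul_inv_iff_mul_eq, eq_mul_inv_iff_mul_eq]
    rw [mul_inv_eq_one] at r0
    calc b * a * b⁻¹ * a * b = ((b * a⁻¹ * b⁻¹)⁻¹ * (a * b * a⁻¹)) * a := by simp [mul_assoc]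
      _ = a ^ 2 := by rw [r0, pow_two]
  have braid : a * b * a = b * a * b := by
    have e : (b * a * b⁻¹) * b⁻¹ * a * b * a⁻¹ = 1 := by
      rw [← r5]
      simp [mul_assoc]
    rw [q0] at e
    have e2 : a * (a * b⁻¹ * a⁻¹ * b⁻¹ * a * b) * a⁻¹ = 1 := by
      rw [← e]
      simp [pow_two, mul_assoc]
    rw [mul_inv_eq_one, mul_eq_left] at e2
    have e3 : (a * b⁻¹ * a⁻¹ * b⁻¹) * (a * b) = 1 := by rw [← e2]; simp [mul_assoc]
    rw [mul_eq_one_iff_inv_eq] at e3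
    rw [← e3]
    simp [mul_assoc]
  have cube : b * a ^ 2 * b = a ^ 3 := by
    have e : b⁻¹ * a * b = a * b * a⁻¹ := by
      rw [eq_mul_inv_iff_mul_eq, mul_assoc b⁻¹, mul_assoc b⁻¹, braid]
      simp [mul_assoc]
    rw [eq_mul_inv_iff_mul_eq, eq_mul_inv_iff_mul_eq] at q0
    calc b * a ^ 2 * b = b * a * (a * b * a⁻¹) * a := by simp [pow_two, mul_assoc]
      _ = (b * a * b⁻¹ * a * b) * a := by rw [← e]; simp [mul_assoc]
      _ = a ^ 3 := by rw [q0, pow_succ a 2]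
  refine ⟨⟨braid, cube⟩, fun u v hu hv => ?_⟩
  have s1 := hs 1
  have s2 := hs 2
  have s3 := hs 3
  have s4 := hs 4
  fin_cases u <;> fin_cases v <;>
    simp [pairLabel, mul_assoc, s1, s2, s3, s4, h12, h13, hd, he', hf, hc', h21, h31, h41, h32, h42, h43] at hu hv ⊢

end Algebra

/-! ### The fundamental group of the combinatorial 2-skeleton -/

section Loops

variable {G : Type*} [Group G]

/-- The potential of the edge labels on the boundary of a pentagon. -/
def pentagonPotential (k : Fin 5 → Fin 5 → G) (j : Fin 6) : Fin 5 → G :=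
  ![1, 1, k (pentagonCycle j 1) (pentagonCycle j 2),
    k (pentagonCycle j 2) (pentagonCycle j 3) * k (pentagonCycle j 1) (pentagonCycle j 2), 1]

/-- The extension of edge labels on the complete graph to the centres of the pentagons. -/
def extendLabel (k : Fin 5 → Fin 5 → G) : SkeletonVertex → SkeletonVertex → G
  | .inl u, .inl v => k u v
  | .inr j, .inl v => pentagonPotential k j (pentagonPosition j v)
  | .inl v, .inr j => (pentagonPotential k j (pentagonPosition j v))⁻¹
  -- Distinct centres never share a facet, so only the value for equal centres matters.
  | .inr _, .inr _ => 1

/-- On a single pentagon the labels are differences of a potential `q`, equal to 1 at the centre;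
such differences always form a cocycle. -/
theorem extendLabel_cocycle (k : Fin 5 → Fin 5 → G) (hs : ∀ u, k u u = 1)
    (hk : ∀ u v, k v u = (k u v)⁻¹) (h0 : ∀ v, k 0 v = 1)
    (hc : ∀ j, k (pentagonCycle j 3) (pentagonCycle j 4) *
      k (pentagonCycle j 2) (pentagonCycle j 3) * k (pentagonCycle j 1) (pentagonCycle j 2) = 1)
    {S : Finset SkeletonVertex} (hS : S ∈ skeletonFacets) {u v w : SkeletonVertex}
    (hu : u ∈ S) (hv : v ∈ S) (hw : w ∈ S) :
    extendLabel k v w * extendLabel k u v = extendLabel k u w := by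
  obtain ⟨⟨j, i⟩, rfl⟩ := hS
  dsimp only at hu hv hw
  let q : SkeletonVertex → G :=
    Sum.elim (fun v => pentagonPotential k j (pentagonPosition j v)) fun _ => 1
  have hp0 : pentagonCycle j 0 = 0 := pentagonCycle_zero j
  -- The potential is defined by the first steps around the pentagon; the pentagon relation is
  -- needed only from position 3 to position 4.
  have hstep : ∀ i, k (pentagonCycle j i) (pentagonCycle j (i + 1)) =
      pentagonPotential k j (i + 1) * (pentagonPotential k j i)⁻¹ := by
    intro i
    have := hc j
    fin_cases i
    · change k (pentagonCycle j 0) _ = 1 * 1⁻¹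
      rw [hp0, h0, inv_one, one_mul]
    · change _ = k _ _ * 1⁻¹
      rw [inv_one, mul_one]
      rfl
    · change _ = k _ _ * k _ _ * (k _ _)⁻¹
      rw [mul_inv_cancel_right]
      rfl
    · change k (pentagonCycle j 3) (pentagonCycle j 4) = 1 * (k _ _ * k _ _)⁻¹
      rw [one_mul, eq_inv_iff_mul_eq_one, ← mul_assoc, this]
    · change k (pentagonCycle j 4) (pentagonCycle j 0) = 1 * 1⁻¹
      rw [hp0, hk, h0, inv_one, one_mul]
  have key : ∀ u ∈ skeletonTriangle j i, ∀ v ∈ skeletonTriangle j i,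
      extendLabel k u v = q v * (q u)⁻¹ := by
    intro u hu v hv
    simp only [skeletonTriangle, Finset.mem_insert, Finset.mem_singleton] at hu hv
    rcases hu with rfl | rfl | rfl <;> rcases hv with rfl | rfl | rfl <;>
      simp only [extendLabel, q, Sum.elim_inl, Sum.elim_inr, pentagonPosition_cycle, hs, hstep,
        inv_one, mul_one, one_mul, mul_inv_cancel]
    rw [hk, hstep, mul_inv_rev, inv_inv]
  rw [key v hv w hw, key u hu v hv, key u hu w hw]
  simp [mul_assoc]

/-- The fundamental group of the 2-skeleton, through a homomorphism to a group `G` given by a pair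
of elements satisfying the icosahedral relations. -/
theorem exists_injective_hom_skeleton {a b : G} (h : IcosahedralPair a b) (h5 : a ^ 5 ≠ 1)
    (h2 : a ^ 2 ≠ 1) (hab : a * b ≠ b * a) (hab2 : a * b ^ 2 ≠ b ^ 2 * a) :
    ∃ (x₀ : SkeletonSpace) (Φ : FundamentalGroup SkeletonSpace x₀ →* G),
      Function.Injective Φ ∧ Φ.range = Subgroup.closure {a, b} := by
  let x₀ : SkeletonSpace := ⟨Pi.single (.inl 0) 1, single_mem_barycentricRealization
    ((exists_skeletonFacet_base (.inl 0)).imp fun S hS => ⟨hS.1, hS.2.1⟩)⟩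
  have hx₀ : x₀ ∈ {w : SkeletonSpace | 0 < w.1 (.inl 0)} := by
    simp [x₀]
  have hU := skeleton_starCover
  have hco := fun {S} hS {u v w} => extendLabel_cocycle (pairLabel a b) (pairLabel_self a b)
    (pairLabel_symm a b) (pairLabel_zero a b) h.pairLabel_cycle (S := S) hS (u := u) (v := v)
    (w := w)
  have hbase : ∀ i, extendLabel (pairLabel a b) (.inl 0) i = 1 := by
    have hpos : ∀ j, pentagonPosition j 0 = 0 := by decide
    rintro (v | j)
    · exact pairLabel_zero a b v
    · simp [extendLabel, hpos, pentagonPotential]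
  obtain ⟨Φ, hΦ⟩ := hU.exists_hom (g := extendLabel (pairLabel a b)) (fun i j k hne => by
    obtain ⟨w, ⟨hi, hj⟩, hk⟩ := hne
    obtain ⟨S, hS, hpos⟩ := mem_of_pos w.2
    exact hco hS (hpos i hi) (hpos j hj) (hpos k hk)) hbase hx₀
  set e := hU.edge hx₀ with he
  have hmul : ∀ {S} (_ : S ∈ skeletonFacets) {u v w : SkeletonVertex} (_ : u ∈ S) (_ : v ∈ S)
      (_ : w ∈ S), e v w * e u v = e u w := by
    intro S hS u v w hu hv hw
    obtain ⟨x, hx⟩ := exists_pos_on hS ⟨u, hu⟩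
    exact hU.edge_mul_edge hx₀ ⟨x, ⟨hx u hu, hx v hv⟩, hx w hw⟩
  have hbase' : ∀ i, e (.inl 0) i = 1 := fun i => hU.edge_base hx₀ i
  have hself : ∀ v, e v v = 1 := by
    intro v
    obtain ⟨S, hS, -, hv⟩ := exists_skeletonFacet_base v
    exact mul_eq_left.1 (hmul hS hv hv hv)
  have hinv : ∀ {S} (_ : S ∈ skeletonFacets) {u v : SkeletonVertex} (_ : u ∈ S) (_ : v ∈ S),
      e v u = (e u v)⁻¹ := fun {_} hS {u v} hu hv =>
    eq_inv_of_mul_eq_one_left ((hmul hS hu hv hu).trans (hself u))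
  have hback : ∀ v, e v (.inl 0) = 1 := by
    intro v
    obtain ⟨S, hS, h0, hv⟩ := exists_skeletonFacet_base v
    rw [hinv hS h0 hv, hbase', inv_one]
  have hX : ∀ u v : Fin 5, e (.inl v) (.inl u) = (e (.inl u) (.inl v))⁻¹ := fun u v => by
    obtain ⟨S, hS, hu, hv⟩ := exists_skeletonFacet u v
    exact hinv hS hu hv
  have hstep : ∀ j i, e (.inr j) (.inl (pentagonCycle j (i + 1))) =
      e (.inl (pentagonCycle j i)) (.inl (pentagonCycle j (i + 1))) *
        e (.inr j) (.inl (pentagonCycle j i)) := fun j i =>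
    (hmul (skeletonTriangle_mem j i) (by simp [skeletonTriangle]) (by simp [skeletonTriangle])
      (by simp [skeletonTriangle])).symm
  have e0 : ∀ j, e (.inr j) (.inl (pentagonCycle j 0)) = 1 := fun j => by
    rw [pentagonCycle_zero, hback]
  have e1 : ∀ j, e (.inr j) (.inl (pentagonCycle j 1)) = 1 := fun j => by
    have := hstep j 0
    rwa [e0, mul_one, pentagonCycle_zero, hbase'] at this
  have e2 : ∀ j, e (.inr j) (.inl (pentagonCycle j 2)) =
      e (.inl (pentagonCycle j 1)) (.inl (pentagonCycle j 2)) := fun j => by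
    have := hstep j 1
    rwa [e1, mul_one] at this
  have e3 : ∀ j, e (.inr j) (.inl (pentagonCycle j 3)) =
      e (.inl (pentagonCycle j 2)) (.inl (pentagonCycle j 3)) *
        e (.inl (pentagonCycle j 1)) (.inl (pentagonCycle j 2)) := fun j => by
    have := hstep j 2
    rwa [e2] at this
  -- Read backwards from the tree edge that returns to vertex 0. Comparison with `e3` will produce
  -- the pentagon relation.
  have e4 : ∀ j, e (.inr j) (.inl (pentagonCycle j 4)) = 1 := fun j => by
    have := hstep j 4
    rw [show (4 : Fin 5) + 1 = 0 from rfl, e0, pentagonCycle_zero, hback, one_mul] at this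
    exact this.symm
  obtain ⟨hpair, hlab⟩ := icosahedralPair_of_cycle (fun u v => e (.inl u) (.inl v))
    (fun u => hself _) hX fun j => by
      have := hstep j 3
      rw [show (3 : Fin 5) + 1 = 4 from rfl, e4, e3, ← mul_assoc] at this
      exact this.symm
  set a' := e (.inl 1) (.inl 2) with ha'
  set b' := e (.inl 1) (.inl 3) with hb'
  have hK : ∀ u v : Fin 5, e (.inl u) (.inl v) ∈ Subgroup.closure {a', b'} := by
    intro u v
    by_cases hu : u = 0
    · rw [hu, hbase']
      exact one_mem _
    by_cases hv : v = 0
    · rw [hv, hback]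
      exact one_mem _
    have hA : a' ∈ Subgroup.closure {a', b'} := Subgroup.subset_closure (by simp)
    have hB : b' ∈ Subgroup.closure {a', b'} := Subgroup.subset_closure (by simp)
    rw [hlab u v hu hv]
    generalize Subgroup.closure {a', b'} = N at hA hB
    have hA' := inv_mem hA
    have hB' := inv_mem hB
    fin_cases u <;> fin_cases v <;> simp only [pairLabel] <;>
      repeat' (first | exact one_mem N | assumption | apply mul_mem)
  have hC : ∀ j i, e (.inr j) (.inl (pentagonCycle j i)) ∈ Subgroup.closure {a', b'} := by
    intro j i
    fin_cases i
    · exact (e0 j).symm ▸ one_mem _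
    · exact (e1 j).symm ▸ one_mem _
    · exact (e2 j).symm ▸ hK _ _
    · exact (e3 j).symm ▸ mul_mem (hK _ _) (hK _ _)
    · exact (e4 j).symm ▸ one_mem _
  -- Every edge of a facet factors through the centre of its pentagon, whose edges are products of
  -- edges between the five vertices.
  have htop : Subgroup.closure {a', b'} = ⊤ := by
    rw [eq_top_iff, ← hU.closure_edge_eq_top hx₀, Subgroup.closure_le]
    rintro _ ⟨u, v, ⟨x, hxu, hxv⟩, rfl⟩
    obtain ⟨S, ⟨⟨j, i⟩, rfl⟩, hpos⟩ := mem_of_pos x.2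
    have hu := hpos u hxu
    have hv := hpos v hxv
    have hcen : Sum.inr j ∈ skeletonTriangle j i := by simp [skeletonTriangle]
    have hS := skeletonTriangle_mem j i
    have hmem : ∀ v ∈ skeletonTriangle j i, e (.inr j) v ∈ Subgroup.closure {a', b'} := by
      intro v hv
      simp only [skeletonTriangle, Finset.mem_insert, Finset.mem_singleton] at hv
      rcases hv with rfl | rfl | rfl
      · rw [hself]
        exact one_mem _
      · exact hC j i
      · exact hC j (i + 1)
    change e u v ∈ Subgroup.closure {a', b'}
    rw [← hmul hS hu hcen hv, hinv hS hcen hu]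
    exact mul_mem (hmem v hv) (inv_mem (hmem u hu))
  have hΦe : ∀ u v : Fin 5, Φ (e (.inl u) (.inl v)) = pairLabel a b u v := by
    intro u v
    obtain ⟨S, hS, hu, hv⟩ := exists_skeletonFacet u v
    obtain ⟨x, hx⟩ := exists_pos_on hS ⟨_, hu⟩
    exact hΦ _ _ ⟨x, hx _ hu, hx _ hv⟩
  have hΦa : Φ a' = a := hΦe 1 2
  have hΦb : Φ b' = b := hΦe 1 3
  refine ⟨x₀, Φ, hpair.injective htop Φ ?_ ?_ ?_ ?_, ?_⟩
  · rwa [hΦa]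
  · rwa [hΦa]
  · rwa [hΦa, hΦb]
  · rwa [hΦa, hΦb]
  · rw [MonoidHom.range_eq_map, ← htop, MonoidHom.map_closure, Set.image_pair, hΦa, hΦb]

end Loops

/-! ### The binary icosahedral group -/

/-- The quaternion with the given coordinates. -/
def quat (a b c d : ℝ) : ℍ[ℝ] := ⟨a, b, c, d⟩

theorem quat_mul_quat (a b c d a' b' c' d' : ℝ) :
    quat a b c d * quat a' b' c' d' =
      quat (a * a' - b * b' - c * c' - d * d') (a * b' + b * a' + c * d' - d * c')
        (a * c' - b * d' + c * a' + d * b') (a * d' + b * c' - c * b' + d * a') := by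
  refine (QuaternionAlgebra.mk_mul_mk ..).trans ?_
  rw [quat]
  congr 1 <;> ring

theorem quat_one : (1 : ℍ[ℝ]) = quat 1 0 0 0 := rfl

theorem quat_congr {a b c d a' b' c' d' : ℝ} (h₁ : a = a') (h₂ : b = b') (h₃ : c = c')
    (h₄ : d = d') : quat a b c d = quat a' b' c' d' := by
  rw [h₁, h₂, h₃, h₄]

theorem goldenRatio_inv_eq : (φ : ℝ)⁻¹ = φ - 1 :=
  inv_eq_of_mul_eq_one_right (by linear_combination Real.goldenRatio_sq)

/-- The generator `(1 + i + j + k) / 2`. -/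
noncomputable def icosianS : ℍ[ℝ]ˣ where
  val := quat (1 / 2) (1 / 2) (1 / 2) (1 / 2)
  inv := quat (1 / 2) (-1 / 2) (-1 / 2) (-1 / 2)
  val_inv := by rw [quat_mul_quat, quat_one]; apply quat_congr <;> norm_num
  inv_val := by rw [quat_mul_quat, quat_one]; apply quat_congr <;> norm_num

/-- The generator `(φ + φ⁻¹ i + j) / 2`. -/
noncomputable def icosianT : ℍ[ℝ]ˣ where
  val := quat (φ / 2) (φ⁻¹ / 2) (1 / 2) 0
  inv := quat (φ / 2) (-φ⁻¹ / 2) (-1 / 2) 0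
  val_inv := by
    have h := Real.goldenRatio_sq
    rw [quat_mul_quat, goldenRatio_inv_eq, quat_one]
    generalize φ = p at h
    apply quat_congr
    · linear_combination (1 / 2 : ℝ) * h
    all_goals ring
  inv_val := by
    have h := Real.goldenRatio_sq
    rw [quat_mul_quat, goldenRatio_inv_eq, quat_one]
    generalize φ = p at h
    apply quat_congr
    · linear_combination (1 / 2 : ℝ) * h
    all_goals ring

theorem binaryIcosahedralGroup_eq :
    binaryIcosahedralGroup = Subgroup.closure {icosianS, icosianT} := by
  rw [binaryIcosahedralGroup]
  congr 1
  ext q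
  simp only [Set.mem_ofPred_eq, Set.mem_insert_iff, Set.mem_singleton_iff, Units.ext_iff]
  rfl

theorem val_icosianS : (icosianS : ℍ[ℝ]) = quat (1 / 2) (1 / 2) (1 / 2) (1 / 2) := rfl

theorem val_icosianT : (icosianT : ℍ[ℝ]) = quat (φ / 2) ((φ - 1) / 2) (1 / 2) 0 := by
  rw [← goldenRatio_inv_eq]
  rfl

theorem icosianS_mul_icosianT :
    ((icosianS * icosianT : ℍ[ℝ]ˣ) : ℍ[ℝ]) = quat 0 ((φ - 1) / 2) (φ / 2) (1 / 2) := by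
  rw [Units.val_mul, val_icosianS, val_icosianT, quat_mul_quat]
  generalize φ = p
  apply quat_congr <;> ring

theorem icosianT_sq : ((icosianT ^ 2 : ℍ[ℝ]ˣ) : ℍ[ℝ]) = quat ((φ - 1) / 2) (1 / 2) (φ / 2) 0 := by
  have h := Real.goldenRatio_sq
  rw [pow_two, Units.val_mul, val_icosianT, quat_mul_quat]
  generalize φ = p at h
  apply quat_congr
  · linear_combination
  · linear_combination (1 / 2 : ℝ) * h
  · ring
  · ring

/-- Together with `STS = T⁴` this yields the icosahedral relations for `a = T` and `b = T⁻¹S`, where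
`ab = S`. -/
theorem icosianT_mul_icosianS_mul_icosianT :
    icosianT * icosianS * icosianT = icosianS ^ 2 := by
  have h := Real.goldenRatio_sq
  rw [pow_two, Units.ext_iff, mul_assoc, Units.val_mul, icosianS_mul_icosianT, Units.val_mul,
    val_icosianS, val_icosianT, quat_mul_quat, quat_mul_quat]
  generalize φ = p at h
  apply quat_congr
  · linear_combination (-1 / 4 : ℝ) * h
  · linear_combination (1 / 4 : ℝ) * h
  · linear_combination (1 / 4 : ℝ) * h
  · linear_combination (1 / 4 : ℝ) * h

theorem icosianS_mul_icosianT_mul_icosianS :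
    icosianS * icosianT * icosianS = icosianT ^ 4 := by
  have h := Real.goldenRatio_sq
  rw [show icosianT ^ 4 = icosianT ^ 2 * icosianT ^ 2 by rw [← pow_add], Units.ext_iff,
    Units.val_mul, icosianS_mul_icosianT, Units.val_mul, icosianT_sq,
    val_icosianS, quat_mul_quat, quat_mul_quat]
  generalize φ = p at h
  apply quat_congr
  · ring
  · ring
  · linear_combination (-1 / 2 : ℝ) * h
  · ring

/-- The braid relation amounts to `TST = S²` and the cube relation to `STS = T⁴`. -/
theorem icosahedralPair_icosian : IcosahedralPair icosianT (icosianT⁻¹ * icosianS) where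
  braid := by
    rw [mul_inv_cancel_left, show icosianT⁻¹ * icosianS * icosianT * (icosianT⁻¹ * icosianS) =
      icosianT⁻¹ * icosianS ^ 2 by simp [pow_two, mul_assoc], ← icosianT_mul_icosianS_mul_icosianT]
    simp [mul_assoc]
  cube := by
    rw [show icosianT⁻¹ * icosianS * icosianT ^ 2 * (icosianT⁻¹ * icosianS) =
      icosianT⁻¹ * (icosianS * icosianT * icosianS) by simp [pow_two, mul_assoc],
      icosianS_mul_icosianT_mul_icosianS, pow_succ' _ 3, inv_mul_cancel_left]

theorem icosian_not_commute :
    icosianT * (icosianT⁻¹ * icosianS) ≠ icosianT⁻¹ * icosianS * icosianT := by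
  intro h
  rw [mul_inv_cancel_left, mul_assoc, eq_inv_mul_iff_mul_eq] at h
  have h2 := congrArg (fun q : ℍ[ℝ]ˣ => (q : ℍ[ℝ]).imI) h
  rw [icosianS_mul_icosianT, Units.val_mul, val_icosianS, val_icosianT, quat_mul_quat] at h2
  change φ / 2 * (1 / 2) + (φ - 1) / 2 * (1 / 2) + 1 / 2 * (1 / 2) - 0 * (1 / 2) = (φ - 1) / 2 at h2
  linarith

/-- One has `T⁵ = STS · T = (ST)²`, and `ST` has real part 0, so its square has negative real part.
-/
theorem icosianT_pow_five_ne : icosianT ^ 5 ≠ 1 := by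
  have h := Real.goldenRatio_sq
  intro h1
  rw [pow_succ, ← icosianS_mul_icosianT_mul_icosianS, mul_assoc] at h1
  have h2 := congrArg (fun q : ℍ[ℝ]ˣ => (q : ℍ[ℝ]).re) h1
  rw [Units.val_mul, icosianS_mul_icosianT, quat_mul_quat] at h2
  change 0 * 0 - (φ - 1) / 2 * ((φ - 1) / 2) - φ / 2 * (φ / 2) - 1 / 2 * (1 / 2) = (1 : ℝ) at h2
  generalize φ = p at h h2
  nlinarith

theorem icosianT_sq_ne : icosianT ^ 2 ≠ 1 := by
  intro h1
  have h2 := congrArg (fun q : ℍ[ℝ]ˣ => (q : ℍ[ℝ]).imI) h1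
  rw [icosianT_sq] at h2
  change (1 : ℝ) / 2 = 0 at h2
  norm_num at h2

/-- The fundamental group of the 2-skeleton is the binary icosahedral group. -/
theorem exists_mulEquiv_fundamentalGroup_skeleton :
    ∃ x₀ : SkeletonSpace, Nonempty (FundamentalGroup SkeletonSpace x₀ ≃* binaryIcosahedralGroup) := by
  have hpair := icosahedralPair_icosian
  obtain ⟨x₀, Φ, hinj, hrange⟩ := exists_injective_hom_skeleton hpair icosianT_pow_five_ne
    -- If `a` commuted with `b²`, then `ab²a = b³` would give `a² = b`, which commutes with `a`.
    icosianT_sq_ne icosian_not_commute fun h => by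
      have h2 := hpair.swap.cube
      rw [h, mul_assoc, ← pow_two, pow_succ _ 2, mul_right_inj] at h2
      apply icosian_not_commute
      rw [← h2]
      exact (Commute.self_pow icosianT 2).eq
  refine ⟨x₀, ⟨(MonoidHom.ofInjective hinj).trans (MulEquiv.subgroupCongr ?_)⟩⟩
  rw [hrange, binaryIcosahedralGroup_eq]
  refine le_antisymm ?_ ?_ <;> rw [Subgroup.closure_le] <;> rintro _ (rfl | rfl)
  · exact Subgroup.subset_closure (by simp)
  · exact mul_mem (inv_mem (Subgroup.subset_closure (by simp))) (Subgroup.subset_closure (by simp))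
  · rw [← mul_inv_cancel_left icosianT icosianS]
    exact mul_mem (Subgroup.subset_closure (by simp)) (Subgroup.subset_closure (by simp))
  · exact Subgroup.subset_closure (by simp)

/-! ### Rectilinear realizations -/

section Placement

variable {ι E : Type*} [Fintype ι] [AddCommGroup E] [Module ℝ E]
  {F : Set (Finset ι)} {x : ι → E}

/-- Points `x i` such that the convex hulls of the simplices in `F` are simplices that meet in
common faces; the condition is stated for homogeneous barycentric coordinates. -/
def IsEmbeddedPlacement (F : Set (Finset ι)) (x : ι → E) : Prop :=
  ∀ S ∈ F, ∀ T ∈ F, ∀ w w' : ι → ℝ, (∀ i, 0 ≤ w i) → (∀ i, 0 ≤ w' i) →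
    (∀ i ∉ S, w i = 0) → (∀ i ∉ T, w' i = 0) → ∑ i, w i = ∑ i, w' i →
    ∑ i, w i • x i = ∑ i, w' i • x i → w = w'

/-- The positive and negative parts of `w` are two weight systems on the same simplex with the same
total and the same image. Totals other than 1 must be allowed for this. -/
theorem IsEmbeddedPlacement.eq_zero (h : IsEmbeddedPlacement F x) {S : Finset ι} (hS : S ∈ F)
    {w : ι → ℝ} (hw : ∀ i ∉ S, w i = 0) (h1 : ∑ i, w i = 0) (hx : ∑ i, w i • x i = 0) : w = 0 := by
  have e : ∀ i, max (w i) 0 - max (-w i) 0 = w i := fun i => max_zero_sub_max_neg_zero_eq_self _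
  have := h S hS S hS (fun i => max (w i) 0) (fun i => max (-w i) 0) (fun i => le_max_right _ _)
    (fun i => le_max_right _ _) (fun i hi => by simp [hw i hi]) (fun i hi => by simp [hw i hi])
    (by rw [← sub_eq_zero, ← Finset.sum_sub_distrib]; simpa only [e])
    (by rw [← sub_eq_zero, ← Finset.sum_sub_distrib]; simpa only [e, ← sub_smul])
  ext i
  rw [← e i, congrFun this i, sub_self, Pi.zero_apply]

/-- The abstract simplicial complex of the nonempty subsets of the simplices in `F`. -/
def generatedComplex (F : Set (Finset ι)) (hF : ∀ i, ∃ S ∈ F, i ∈ S) :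
    AbstractSimplicialComplex ι where
  faces := {s | s.Nonempty ∧ ∃ S ∈ F, s ⊆ S}
  isRelLowerSet_faces := fun s ⟨hs, S, hS, h⟩ => ⟨hs, fun _ ht htn => ⟨htn, S, hS, ht.trans h⟩⟩
  singleton_mem i := ⟨Finset.singleton_nonempty i, by simpa using hF i⟩

theorem IsEmbeddedPlacement.injective [DecidableEq ι] (h : IsEmbeddedPlacement F x)
    (hF : ∀ i, ∃ S ∈ F, i ∈ S) : Function.Injective x := by
  intro i j hij
  obtain ⟨S, hS, hi⟩ := hF i
  obtain ⟨T, hT, hj⟩ := hF j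
  have := h S hS T hT (Pi.single i 1) (Pi.single j 1)
    (fun k => by rw [Pi.single_apply]; split_ifs <;> simp)
    (fun k => by rw [Pi.single_apply]; split_ifs <;> simp)
    (fun k hk => Pi.single_eq_of_ne (by rintro rfl; exact hk hi) _)
    (fun k hk => Pi.single_eq_of_ne (by rintro rfl; exact hk hj) _)
    (by simp) (by simpa [Pi.single_apply, ite_smul] using hij)
  by_contra hne
  have := congrFun this i
  simp [hne] at this

theorem mem_convexHull_map_iff {s : Finset ι} (hx : Function.Injective x) {y : E} :
    y ∈ convexHull ℝ (s.map ⟨x, hx⟩ : Set E) ↔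
      ∃ w ∈ stdSimplex ℝ ι, (∀ i ∉ s, w i = 0) ∧ ∑ i, w i • x i = y := by
  classical
  rw [Finset.mem_convexHull']
  constructor
  · rintro ⟨w, h0, h1, rfl⟩
    rw [Finset.sum_map] at h1 ⊢
    refine ⟨fun i => if i ∈ s then w (x i) else 0, ⟨fun i => ?_, ?_⟩, fun i hi => if_neg hi, ?_⟩
    · dsimp only
      split_ifs with hi
      · exact h0 _ (Finset.mem_map_of_mem _ hi)
      · exact le_rfl
    · simpa [Finset.sum_ite_mem] using h1
    · simp [ite_smul, Finset.sum_ite_mem]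
  · rintro ⟨w, ⟨h0, h1⟩, hw, rfl⟩
    refine ⟨Function.extend x w 0, fun y hy => ?_, ?_, ?_⟩
    · obtain ⟨i, hi, rfl⟩ := Finset.mem_map.1 hy
      simpa [hx.extend_apply] using h0 i
    · rw [Finset.sum_map, ← h1]
      simp only [Function.Embedding.coeFn_mk, hx.extend_apply]
      exact Finset.sum_subset (Finset.subset_univ s) fun i _ hi => hw i hi
    · rw [Finset.sum_map]
      simp only [Function.Embedding.coeFn_mk, hx.extend_apply]
      exact Finset.sum_subset (Finset.subset_univ s) fun i _ hi => by rw [hw i hi, zero_smul]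

variable [DecidableEq ι]

theorem IsEmbeddedPlacement.affineIndependent (h : IsEmbeddedPlacement F x) {S : Finset ι}
    (hS : S ∈ F) : AffineIndependent ℝ fun i : S => x i := by
  rw [affineIndependent_iff]
  intro u w h1 h2 e he
  have := h.eq_zero hS (w := fun i => ∑ e ∈ u, if e.1 = i then w e else 0)
    (fun i hi => Finset.sum_eq_zero fun e _ => if_neg (by rintro rfl; exact hi e.2))
    (by rw [Finset.sum_comm]; simpa using h1)
    (by simp only [Finset.sum_smul, ite_smul, zero_smul]; rw [Finset.sum_comm]; simpa using h2)
  have := congrFun this e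
  simpa [Subtype.coe_inj, he] using this

/-- The geometric simplicial complex with vertices at the points `x i`. -/
def IsEmbeddedPlacement.complex (h : IsEmbeddedPlacement F x) (hF : ∀ i, ∃ S ∈ F, i ∈ S) :
    Geometry.SimplicialComplex ℝ E where
  faces := {t | ∃ s ∈ (generatedComplex F hF).faces, t = s.map ⟨x, h.injective hF⟩}
  isRelLowerSet_faces := by
    rintro _ ⟨s, ⟨hs, S, hS, hsS⟩, rfl⟩
    refine ⟨hs.map, fun t ht htn => ?_⟩
    obtain ⟨u, hu, rfl⟩ := Finset.subset_map_iff.1 ht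
    exact ⟨u, ⟨Finset.map_nonempty.1 htn, S, hS, hu.trans hsS⟩, rfl⟩
  indep := by
    rintro _ ⟨s, ⟨hs, S, hS, hsS⟩, rfl⟩
    have hr := (h.affineIndependent hS).range
    refine hr.mono (t := Set.range fun i : S => x i) ?_
    intro y hy
    obtain ⟨i, hi, rfl⟩ := Finset.mem_map.1 (Finset.mem_coe.1 hy)
    exact ⟨⟨i, hsS hi⟩, rfl⟩
  -- A common point has the same weights in both simplices, so they are supported on the common
  -- vertices.
  inter_subset_convexHull := by
    rintro _ _ ⟨s, ⟨hs, S, hS, hsS⟩, rfl⟩ ⟨t, ⟨ht, T, hT, htT⟩, rfl⟩ y ⟨hy, hy'⟩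
    obtain ⟨w, ⟨h0, h1⟩, hw, rfl⟩ := (mem_convexHull_map_iff _).1 hy
    obtain ⟨w', ⟨h0', h1'⟩, hw', e⟩ := (mem_convexHull_map_iff _).1 hy'
    have := h S hS T hT w w' h0 h0' (fun i hi => hw i fun h => hi (hsS h))
      (fun i hi => hw' i fun h => hi (htT h)) (h1.trans h1'.symm) e.symm
    subst this
    classical
    rw [← Finset.coe_inter, ← Finset.map_inter, mem_convexHull_map_iff]
    refine ⟨w, ⟨h0, h1⟩, fun i hi => ?_, rfl⟩
    by_cases his : i ∈ s
    · exact hw' i fun hit => hi (Finset.mem_inter.2 ⟨his, hit⟩)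
    · exact hw i his

theorem IsEmbeddedPlacement.isPolyhedralRealization (h : IsEmbeddedPlacement F x)
    (hF : ∀ i, ∃ S ∈ F, i ∈ S) :
    IsPolyhedralRealization (generatedComplex F hF) x (h.complex hF) :=
  ⟨h.injective hF, rfl⟩

theorem IsEmbeddedPlacement.mem_space (h : IsEmbeddedPlacement F x) (hF : ∀ i, ∃ S ∈ F, i ∈ S)
    {w : ι → ℝ} (hw : w ∈ barycentricRealization F) : ∑ i, w i • x i ∈ (h.complex hF).space := by
  obtain ⟨hw1, S, hS, hwS⟩ := hw
  rw [Geometry.SimplicialComplex.mem_space_iff]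
  refine ⟨S.map ⟨x, h.injective hF⟩, ⟨S, ⟨?_, S, hS, subset_rfl⟩, rfl⟩, ?_⟩
  · rw [Finset.nonempty_iff_ne_empty]
    rintro rfl
    have := hw1.2
    simp [hwS] at this
  · exact (mem_convexHull_map_iff _).2 ⟨w, hw1, hwS, rfl⟩

variable [TopologicalSpace E] [IsTopologicalAddGroup E] [ContinuousSMul ℝ E] [T2Space E]

/-- The geometric realization in barycentric coordinates is the underlying space. -/
noncomputable def IsEmbeddedPlacement.homeomorph (h : IsEmbeddedPlacement F x) (hF : ∀ i, ∃ S ∈ F, i ∈ S) :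
    barycentricRealization F ≃ₜ (h.complex hF).space :=
  barycentricHomeo (fun w => ⟨∑ i, w.1 i • x i, h.mem_space hF w.2⟩)
    (Continuous.subtype_mk (continuous_finsetSum _ fun i _ =>
      ((continuous_apply i).comp continuous_subtype_val).smul continuous_const) _) (by
      constructor
      · rintro ⟨w, hw, S, hS, hwS⟩ ⟨w', hw', T, hT, hwT⟩ e
        exact Subtype.ext (h S hS T hT w w' hw.1 hw'.1 hwS hwT (hw.2.trans hw'.2.symm)
          (congrArg Subtype.val e))
      · rintro ⟨y, hy⟩
        obtain ⟨_, ⟨s, ⟨-, S, hS, hsS⟩, rfl⟩, hy⟩ := Geometry.SimplicialComplex.mem_space_iff.1 hy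
        obtain ⟨w, hw, hws, rfl⟩ := (mem_convexHull_map_iff _).1 hy
        exact ⟨⟨w, hw, S, hS, fun i hi => hws i fun h => hi (hsS h)⟩, rfl⟩)

end Placement

/-! ### Prescribed affine maps and a separation criterion -/

/-- Affine maps may be prescribed on affinely independent points. -/
theorem AffineIndependent.exists_affineMap {ι E V : Type*} [Fintype ι] [AddCommGroup E]
    [Module ℝ E] [AddCommGroup V] [Module ℝ V] {x : ι → E} (hx : AffineIndependent ℝ x)
    (t : ι → V) : ∃ g : E →ᵃ[ℝ] V, ∀ i, g (x i) = t i := by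
  -- Placed at height 1 in `E × ℝ`, affinely independent points become linearly independent vectors.
  have hli : LinearIndependent ℝ fun i => (x i, (1 : ℝ)) := by
    rw [linearIndependent_iff']
    intro s w hw i hi
    rw [affineIndependent_iff] at hx
    have h := Prod.ext_iff.1 hw
    simp only [Prod.fst_sum, Prod.snd_sum, Prod.smul_mk, smul_eq_mul, mul_one] at h
    exact hx s w h.2 h.1 i hi
  obtain ⟨L, hL⟩ := LinearMap.exists_extend ((Module.Basis.span hli).constr ℝ t)
  refine ⟨L.toAffineMap.comp (AffineMap.id ℝ E |>.prod (AffineMap.const ℝ E 1)), fun i => ?_⟩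
  have h1 := LinearMap.congr_fun hL (Module.Basis.span hli i)
  rw [Module.Basis.constr_basis, LinearMap.comp_apply, Submodule.subtype_apply,
    Module.Basis.span_apply] at h1
  exact h1

/-- Simplices are embedded if they are nondegenerate and separated from each other by hyperplanes
through their common vertices. -/
theorem isEmbeddedPlacement_of_separated {ι E : Type*} [Fintype ι] [AddCommGroup E] [Module ℝ E]
    {F : Set (Finset ι)} {x : ι → E}
    (hsep : ∀ S ∈ F, ∀ T ∈ F, S ≠ T → ∃ f : E →ₗ[ℝ] ℝ, ∀ a ∈ S, ∀ b ∈ T,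
      a ∈ T ∧ b ∈ S ∧ f (x a) = f (x b) ∨ f (x a) < f (x b))
    (hind : ∀ S ∈ F, ∀ v ∈ S, ∃ f : E →ₗ[ℝ] ℝ, ∃ c, f (x v) ≠ c ∧ ∀ u ∈ S, u ≠ v → f (x u) = c) :
    IsEmbeddedPlacement F x := by
  have hsum : ∀ (f : E →ₗ[ℝ] ℝ) {w w' : ι → ℝ}, ∑ i, w i • x i = ∑ i, w' i • x i →
      ∑ i, w i * f (x i) = ∑ i, w' i * f (x i) := fun f w w' h => by
    simpa using congrArg f h
  -- Within one simplex, a form constant on the facet opposite to `v` recovers the weight at `v`.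
  have main : ∀ S ∈ F, ∀ w w' : ι → ℝ, (∀ i ∉ S, w i = 0) → (∀ i ∉ S, w' i = 0) →
      ∑ i, w i = ∑ i, w' i → ∑ i, w i • x i = ∑ i, w' i • x i → w = w' := by
    intro S hS w w' hw hw' h1 hx
    ext v
    by_cases hv : v ∈ S
    · obtain ⟨f, c, hc, hf⟩ := hind S hS v hv
      have e : ∑ i, (w i - w' i) * (f (x i) - c) = 0 := by
        simp only [sub_mul, mul_sub, Finset.sum_sub_distrib, ← Finset.sum_mul, h1, hsum f hx]
        ring
      rw [Finset.sum_eq_single v] at e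
      · exact sub_eq_zero.1 ((mul_eq_zero.1 e).resolve_right (sub_ne_zero.2 hc))
      · intro u _ hu
        by_cases huS : u ∈ S
        · rw [hf u huS hu, sub_self, mul_zero]
        · rw [hw u huS, hw' u huS, sub_self, zero_mul]
      · simp
    · rw [hw v hv, hw' v hv]
  intro S hS T hT w w' h0 h0' hw hw' h1 hx
  by_cases hST : S = T
  · exact main S hS w w' hw (hST ▸ hw') h1 hx
  obtain ⟨f, hf⟩ := hsep S hS T hT hST
  -- Equal totals and equal images make this double sum vanish, while separation makes every summand
  -- nonnegative; so each summand is zero.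
  have e : ∑ a, ∑ b, w a * w' b * (f (x b) - f (x a)) = 0 := by
    have : ∑ a, ∑ b, w a * w' b * (f (x b) - f (x a)) =
        (∑ a, w a) * (∑ b, w' b * f (x b)) - (∑ a, w a * f (x a)) * ∑ b, w' b := by
      simp only [Finset.sum_mul_sum, ← Finset.sum_sub_distrib]
      exact Finset.sum_congr rfl fun a _ => Finset.sum_congr rfl fun b _ => by ring
    rw [this, h1, hsum f hx]
    ring
  have hnn : ∀ a b, 0 ≤ w a * w' b * (f (x b) - f (x a)) := fun a b => by
    by_cases ha : a ∈ S
    · by_cases hb : b ∈ T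
      · refine mul_nonneg (mul_nonneg (h0 a) (h0' b)) ?_
        rcases hf a ha b hb with ⟨-, -, h⟩ | h <;> linarith
      · simp [hw' b hb]
    · simp [hw a ha]
  have hz : ∀ a b, w a * w' b * (f (x b) - f (x a)) = 0 := fun a b => by
    rw [Finset.sum_eq_zero_iff_of_nonneg fun a _ => Finset.sum_nonneg fun b _ => hnn a b] at e
    have := e a (Finset.mem_univ a)
    rw [Finset.sum_eq_zero_iff_of_nonneg fun b _ => hnn a b] at this
    exact this b (Finset.mem_univ b)
  have hp : ∀ a b, a ∈ S → b ∈ T → (a ∉ T ∨ b ∉ S) → w a = 0 ∨ w' b = 0 := fun a b ha hb hab => by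
    have hlt := (hf a ha b hb).resolve_left fun h => hab.elim (· h.1) (· h.2.1)
    rw [← mul_eq_zero]
    exact (mul_eq_zero.1 (hz a b)).resolve_right (sub_pos.2 hlt).ne'
  by_cases hW : ∑ i, w i = 0
  · have hW' := h1 ▸ hW
    rw [Finset.sum_eq_zero_iff_of_nonneg fun i _ => h0 i] at hW
    rw [Finset.sum_eq_zero_iff_of_nonneg fun i _ => h0' i] at hW'
    ext i
    rw [hW i (Finset.mem_univ i), hW' i (Finset.mem_univ i)]
  -- A vertex `b` of `T` outside `S` is strictly separated from all of `S`; positive weight there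
  -- would annihilate `w`. So both weight systems live on `S`.
  refine main S hS w w' hw (fun b hb => ?_) h1 hx
  by_contra hb'
  have hbT : b ∈ T := by_contra fun h => hb' (hw' b h)
  refine hW (Finset.sum_eq_zero fun a _ => ?_)
  by_cases ha : a ∈ S
  · exact (hp a b ha hbT (Or.inr hb)).resolve_right hb'
  · exact hw a ha

/-! ### The complex with 23 vertices -/

/-- The integer coordinates of the 23 vertices. -/
def fineCoordinate : Fin 23 → Fin 4 → ℤ :=
  ![![0, 0, 0, 1], ![3, -3, -3, 0], ![3, 3, 3, 0], ![-3, -3, 0, 0], ![0, 0, -3, 0],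
    ![1, -2, -1, 0], ![-1, -2, 4, 0], ![-3, 0, -4, 0], ![1, 3, -2, 0], ![0, -2, 0, 0],
    ![1, 2, -1, 0], ![3, -1, -1, 0], ![3, 1, 1, 0], ![1, -3, -2, 0], ![-1, -3, -1, 0],
    ![2, -2, -3, 0], ![1, -1, -3, 0], ![1, 1, 2, 0], ![-1, -1, 1, 0], ![2, 2, 1, 0],
    ![1, 1, -1, 0], ![-2, -2, -1, 0], ![-1, -1, -2, 0]]

/-- The boundary circles of the six pentagons, with eleven vertices each. -/
def fineCycle : Fin 6 → Fin 11 → Fin 23 :=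
  ![![0, 2, 12, 11, 1, 15, 16, 4, 22, 21, 3], ![0, 3, 14, 13, 1, 11, 12, 2, 19, 20, 4],
    ![0, 2, 17, 18, 3, 14, 13, 1, 15, 16, 4], ![0, 1, 11, 12, 2, 17, 18, 3, 21, 22, 4],
    ![0, 1, 13, 14, 3, 21, 22, 4, 20, 19, 2], ![0, 1, 15, 16, 4, 20, 19, 2, 17, 18, 3]]

/-- Linear forms that separate the triangles from each other. -/
def separatingForms : List (ℤ × ℤ × ℤ × ℤ) :=
  [(-2, 5, 8, -8), (-9, 7, -4, -17), (3, 2, -3, 4), (-7, -8, -4, 14), (9, -7, -5, -5),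
    (-7, 6, 1, 0), (8, -5, 4, -8), (0, 6, -1, -14), (-9, -3, 5, -24), (8, 3, 0, 12),
    (2, -5, -8, 4), (3, -8, 5, -80), (2, 3, -4, 12), (0, 5, 4, -13), (9, -5, 1, 11),
    (1, 1, -1, -80), (-8, -3, 0, -15), (-9, 5, -1, -80), (7, 8, 4, -11), (6, -5, -3, -80),
    (-9, 7, 4, 2), (1, -9, 4, 16), (2, -1, 4, -80), (-6, 7, 1, -14), (-2, 1, -4, 1),
    (9, -5, -2, 7), (0, -5, -4, 12), (9, -7, -4, -6), (7, -6, -1, -80), (-2, -3, 4, 0),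
    (-1, 4, -1, 4), (-4, 1, -4, 2), (3, -3, 2, -80), (9, 3, -5, 20), (-1, 5, 4, -12),
    (0, 0, -1, 2), (-8, -3, 0, -1), (-1, -6, -4, -80), (4, -3, 1, 7), (4, -6, 5, -14),
    (-8, 5, -4, 13), (-3, -2, 3, -80), (3, 1, -1, -9), (-1, 9, -2, -80), (1, -1, 1, -80),
    (-1, 0, -1, -80), (1, 6, 2, -80), (6, -5, -2, -80), (4, 9, 1, -17), (2, -1, 0, -80),
    (-7, -8, -4, 16), (-6, 5, 3, -80), (8, 3, 0, 16), (2, 3, -4, 9), (-4, 6, -5, -80),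
    (1, 6, 4, -80), (-3, -1, 1, -8), (1, 0, 1, -80), (-1, -6, -2, -80), (-1, 9, 4, -80),
    (-3, 9, 5, -80), (3, -2, -1, -80), (0, -6, 1, -4), (-2, 1, 0, -3), (-2, -1, 2, -80),
    (-4, 3, -1, 4), (5, -5, -3, -2), (6, -5, -3, -5), (-1, 9, -4, -80), (9, -5, 1, 6),
    (-7, 6, 1, 1), (4, -6, 5, 12), (1, -9, -4, -80), (1, 1, 2, -80), (-3, 2, 1, -80),
    (4, -1, 4, -80), (0, -4, -3, -80), (1, 2, 0, -80), (-2, 8, 9, -80), (-2, 1, 0, 1),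
    (-5, 3, 2, -80), (8, -6, -3, -80), (1, 0, 4, 0), (5, -2, -1, 2), (7, -6, -3, -7),
    (7, -2, -1, 4), (0, 1, 0, 1), (-1, 4, 1, -10), (1, 1, 1, 1), (2, 1, 1, 2), (3, -7, 5, 13),
    (3, -2, 0, 4), (4, -3, 2, 1), (7, -6, -3, 1)]

/-- The number of a separating form for every pair of triangles, in base 128. -/
def separatingCode : ℕ :=
  0x2080000000000000000000000000000000000000000000000000000000000000000000000000000000000000000000000000000000000000000014b400000000000000000000000000000000000000000000000000000000000000000000000000000000000000000000000000000000000000001837400000000000000000000000000000000000000000000000000000000000000000000000000000000000000000000000000000000000000060c84a0000000000000000000000000000000000000000000000000000000000000000000000000000000000000000000000000000000000000a112851980000000000000000000000000000000000000000000000000000000000000000000000000000000000000000000000000000000000285000000e4000000000000000000000000000000000000000000000000000000000000000000000000000000000000000000000000000000000a14000001680000000000000000000000000000000000000000000000000000000000000000000000000000000000000000000000000000000028200000020429000000000000000000000000000000000000000000000000000000000000000000000000000000000000000000000000000000a08000000810e0f80000000000000000000000000000000000000000000000000000000000000000000000000000000000000000000000000003e20000002041020b4000000000000000000000000000000000000000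00000000000000000000000000000000000000000000000000000000000c0102d810102041023000000000000000000000000000000000000000000000000000000000000000000000000000000000000000000000000030042851e040810408626000000000000000000000000000000000000000000000000000000000000000000000000000000000000000000000002850a1428f0208102423830000000000000000000000000000000000000000000000000000000000000000000000000000000000000000000000a140000000782040848e2ce4000000000000000000000000000000000000000000000000000000000000000000000000000000000000000000000000000000e0810212000006e0000000000000000000000000000000000000000000000000000000000000000000000000000000000000000000000000000102040810000004aa0000000000000000000000000000000000000000000000000000000000000000000000000000000000000000000000000004081020408102040860000000000000000000000000000000000000000000000000000000000000000000000000000000000000000000000000102040810204081020ef00000000000000000000000000000000000000000000000000000000000000000000000000000000000000000000000020410204000000e1c3940a0000000000000000000000000000000000000000000000000000000000000000000000000000000000000000000000810e30600000008102040b6000000000000000000000000000000000000000000000000000000000000000000000000000000000281000000002043986a5c3810204081020ca80000000000000000000000000000000000000000000000000000000000000000000000000000004e5800000190200c183060c18588060c183060c0000000000000000000000000000000000000000000000000000000000000000000000000000030600000061c383060c183061c983060c18306aa0000000000000000000000000000000000000000000000000000000000000000000000000000c18000001870e0c183060c187044c18304081a9980000000000000000000000000000000000000000000000000000000000000000000000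000030600000061c383060c1830608102260c102061c39e800000000000000000000000000000000000000000000000000000000000000000000000babc70e1c10204081070e0c1020408285040838c84084c00000000000000000000000000000000000000000000000000000000000000000000021425e64c8408102043238704080c183060c183141020a7e00000000000000000000000000000000000000000000000000000000000000000000060e42fa210183060c1993810183060c183060c5040828d0300000000000000000000000000000000000000000000000000000000000000000001831020408060c1830674408060c183060c183060c18306428000000000000000000000000000000000000000000000000000000000000000001020408102040820408081020403060c183060c810204081028880000000000000000000000000000000000000000000000000000000000000004080000008102041048204081020183060c1a4102040810000009200000000000000000000000000000000000000000000000000000000000001020000002040820a48081020408060c1830641c1f3e44a0000004c000000000000000000000000000000000000000000000000000000000000139600000001a081020c18306162c58b16183061858b162c000001208480000000000000000000000000000000000000000000000000000000000000000000000f1224480000000000000060c54000000000000000091358000000000000000000000000000000000000000000000000000000000000000000003078912000000000000002c5950000000000000000244805c0000000000000000000000000000000000000000000000000000000000000000000c243e9000000000000001d3a74000000000000000096801b8c0000000000000000000000000000000000000000000000000000000000000000030912240000000000000074b5800000000000000002490018c26800000000000000000000000000000000000000000000000000000000000001020408100000068d0000016244810d00000000000002043060f1e0800000000000000000000000000000000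00000000000000000000000000004081020424309122468d2c18309042468d00000000408102040810a5400000000000000000000000000000000000000000000000086c489040810204081090c10204081020408101040810d89120810204081020428d4c0000000000000000000000000000000000000000000000213362410204081020438704081020408102040410204266c4820408102040810a3494200000000000000000000000000000000000000000000084c99b04081020408219381020408102040810204081099336081020810204081020410f800000000000000000000000000000000000000000219327501020408102086ce04081020b16102040810213264ea02040823e6a2850a34204292600000000000000000000000000000000000000000a142870e1c38204084c562c69ba060c183060c61122142850e1c482126850a140c1830a1439e0000000000000000000000000000000000000002850a143871e081021238731320c183060c18350448850a142891208483060c183060c2850a16780000000000000000000000000000000000000a142850e3c082040908e1c64203060c183060c60102042850a85082420c183060c18306142850694000000000000000000000000000000000005010a147810204102156cc84080c183060c183140408102142a10408503020c183060c0850b181913800000000000000000000000000000000002040810204081040850102040810204083060c0810204081023c1021404083060c18102040810644fc1000000000000000000000000000000000810204081020408c18040810204081020c183020408102040871e086010204183060408102040810205e00000000000000000000000000000002040810204081023060102040810204083067c0810204081021c38f1804081180c181020408102040811ab80000000000000000000000000000081020408102040870e04081020408102a1587020408102040870e1c381020439806040810204081020469260000000000000000000000000000a04285040808104081070e1c3870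e78f2b881c10102040850a08102041c0870e30c010214285605c90d0c183070000000000000000000000000f170e0810204081020408102040839e560810204040812e1c102040810204081020460b8704083870e1c3060c24700000000000000000000000363c387040810204081070e102040828504081010102047870e08102041c387142850a1e1c387547090d0c1831c38f400000000000000000000111700000000408102043468d1ab9dd7162c5da04040812e0000004081230e1c50a1468b870e7868d00000060c1858b44000000000000000000000000000000102040810d1a3468d768858b171c101025c00000001020408102040851a661c3821a340000018306162c0520000000000000000000000000000040810204000001a35100162c5950404b80000000004081020408102140c2940e0890d00000060c1858b0054d000000000000000000000000000382040848000006a2000040b165491700000000000482127850a14281830a142852434000001830616200153a940000000000000000000000000a3c48912000001a40000060c1830a14000000000000244854694183060c2850a1428500000000c1858800000009c000000000000000000000000811e244800000285000018306542810000000000000912140a3060c18302142850a14000000030616140000000692000000000000000000000020438fb2000000204000020c1b2020400000000000025a01021d18306040810204285000000096548050000000020540000000000000000000008118306000000081020008306c80810200000000000f180408c180c18102040810a140000001615201400102040813eb400000000810204081020460c18040810204081020c183020408102040851e086010228183060408102042850a0002c402c5850a040810204503460000002040810204081040860102040810204083060c0810204081023c102180408a060c18102040814844891588100b1620a83060c8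0a080c22700000810244101020410230fc8810204081020c183020408102048820408c010228503060408122152112246e20402c5882a744082028204083aa80

/-- The vertices of the `i`-th triangle of the `j`-th pentagon. -/
def fineTriangleList (j : Fin 6) (i : Fin 11) : List (Fin 23) :=
  [⟨5 + j, by lia⟩, fineCycle j i, fineCycle j (i + 1)]

/-- The `i`-th triangle of the `j`-th pentagon. -/
def fineTriangle (j : Fin 6) (i : Fin 11) : Finset (Fin 23) :=
  (fineTriangleList j i).toFinset

/-- The 66 triangles. -/
def fineFacets : Set (Finset (Fin 23)) :=
  Set.range fun t : Fin 6 × Fin 11 => fineTriangle t.1 t.2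

/-- The value of a linear form at a vertex. -/
def formValue (f : ℤ × ℤ × ℤ × ℤ) (v : Fin 23) : ℤ :=
  f.1 * fineCoordinate v 0 + f.2.1 * fineCoordinate v 1 + f.2.2.1 * fineCoordinate v 2 +
    f.2.2.2 * fineCoordinate v 3

/-- The separation of two simplices by a linear form. -/
def separates (f : ℤ × ℤ × ℤ × ℤ) (S T : List (Fin 23)) : Bool :=
  S.all fun a => T.all fun b =>
    T.contains a && S.contains b && formValue f a == formValue f b ||
      decide (formValue f a < formValue f b)

/-- The separating form of the triangles with the given numbers. -/
def separatingForm (s t : ℕ) : ℤ × ℤ × ℤ × ℤ :=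
  separatingForms.getD (separatingCode >>> (7 * (66 * s + t)) % 128) 0

/-- Only one order of each pair is tabulated; the opposite form serves the other. -/
theorem separates_of_lt (j : Fin 6) (i : Fin 11) (j' : Fin 6) (i' : Fin 11)
    (h : 11 * j.1 + i.1 < 11 * j'.1 + i'.1) :
    separates (separatingForm (11 * j.1 + i.1) (11 * j'.1 + i'.1))
      (fineTriangleList j i) (fineTriangleList j' i') = true := by
  revert j i j' i'
  decide +kernel

/-- The points in `ℝ⁴` with the given integer coordinates. -/
noncomputable def finePoint (v : Fin 23) : EuclideanSpace ℝ (Fin 4) :=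
  WithLp.toLp 2 fun k => (fineCoordinate v k : ℝ)

/-- An integral linear form on `ℝ⁴`. -/
noncomputable def realForm (f : ℤ × ℤ × ℤ × ℤ) : EuclideanSpace ℝ (Fin 4) →ₗ[ℝ] ℝ :=
  (f.1 : ℝ) • (EuclideanSpace.proj 0).toLinearMap +
    (f.2.1 : ℝ) • (EuclideanSpace.proj 1).toLinearMap +
    (f.2.2.1 : ℝ) • (EuclideanSpace.proj 2).toLinearMap +
    (f.2.2.2 : ℝ) • (EuclideanSpace.proj 3).toLinearMap

theorem realForm_finePoint (f : ℤ × ℤ × ℤ × ℤ) (v : Fin 23) :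
    realForm f (finePoint v) = formValue f v := by
  simp [realForm, finePoint, formValue]

theorem fineTriangle_mem (j : Fin 6) (i : Fin 11) : fineTriangle j i ∈ fineFacets :=
  ⟨(j, i), rfl⟩

theorem exists_fineFacet (v : Fin 23) : ∃ S ∈ fineFacets, v ∈ S := by
  have : ∀ v : Fin 23, ∃ j i, v ∈ fineTriangle j i := by decide +kernel
  obtain ⟨j, i, h⟩ := this v
  exact ⟨_, fineTriangle_mem j i, h⟩

/-- A linear form that vanishes on `b - c` but not on `a - b` if the three points are not
collinear. -/
def cornerForm (a b c : Fin 23) : ℤ × ℤ × ℤ × ℤ :=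
  let u := fun k => fineCoordinate a k - fineCoordinate b k
  let w := fun k => fineCoordinate b k - fineCoordinate c k
  let p := ∑ k, w k * w k
  let q := ∑ k, u k * w k
  -- This is `|w|²` times the component of `u` orthogonal to `w`.
  (p * u 0 - q * w 0, p * u 1 - q * w 1, p * u 2 - q * w 2, p * u 3 - q * w 3)

theorem cornerForm_spec (j : Fin 6) (i : Fin 11) {v : Fin 23} (hv : v ∈ fineTriangle j i) :
    ∃ b ∈ fineTriangle j i, ∃ c ∈ fineTriangle j i,
      formValue (cornerForm v b c) v ≠ formValue (cornerForm v b c) b ∧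
      ∀ u ∈ fineTriangle j i, u ≠ v →
        formValue (cornerForm v b c) u = formValue (cornerForm v b c) b := by
  revert j i v
  decide +kernel

/-- The 23 points are the vertices of an embedded complex. -/
theorem isEmbeddedPlacement_finePoint : IsEmbeddedPlacement fineFacets finePoint := by
  apply isEmbeddedPlacement_of_separated
  · rintro _ ⟨⟨j, i⟩, rfl⟩ _ ⟨⟨j', i'⟩, rfl⟩ hne
    have key : ∀ {j i j' i' f}, separates f (fineTriangleList j i) (fineTriangleList j' i') = true →
        ∀ a ∈ fineTriangle j i, ∀ b ∈ fineTriangle j' i',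
          a ∈ fineTriangle j' i' ∧ b ∈ fineTriangle j i ∧
            realForm f (finePoint a) = realForm f (finePoint b) ∨
          realForm f (finePoint a) < realForm f (finePoint b) := by
      intro j i j' i' f h a ha b hb
      simp only [fineTriangle, List.mem_toFinset] at ha hb ⊢
      simp only [separates, List.all_eq_true] at h
      have := h a ha b hb
      simp only [Bool.or_eq_true, Bool.and_eq_true, List.contains_iff_mem, beq_iff_eq,
        decide_eq_true_eq] at this
      simpa only [realForm_finePoint, Int.cast_inj, Int.cast_lt, and_assoc] using this
    rcases lt_trichotomy (11 * j.1 + i.1) (11 * j'.1 + i'.1) with h | h | h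
    · exact ⟨_, key (separates_of_lt j i j' i' h)⟩
    · have h1 : j = j' := by ext; lia
      have h2 : i = i' := by ext; lia
      exact absurd (by rw [h1, h2]) hne
    · refine ⟨-realForm (separatingForm (11 * j'.1 + i'.1) (11 * j.1 + i.1)), fun a ha b hb => ?_⟩
      rcases key (separates_of_lt j' i' j i h) b hb a ha with ⟨h1, h2, h3⟩ | h3
      · exact Or.inl ⟨h2, h1, by rw [LinearMap.neg_apply, LinearMap.neg_apply, h3]⟩
      · exact Or.inr (by rw [LinearMap.neg_apply, LinearMap.neg_apply]; exact neg_lt_neg h3)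
  · rintro _ ⟨⟨j, i⟩, rfl⟩ v hv
    obtain ⟨b, -, c, -, h1, h2⟩ := cornerForm_spec j i hv
    refine ⟨realForm (cornerForm v b c), formValue (cornerForm v b c) b, ?_, fun u hu huv => ?_⟩
    · rw [realForm_finePoint]
      exact_mod_cast h1
    · rw [realForm_finePoint, h2 u hu huv]

/-- The simplicial complex with 23 vertices. -/
def fineComplex : AbstractSimplicialComplex (Fin 23) :=
  generatedComplex fineFacets exists_fineFacet

/-- Its polyhedral realization. -/
noncomputable def fineGeometricComplex : Geometry.SimplicialComplex ℝ (EuclideanSpace ℝ (Fin 4)) :=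
  isEmbeddedPlacement_finePoint.complex exists_fineFacet

/-- The realization in barycentric coordinates. -/
noncomputable def fineHomeomorph :
    barycentricRealization fineFacets ≃ₜ fineGeometricComplex.space :=
  isEmbeddedPlacement_finePoint.homeomorph exists_fineFacet

theorem card_fineTriangle (j : Fin 6) (i : Fin 11) : (fineTriangle j i).card = 3 := by
  revert j i
  decide +kernel

theorem hasDimension_fineComplex : HasDimension fineComplex 2 := by
  refine ⟨?_, fineTriangle 0 0, ⟨?_, _, fineTriangle_mem 0 0, subset_rfl⟩, card_fineTriangle 0 0⟩
  · rintro s ⟨-, _, ⟨⟨j, i⟩, rfl⟩, h⟩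
    exact (Finset.card_le_card h).trans (card_fineTriangle j i).le
  · rw [← Finset.card_pos, card_fineTriangle]
    norm_num

theorem finePoint_coordinate (v : Fin 23) (i : Fin 4) :
    ∃ m : ℤ, -4 ≤ m ∧ m ≤ 4 ∧ finePoint v i = m := by
  have : ∀ v i, -4 ≤ fineCoordinate v i ∧ fineCoordinate v i ≤ 4 := by decide
  exact ⟨fineCoordinate v i, (this v i).1, (this v i).2, rfl⟩

theorem finePoint_zero : finePoint 0 = !₂[0, 0, 0, 1] := by
  ext i
  fin_cases i <;> simp [finePoint, fineCoordinate]

theorem finePoint_ne_zero {v : Fin 23} (hv : v ≠ 0) : finePoint v 3 = 0 := by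
  have : ∀ v : Fin 23, v ≠ 0 → fineCoordinate v 3 = 0 := by decide
  simp [finePoint, this v hv]

section Pushforward

variable {ι κ : Type*} [Fintype ι] [Fintype κ] {F : Set (Finset ι)} {F' : Set (Finset κ)}
  {β : ι → κ → ℝ}

/-- The affine extension of a vertex map that sends each simplex of `F` into a simplex of `F'`; it
serves both for the subdivision and for the labelling. -/
theorem linearCombination_mem_barycentricRealization (hβ : ∀ i, β i ∈ stdSimplex ℝ κ)
    (h : ∀ S ∈ F, ∃ T ∈ F', ∀ i ∈ S, ∀ k ∉ T, β i k = 0) {w : ι → ℝ}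
    (hw : w ∈ barycentricRealization F) :
    Fintype.linearCombination ℝ β w ∈ barycentricRealization F' := by
  obtain ⟨hw, S, hS, hwS⟩ := hw
  obtain ⟨T, hT, hST⟩ := h S hS
  rw [Fintype.linearCombination_apply]
  refine ⟨(convex_stdSimplex ℝ κ).sum_mem (fun i _ => hw.1 i) hw.2 fun i _ => hβ i, T, hT,
    fun k hk => ?_⟩
  rw [Finset.sum_apply]
  refine Finset.sum_eq_zero fun i _ => ?_
  by_cases hi : i ∈ S
  · simp [hST i hi k hk]
  · simp [hwS i hi]

end Pushforward

/-! ### Subdivision of the 2-skeleton -/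

/-- Three times the barycentric coordinates of the 23 vertices in the 2-skeleton. -/
def fineWeight : Fin 23 → SkeletonVertex → ℕ :=
  fun v => Fin.addCases (m := 5) (n := 18) (fun k => Pi.single (.inl k) 3)
    (Fin.addCases (m := 6) (n := 12) (fun j => Pi.single (.inr j) 3)
      fun k => Sum.elim (![![0, 2, 1, 0, 0], ![0, 1, 2, 0, 0], ![0, 2, 0, 1, 0], ![0, 1, 0, 2, 0],
        ![0, 2, 0, 0, 1], ![0, 1, 0, 0, 2], ![0, 0, 2, 1, 0], ![0, 0, 1, 2, 0], ![0, 0, 2, 0, 1],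
        ![0, 0, 1, 0, 2], ![0, 0, 0, 2, 1], ![0, 0, 0, 1, 2]] k) 0) v

/-- The positions of the vertices of the 2-skeleton. -/
def skeletonCoordinate : SkeletonVertex → Fin 4 → ℤ :=
  Sum.elim (fun k => fineCoordinate (Fin.castAdd 18 k))
    fun j => fineCoordinate (Fin.natAdd 5 (Fin.castAdd 12 j))

theorem fineWeight_sum (v : Fin 23) : ∑ k, fineWeight v k = 3 := by
  revert v
  decide +kernel

/-- The twelve extra vertices are trisection points in `ℝ⁴` too, so positions depend affinely on the
position in the coarse 2-skeleton. -/
theorem sum_fineWeight_mul (v : Fin 23) (l : Fin 4) :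
    ∑ k, fineWeight v k * skeletonCoordinate k l = 3 * fineCoordinate v l := by
  revert v l
  decide +kernel

theorem fineWeight_support (j : Fin 6) (i : Fin 11) :
    ∃ i', ∀ v ∈ fineTriangle j i, ∀ k ∉ skeletonTriangle j i', fineWeight v k = 0 := by
  revert j i
  decide +kernel

/-- The barycentric coordinates of the 23 vertices in the 2-skeleton. -/
noncomputable def fineBarycentric (v : Fin 23) (k : SkeletonVertex) : ℝ := fineWeight v k / 3

theorem fineBarycentric_mem (v : Fin 23) : fineBarycentric v ∈ stdSimplex ℝ SkeletonVertex := by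
  refine ⟨fun k => by unfold fineBarycentric; positivity, ?_⟩
  simp only [fineBarycentric, ← Finset.sum_div]
  rw [← Nat.cast_sum, fineWeight_sum]
  norm_num

/-- The map from the subdivision to the 2-skeleton. -/
noncomputable def fineToSkeleton (w : barycentricRealization fineFacets) : SkeletonSpace :=
  ⟨Fintype.linearCombination ℝ fineBarycentric w.1,
    linearCombination_mem_barycentricRealization fineBarycentric_mem (by
      rintro _ ⟨⟨j, i⟩, rfl⟩
      obtain ⟨i', h⟩ := fineWeight_support j i
      refine ⟨_, skeletonTriangle_mem j i', fun v hv k hk => ?_⟩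
      simp [fineBarycentric, h v hv k hk]) w.2⟩

theorem continuous_fineToSkeleton : Continuous fineToSkeleton :=
  Continuous.subtype_mk ((LinearMap.continuous_of_finiteDimensional _).comp
    continuous_subtype_val) _

theorem finePoint_eq_sum (v : Fin 23) :
    finePoint v = ∑ k, fineBarycentric v k • WithLp.toLp 2 fun l => (skeletonCoordinate k l : ℝ) := by
  ext l
  have := sum_fineWeight_mul v l
  have h : ((∑ k, fineWeight v k * skeletonCoordinate k l : ℤ) : ℝ) =
    ((3 * fineCoordinate v l : ℤ) : ℝ) := by rw [this]
  push_cast at h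
  rw [WithLp.ofLp_sum, Finset.sum_apply]
  simp only [fineBarycentric, PiLp.smul_apply, smul_eq_mul, div_mul_eq_mul_div, ← Finset.sum_div, h]
  change (fineCoordinate v l : ℝ) = _
  ring

/-- The map to `ℝ⁴` factors through `fineToSkeleton`, so the embedding proved by separation already
gives injectivity. -/
theorem injective_fineToSkeleton : Function.Injective fineToSkeleton := by
  rintro ⟨w, hw, S, hS, hwS⟩ ⟨w', hw', T, hT, hwT⟩ e
  refine Subtype.ext (isEmbeddedPlacement_finePoint S hS T hT w w' hw.1 hw'.1 hwS hwT
    (hw.2.trans hw'.2.symm) ?_)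
  have key : ∀ w : Fin 23 → ℝ, ∑ i, w i • finePoint i =
      ∑ k, Fintype.linearCombination ℝ fineBarycentric w k •
        WithLp.toLp 2 fun l => (skeletonCoordinate k l : ℝ) := by
    intro w
    simp only [finePoint_eq_sum, Fintype.linearCombination_apply, Finset.sum_apply,
      Pi.smul_apply, smul_eq_mul, Finset.smul_sum, Finset.sum_smul, smul_smul]
    exact Finset.sum_comm
  rw [key, key]
  have e' : Fintype.linearCombination ℝ fineBarycentric w =
    Fintype.linearCombination ℝ fineBarycentric w' := congrArg Subtype.val e
  rw [e']

theorem range_fineToSkeleton (j : Fin 6) (i : Fin 11) {s : Fin 3 → ℝ} (hs : s ∈ stdSimplex ℝ (Fin 3))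
    {u : SkeletonSpace}
    (hu : u.1 = s 0 • fineBarycentric (Fin.natAdd 5 (Fin.castAdd 12 j)) +
      s 1 • fineBarycentric (fineCycle j i) + s 2 • fineBarycentric (fineCycle j (i + 1))) :
    u ∈ Set.range fineToSkeleton := by
  let v : Fin 3 → Fin 23 := ![Fin.natAdd 5 (Fin.castAdd 12 j), fineCycle j i, fineCycle j (i + 1)]
  have hv : ∀ k, v k ∈ fineTriangle j i := by
    intro k
    rw [fineTriangle, List.mem_toFinset]
    fin_cases k <;> simp [v, fineTriangleList]
    left; rfl
  have hmem : ∑ k, s k • Pi.single (v k) (1 : ℝ) ∈ barycentricRealization fineFacets := by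
    refine ⟨(convex_stdSimplex ℝ _).sum_mem (fun i _ => hs.1 i) hs.2 fun i _ =>
      single_mem_stdSimplex ℝ _, _, fineTriangle_mem j i, fun l hl => ?_⟩
    rw [Finset.sum_apply]
    refine Finset.sum_eq_zero fun k _ => ?_
    rw [Pi.smul_apply, Pi.single_eq_of_ne (by rintro rfl; exact hl (hv k)), smul_zero]
  refine ⟨⟨_, hmem⟩, Subtype.ext ?_⟩
  change Fintype.linearCombination ℝ fineBarycentric _ = _
  rw [map_sum, hu, Fin.sum_univ_three]
  simp [v, Fintype.linearCombination_apply_single]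

theorem fineWeight_centre (j : Fin 6) :
    fineWeight (Fin.natAdd 5 (Fin.castAdd 12 j)) = Pi.single (.inr j) 3 := by
  revert j
  decide

/-- Position `1 + 3i + r` divides the `i`-th edge away from vertex 0 in the ratio `r : 3 - r`. The
shift by 1 reflects that the two edges at vertex 0 are not subdivided. -/
theorem fineWeight_cycle (j : Fin 6) (i : Fin 3) (r : Fin 4) :
    fineWeight (fineCycle j (Fin.ofNat 11 (1 + 3 * i.1 + r.1))) =
      Pi.single (.inl (pentagonCycle j (Fin.ofNat 5 (1 + i.1)))) (3 - r.1) +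
        Pi.single (.inl (pentagonCycle j (Fin.ofNat 5 (2 + i.1)))) r.1 := by
  revert j i r
  decide +kernel

theorem fineWeight_cycle_zero (j : Fin 6) :
    fineWeight (fineCycle j 0) = Pi.single (.inl (pentagonCycle j 0)) 3 := by
  revert j
  decide +kernel

theorem fineWeight_cycle_last (j : Fin 6) :
    fineWeight (fineCycle j 10) = Pi.single (.inl (pentagonCycle j 4)) 3 := by
  revert j
  decide +kernel

theorem eq_sum_single {κ : Type*} [DecidableEq κ] {a b c : κ} (hab : a ≠ b) (hac : a ≠ c)
    (hbc : b ≠ c) {w : κ → ℝ} (h : ∀ i ∉ ({a, b, c} : Finset κ), w i = 0) :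
    w = w a • Pi.single a 1 + w b • Pi.single b 1 + w c • Pi.single c 1 := by
  ext i
  by_cases hi : i ∈ ({a, b, c} : Finset κ)
  · simp only [Finset.mem_insert, Finset.mem_singleton] at hi
    rcases hi with rfl | rfl | rfl
    · simp [hab, hac]
    · simp [hab.symm, hbc]
    · simp [hac.symm, hbc.symm]
  · rw [h i hi]
    simp only [Finset.mem_insert, Finset.mem_singleton, not_or] at hi
    simp [hi.1, hi.2.1, hi.2.2]

theorem pentagonCycle_ne (j : Fin 6) (i : Fin 5) : pentagonCycle j i ≠ pentagonCycle j (i + 1) := by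
  revert j i
  decide

theorem SkeletonSpace.exists_eq (u : SkeletonSpace) :
    ∃ j i, ∃ s ∈ stdSimplex ℝ (Fin 3), u.1 = s 0 • Pi.single (.inr j) 1 +
      s 1 • Pi.single (.inl (pentagonCycle j i)) 1 +
      s 2 • Pi.single (.inl (pentagonCycle j (i + 1))) 1 := by
  obtain ⟨u, hu, _, ⟨⟨j, i⟩, rfl⟩, h⟩ := u
  have e := eq_sum_single (by simp) (by simp) (by simpa using pentagonCycle_ne j i) h
  refine ⟨j, i, ![u (.inr j), u (.inl (pentagonCycle j i)), u (.inl (pentagonCycle j (i + 1)))],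
    ⟨?_, ?_⟩, e⟩
  · intro k
    fin_cases k <;> exact hu.1 _
  · have h2 := hu.2
    rw [e] at h2
    rw [Fin.sum_univ_three]
    change u (.inr j) + u (.inl (pentagonCycle j i)) + u (.inl (pentagonCycle j (i + 1))) = 1
    simpa only [Pi.add_apply, Pi.smul_apply, smul_eq_mul,
      Finset.sum_add_distrib, ← Finset.mul_sum, Finset.sum_pi_single', Finset.mem_univ, if_true,
      mul_one] using h2

theorem fineBarycentric_eq_single {v : Fin 23} {k : SkeletonVertex}
    (h : fineWeight v = Pi.single k 3) : fineBarycentric v = Pi.single k 1 := by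
  ext l
  rw [fineBarycentric, h]
  by_cases hl : l = k
  · subst hl
    simp
  · simp [hl]

theorem fineBarycentric_cycle (j : Fin 6) (i : Fin 3) (r : Fin 4) :
    fineBarycentric (fineCycle j (Fin.ofNat 11 (1 + 3 * i.1 + r.1))) =
      ((3 - r.1 : ℝ) / 3) • Pi.single (.inl (pentagonCycle j (Fin.ofNat 5 (1 + i.1)))) 1 +
        ((r.1 : ℝ) / 3) • Pi.single (.inl (pentagonCycle j (Fin.ofNat 5 (2 + i.1)))) 1 := by
  ext l
  have hr : r.1 ≤ 3 := by lia
  rw [fineBarycentric, fineWeight_cycle]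
  simp only [Pi.add_apply, Pi.smul_apply, Pi.single_apply, smul_eq_mul]
  split_ifs <;> simp [Nat.cast_sub hr]
  ring

/-- Over an edge at vertex 0 a coarse triangle is a fine one; over any other edge it is the union of
three fine triangles. -/
theorem surjective_fineToSkeleton : Function.Surjective fineToSkeleton := by
  intro u
  obtain ⟨j, i, s, hs, hu⟩ := u.exists_eq
  have hc := fineBarycentric_eq_single (fineWeight_centre j)
  have h0 := fineBarycentric_eq_single (fineWeight_cycle_zero j)
  have hl := fineBarycentric_eq_single (fineWeight_cycle_last j)
  by_cases hi0 : i = 0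
  · subst hi0
    apply range_fineToSkeleton j 0 hs
    have h1 : fineBarycentric (fineCycle j (0 + 1)) = Pi.single (.inl (pentagonCycle j 1)) 1 := by
      have := fineBarycentric_cycle j 0 0
      simp only [Fin.val_zero] at this
      norm_num at this
      exact this
    rw [hu, hc, h0, h1]
    rfl
  by_cases hi4 : i = 4
  · subst hi4
    apply range_fineToSkeleton j 10 hs
    rw [hu, hc, hl, show (10 : Fin 11) + 1 = 0 from rfl, h0]
    rfl
  obtain ⟨i, rfl, hi⟩ : ∃ i' : Fin 3, i = Fin.ofNat 5 (1 + i'.1) ∧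
      i + 1 = Fin.ofNat 5 (2 + i'.1) := by
    clear hu
    revert i
    decide
  rw [hi] at hu
  -- The fine triangle over the `r`-th third of the edge. The two expressions are the weights at its
  -- ends, and their signs decide which third applies.
  have main : ∀ r : ℕ, r < 3 → 0 ≤ (r + 1) * (s 1 + s 2) - 3 * s 2 →
      0 ≤ 3 * s 2 - r * (s 1 + s 2) → u ∈ Set.range fineToSkeleton := by
    intro r hr ha hb
    have e1 := fineBarycentric_cycle j i ⟨r, by lia⟩
    have e2 := fineBarycentric_cycle j i ⟨r + 1, by lia⟩
    have hadd : Fin.ofNat 11 (1 + 3 * i.1 + (r + 1)) = Fin.ofNat 11 (1 + 3 * i.1 + r) + 1 := by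
      ext
      simp [Fin.val_add, ← add_assoc]
    dsimp only at e1 e2
    rw [hadd] at e2
    have hsum := hs.2
    rw [Fin.sum_univ_three] at hsum
    apply range_fineToSkeleton j (Fin.ofNat 11 (1 + 3 * i.1 + r))
      (s := ![s 0, (r + 1) * (s 1 + s 2) - 3 * s 2, 3 * s 2 - r * (s 1 + s 2)])
    · refine ⟨fun k => ?_, ?_⟩
      · fin_cases k
        · exact hs.1 0
        · exact ha
        · exact hb
      · rw [Fin.sum_univ_three]
        change s 0 + ((r + 1) * (s 1 + s 2) - 3 * s 2) + (3 * s 2 - r * (s 1 + s 2)) = 1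
        linear_combination hsum
    · rw [hu, hc, e1, e2]
      ext l
      simp only [Pi.add_apply, Pi.smul_apply, smul_eq_mul, Matrix.cons_val]
      push_cast
      ring
  have h1 := hs.1 1
  have h2 := hs.1 2
  rcases le_total (3 * s 2) (s 1 + s 2) with h | h
  · exact main 0 (by norm_num) (by push_cast; linarith) (by push_cast; linarith)
  rcases le_total (3 * s 2) (2 * (s 1 + s 2)) with h' | h'
  · exact main 1 (by norm_num) (by push_cast; linarith) (by push_cast; linarith)
  · exact main 2 (by norm_num) (by push_cast; linarith) (by push_cast; linarith)

/-- The 23-vertex complex subdivides the 2-skeleton. -/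
noncomputable def fineToSkeletonHomeo : barycentricRealization fineFacets ≃ₜ SkeletonSpace :=
  barycentricHomeo fineToSkeleton continuous_fineToSkeleton
    ⟨injective_fineToSkeleton, surjective_fineToSkeleton⟩

/-! ### The fundamental group of the underlying space -/

/-- A homeomorphism induces an isomorphism of fundamental groups. -/
noncomputable def Homeomorph.fundamentalGroupMulEquiv {X Y : Type*} [TopologicalSpace X]
    [TopologicalSpace Y] (e : X ≃ₜ Y) (x : X) : FundamentalGroup X x ≃* FundamentalGroup Y (e x) :=
  MulEquiv.ofBijective (FundamentalGroup.map (e : C(X, Y)) x) (by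
    have hx : x = e.symm (e x) := (e.symm_apply_apply x).symm
    constructor
    · intro p q hpq
      induction p using Quotient.ind with | _ p
      induction q using Quotient.ind with | _ q
      have h : (p.map e.continuous).Homotopic (q.map e.continuous) := Quotient.exact hpq
      refine Quotient.sound ?_
      have key : ∀ p : Path x x, ((p.map e.continuous).map e.symm.continuous).cast hx hx = p :=
        fun p => Path.ext (funext fun t => e.symm_apply_apply _)
      have h2 : (((p.map e.continuous).map e.symm.continuous).cast hx hx).Homotopic
          (((q.map e.continuous).map e.symm.continuous).cast hx hx) :=
        (h.map (e.symm : C(Y, X))).pathCast hx hx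
      rwa [key, key] at h2
    · intro q
      induction q using Quotient.ind with | _ q
      refine ⟨Quotient.mk _ ((q.map e.symm.continuous).cast hx hx), ?_⟩
      exact congrArg _ (Path.ext (funext fun t => e.apply_symm_apply _)))

theorem StarCover.pathConnectedSpace {X ι : Type*} [TopologicalSpace X] {U : ι → Set X} {o : ι}
    (hU : StarCover U o) {x₀ : X} (h₀ : x₀ ∈ U o) : PathConnectedSpace X := by
  have h : ∀ y, Joined x₀ y := fun y => by
    obtain ⟨i, hi⟩ := hU.cover y
    obtain ⟨z, hz, hz'⟩ := hU.meets i
    exact ((hU.simplyConnected o).isPathConnected.joinedIn _ h₀ _ hz).joined.trans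
      ((hU.simplyConnected i).isPathConnected.joinedIn _ hz' _ hi).joined
  exact ⟨⟨x₀⟩, fun x y => (h x).symm.trans (h y)⟩

/-- The 23-vertex complex is homeomorphic to the 2-skeleton. -/
noncomputable def geometricHomeomorph : fineGeometricComplex.space ≃ₜ SkeletonSpace :=
  fineHomeomorph.symm.trans fineToSkeletonHomeo

theorem nonempty_fundamentalGroup_mulEquiv (p : fineGeometricComplex.space) :
    Nonempty (FundamentalGroup fineGeometricComplex.space p ≃* binaryIcosahedralGroup) := by
  obtain ⟨x₀, ⟨f⟩⟩ := exists_mulEquiv_fundamentalGroup_skeleton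
  obtain ⟨w, hw⟩ := exists_pos_on (skeletonTriangle_mem 0 0) ⟨_, Finset.mem_insert_self _ _⟩
  have : PathConnectedSpace SkeletonSpace :=
    skeleton_starCover.pathConnectedSpace (hw (.inl 0) (by decide))
  exact ⟨(geometricHomeomorph.fundamentalGroupMulEquiv p).trans
    ((FundamentalGroup.fundamentalGroupMulEquivOfPathConnected _ x₀).trans f)⟩

/-- A contractible space has trivial fundamental group, but `icosianT` is a nontrivial element of
the binary icosahedral group. -/
theorem not_contractibleSpace_fineGeometricComplex :
    ¬ ContractibleSpace fineGeometricComplex.space := by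
  intro h
  obtain ⟨p⟩ : Nonempty fineGeometricComplex.space := inferInstance
  obtain ⟨f⟩ := nonempty_fundamentalGroup_mulEquiv p
  have hs := f.symm.injective.subsingleton
  have hT : icosianT ∈ binaryIcosahedralGroup := by
    rw [binaryIcosahedralGroup_eq]
    exact Subgroup.subset_closure (by simp)
  have := congrArg Subtype.val (Subsingleton.elim (⟨icosianT, hT⟩ : binaryIcosahedralGroup) 1)
  refine icosianT_sq_ne ?_
  rw [show icosianT = 1 from this, one_pow]

/-! ### Acyclicity -/

section Acyclic

variable {V : Type*} [LinearOrder V]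

/-- A complex with a chain contraction is acyclic. -/
theorem isZAcyclic_of_contraction {K : AbstractSimplicialComplex V}
    (h : Finset V → Finset V →₀ ℤ)
    (hmem : ∀ s, (s ∈ K.faces ∨ s = ∅) → h s ∈ augmentedChains K (s.card + 1))
    (heq : ∀ s, (s ∈ K.faces ∨ s = ∅) →
      chainBoundary V (h s) + Finsupp.linearCombination ℤ h (simplexBoundary s) =
        Finsupp.single s 1) : IsZAcyclic K := by
  intro k c hc hcz
  refine ⟨Finsupp.linearCombination ℤ h c, ?_, ?_⟩
  · rw [Finsupp.linearCombination_apply]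
    refine Submodule.sum_mem _ fun s hs => Submodule.smul_mem _ _ ?_
    obtain ⟨h1, rfl⟩ := (Finsupp.mem_supported ℤ c).1 hc hs
    exact hmem s h1
  -- The identity `∂h + h∂ = 1`, extended linearly from simplices to chains.
  · have : chainBoundary V (Finsupp.linearCombination ℤ h c) +
        Finsupp.linearCombination ℤ h (chainBoundary V c) = c := by
      conv_rhs => rw [← Finsupp.sum_single c]
      simp only [chainBoundary, Finsupp.linearCombination_apply ℤ c, Finsupp.sum, map_sum,
        map_smul, ← Finset.sum_add_distrib, ← smul_add]
      refine Finset.sum_congr rfl fun s hs => ?_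
      rw [← chainBoundary, heq s ((Finsupp.mem_supported ℤ c).1 hc hs).1]
      simp
    rwa [hcz, map_zero, add_zero] at this

theorem chainBoundary_single (s : Finset V) :
    chainBoundary V (Finsupp.single s 1) = simplexBoundary s := by
  simp [chainBoundary]

theorem simplexBoundary_empty : simplexBoundary (∅ : Finset V) = 0 := by
  simp [simplexBoundary]

theorem simplexBoundary_singleton (v : V) : simplexBoundary {v} = Finsupp.single ∅ 1 := by
  simp [simplexBoundary, Finset.filter_singleton]

theorem simplexBoundary_pair {u v : V} (h : u < v) :
    simplexBoundary {u, v} = Finsupp.single {v} 1 - Finsupp.single {u} 1 := by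
  have e : ({u, v} : Finset V).erase v = {u} := by grind
  simp [simplexBoundary, Finset.sum_pair h.ne, Finset.filter_insert, Finset.filter_singleton, h, e,
    h.not_gt, h.ne, sub_eq_add_neg]

theorem simplexBoundary_triple {u v w : V} (h : u < v) (h' : v < w) :
    simplexBoundary {u, v, w} =
      Finsupp.single {v, w} 1 - Finsupp.single {u, w} 1 + Finsupp.single {u, v} 1 := by
  have hu := h.trans h'
  have e1 : ({u, v, w} : Finset V).erase u = {v, w} := by grind
  have e2 : ({u, v, w} : Finset V).erase v = {u, w} := by grind
  have e3 : ({u, v, w} : Finset V).erase w = {u, v} := by grind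
  have f1 : ({u, v, w} : Finset V).filter (· < u) = ∅ := by grind
  have f2 : ({u, v, w} : Finset V).filter (· < v) = {u} := by grind
  have f3 : ({u, v, w} : Finset V).filter (· < w) = {u, v} := by grind
  rw [simplexBoundary, Finset.sum_insert (by simp [h.ne, hu.ne]), Finset.sum_pair h'.ne, e1, e2, e3,
    f1, f2, f3, Finset.card_empty, Finset.card_singleton, Finset.card_pair h.ne, pow_zero,
    pow_one, neg_one_sq, Finsupp.single_neg]
  abel

end Acyclic

/-! ### The tabulated chain contraction -/

/-- The 88 edges. -/
def fineEdge : Fin 88 → Fin 23 × Fin 23 :=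
  ![(0, 1), (0, 2), (0, 3), (0, 4), (0, 5), (0, 6), (0, 7), (0, 8), (0, 9), (0, 10), (1, 5),
    (1, 6), (1, 7), (1, 8), (1, 9), (1, 10), (1, 11), (1, 13), (1, 15), (2, 5), (2, 6), (2, 7),
    (2, 8), (2, 9), (2, 10), (2, 12), (2, 17), (2, 19), (3, 5), (3, 6), (3, 7), (3, 8), (3, 9),
    (3, 10), (3, 14), (3, 18), (3, 21), (4, 5), (4, 6), (4, 7), (4, 8), (4, 9), (4, 10), (4, 16),
    (4, 20), (4, 22), (5, 11), (5, 12), (5, 15), (5, 16), (5, 21), (5, 22), (6, 11), (6, 12),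
    (6, 13), (6, 14), (6, 19), (6, 20), (7, 13), (7, 14), (7, 15), (7, 16), (7, 17), (7, 18),
    (8, 11), (8, 12), (8, 17), (8, 18), (8, 21), (8, 22), (9, 13), (9, 14), (9, 19), (9, 20),
    (9, 21), (9, 22), (10, 15), (10, 16), (10, 17), (10, 18), (10, 19), (10, 20), (11, 12),
    (13, 14), (15, 16), (17, 18), (19, 20), (21, 22)]

/-- The numbers of the edges, in base 128. -/
def edgeCode : ℕ :=
  0x2b80000000000000000000000000000000000000000000000000000000000000000000000000000000002b00000000000000000000000000000000000000000000000000000000000000000000000000000000002a80000000000000000000000000000000000000000000000000000000000000000000000000000000002a00000000000000000000000000000000000000000000000000000000000000000000000000000000002980000000000000000000000000000000000000000000000000000000000000000000000000000000002900000000000000000000000014684f9d3660000000000000000000000000025ca932000000023c60000000000000000000000116200010e100000004180000000000000000000000000007ef9ebc76e800000000000000000000000000e5c0000000376cd5a000000000000000000019b2000000062c00005eb80000000000000000000b402c000002b000000000a94a84e9928000000000090000460000044000004280f9e3a7000000000000000d80340000000640182e58a942600000000000000000000048011004078e1a3058a000000000000000000000000000000244070c142030404000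

/-- The next vertex on the way to the base vertex. -/
def fineParent : Fin 23 → Fin 23 :=
  ![0, 0, 0, 0, 0, 0, 0, 0, 0, 0, 0, 1, 2, 1, 3, 1, 4, 2, 3, 2, 4, 3, 4]

/-- The coefficients, increased by one, of the chains that fill the edges, in base 4. -/
def fillingCode : ℕ :=
  0xa544059954015554519a6551515995566655554555550566a51156a9555659104559595515544455556555550566651156a955565910455959551554445555655555a544559954015554519a6551515595566655554555550566551156a955565910455959551555445555655555a545559954015554519a655151559555665555455555a549559954015554519a6551515595556655554555550561551156a9555659104569595515554455556555550561511156a955565910456959551555445555655555a5495a9954015554519a6541515595556655554555550561501156a95556591045695955155544559565555518504110569596a55511556959550556955554555555925a699a54151405559955415155a55455555655555518504111569596a5551155695955055655555455555518504115569596a55511556959550556555554555555925a699554151405559955455155a554555556555555925a695554151405559955455155a55455555655555518504165569596a55511556559550556555554555555925a694554151405559955455156a554555556555555925a694514151405559955455156a55455555655555518504165a69596a55511556559540556555554555555925a694504151405559955455156a55455556655555541166501101515166a55555a5556a554545555155555699445a99a9595944055555155540556565555955555699445a996959594405555515554055656555595555541166501151515166a5555595556a554545555155555699445a9959595944055555155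544556565555955555699445a995559594405555515554455656555595555541166501156515166a55555955566554545555155555699445a9954595944055555155544556665555955555699445a995419594405555515554455666555595555541166501156a15166a55555955566554445555155555699445a995409594405555515554455666555995555515a5556596a950454410455599541555455556a555559505554514015a65669a6555515695556555540555559505554514015665669a65555156955565555405555515a5556596a955454410455559541555455556a555559505554514015565669a65555156955565555505555515a5556596a955554410455559541555455555a5555515a5556596a955954410455559541555455555a555559505554514015515669a65555156a5556555550555559505554514011515669a65555156a55565555505555515a5556596a9a5954410455559540555455555a555559505554514010515669a65555156a55569555505555558404155554196a05156656565554556665554455555526a69555569140a5954454555556554445556655555526a695555691406595445455555655444555665555558404155554196a55156656555554556665554455555526a6955556914055954454555556554455556655555526a695555691405555445455555655445555665555558404155554196a55656656555554556655554455555526a6955556914055454454555556554455556a5555558404155554196a5665665655555455665555405555558404155554196a5a656656555554556655554055555526a6955556914050454454555556954455556a5555544115101155556666a01556959565655545554155555669959a99555544440a955415154555556555695555544115101155556666a1155695956555554555415555544115101155556666a51556959565555545554155555669959a9955554444059554155545555565556955555669959a995555444405555415554555556555695555544115101155556666a56556955565555545554155555669959a9955554444054554155545555565556a5555544115101155556666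a5665695556555554555405555544115101155556666a56a56955565555545554055555669959a9955554444054054155545555569556a55555

/-- The triangles at an edge, with the signs of the edge in their boundaries. -/
def edgeTriangles : Fin 88 → List (Fin 6 × Fin 11 × ℤ) :=
  ![[(3, 0, 1), (4, 0, 1), (5, 0, 1)], [(0, 0, 1), (2, 0, 1), (4, 10, 1)],
    [(0, 10, 1), (1, 0, 1), (5, 10, 1)], [(1, 10, 1), (2, 10, 1), (3, 10, 1)],
    [(0, 0, -1), (0, 10, -1)], [(1, 0, -1), (1, 10, -1)], [(2, 0, -1), (2, 10, -1)],
    [(3, 0, -1), (3, 10, -1)], [(4, 0, -1), (4, 10, -1)], [(5, 0, -1), (5, 10, -1)],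
    [(0, 3, 1), (0, 4, 1)], [(1, 3, 1), (1, 4, 1)], [(2, 6, 1), (2, 7, 1)],
    [(3, 0, 1), (3, 1, 1)], [(4, 0, 1), (4, 1, 1)], [(5, 0, 1), (5, 1, 1)],
    [(0, 3, -1), (1, 4, -1), (3, 1, -1)], [(1, 3, -1), (2, 6, -1), (4, 1, -1)],
    [(0, 4, -1), (2, 7, -1), (5, 1, -1)], [(0, 0, 1), (0, 1, 1)], [(1, 6, 1), (1, 7, 1)],
    [(2, 0, 1), (2, 1, 1)], [(3, 3, 1), (3, 4, 1)], [(4, 9, 1), (4, 10, 1)],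
    [(5, 6, 1), (5, 7, 1)], [(0, 1, -1), (1, 6, -1), (3, 3, -1)],
    [(2, 1, -1), (3, 4, -1), (5, 7, -1)], [(1, 7, -1), (4, 9, -1), (5, 6, -1)],
    [(0, 9, 1), (0, 10, 1)], [(1, 0, 1), (1, 1, 1)], [(2, 3, 1), (2, 4, 1)],
    [(3, 6, 1), (3, 7, 1)], [(4, 3, 1), (4, 4, 1)], [(5, 9, 1), (5, 10, 1)],
    [(1, 1, -1), (2, 4, -1), (4, 3, -1)], [(2, 3, -1), (3, 6, -1), (5, 9, -1)],
    [(0, 9, -1), (3, 7, -1), (4, 4, -1)], [(0, 6, 1), (0, 7, 1)], [(1, 9, 1), (1, 10, 1)],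
    [(2, 9, 1), (2, 10, 1)], [(3, 9, 1), (3, 10, 1)], [(4, 6, 1), (4, 7, 1)],
    [(5, 3, 1), (5, 4, 1)], [(0, 6, -1), (2, 9, -1), (5, 3, -1)],
    [(1, 9, -1), (4, 7, -1), (5, 4, -1)], [(0, 7, -1), (3, 9, -1), (4, 6, -1)],
    [(0, 2, 1), (0, 3, 1)], [(0, 1, 1), (0, 2, -1)], [(0, 4, 1), (0, 5, 1)],
    [(0, 5, -1), (0, 6, 1)], [(0, 8, 1), (0, 9, 1)], [(0, 7, 1), (0, 8, -1)],
    [(1, 4, 1), (1, 5, 1)], [(1, 5, -1), (1, 6, 1)], [(1, 2, 1), (1, 3, 1)],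
    [(1, 1, 1), (1, 2, -1)], [(1, 7, 1), (1, 8, 1)], [(1, 8, -1), (1, 9, 1)],
    [(2, 5, 1), (2, 6, 1)], [(2, 4, 1), (2, 5, -1)], [(2, 7, 1), (2, 8, 1)],
    [(2, 8, -1), (2, 9, 1)], [(2, 1, 1), (2, 2, 1)], [(2, 2, -1), (2, 3, 1)],
    [(3, 1, 1), (3, 2, 1)], [(3, 2, -1), (3, 3, 1)], [(3, 4, 1), (3, 5, 1)],
    [(3, 5, -1), (3, 6, 1)], [(3, 7, 1), (3, 8, 1)], [(3, 8, -1), (3, 9, 1)],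
    [(4, 1, 1), (4, 2, 1)], [(4, 2, -1), (4, 3, 1)], [(4, 8, 1), (4, 9, 1)],
    [(4, 7, 1), (4, 8, -1)], [(4, 4, 1), (4, 5, 1)], [(4, 5, -1), (4, 6, 1)],
    [(5, 1, 1), (5, 2, 1)], [(5, 2, -1), (5, 3, 1)], [(5, 7, 1), (5, 8, 1)],
    [(5, 8, -1), (5, 9, 1)], [(5, 5, 1), (5, 6, 1)], [(5, 4, 1), (5, 5, -1)],
    [(0, 2, 1), (1, 5, 1), (3, 2, 1)], [(1, 2, 1), (2, 5, 1), (4, 2, 1)],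
    [(0, 5, 1), (2, 8, 1), (5, 2, 1)], [(2, 2, 1), (3, 5, 1), (5, 8, 1)],
    [(1, 8, 1), (4, 8, 1), (5, 5, 1)], [(0, 8, 1), (3, 8, 1), (4, 5, 1)]]

/-- The number of an edge. -/
def edgeNumber (u v : Fin 23) : Fin 88 := Fin.ofNat 88 (edgeCode >>> (7 * (23 * u.1 + v.1)) % 128)

/-- The coefficients of the chains that fill the edges. -/
def filling (e : Fin 88) (t : Fin 6 × Fin 11) : ℤ :=
  (fillingCode >>> (2 * (88 * (11 * t.1.1 + t.2.1) + e.1)) % 4 : ℕ) - 1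

/-- The vertices of a triangle in increasing order. -/
def sortedTriangle (t : Fin 6 × Fin 11) : Fin 23 × Fin 23 × Fin 23 :=
  let a : Fin 23 := ⟨5 + t.1, by lia⟩
  let b := fineCycle t.1 t.2
  let c := fineCycle t.1 (t.2 + 1)
  (min a (min b c), max (min b c) (min a (max b c)), max a (max b c))

/-- The edges of a triangle. -/
def triangleEdges (t : Fin 6 × Fin 11) : Fin 88 × Fin 88 × Fin 88 :=
  let s := sortedTriangle t
  (edgeNumber s.2.1 s.2.2, edgeNumber s.1 s.2.2, edgeNumber s.1 s.2.1)

/-- The boundary of a triangle. -/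
def triangleBoundary (t : Fin 6 × Fin 11) : Fin 88 → ℤ :=
  let s := triangleEdges t
  Pi.single s.1 1 - Pi.single s.2.1 1 + Pi.single s.2.2 1

/-- The path from the base vertex to a vertex. -/
def vertexPath (v : Fin 23) : Fin 88 → ℤ :=
  (if v = 0 then 0 else Pi.single (edgeNumber (fineParent v) v) 1) +
    if fineParent v = 0 then 0 else Pi.single (edgeNumber 0 (fineParent v)) 1

theorem fineEdge_lt (e : Fin 88) : (fineEdge e).1 < (fineEdge e).2 := by
  revert e
  decide +kernel

theorem edgeNumber_fineEdge (e : Fin 88) : edgeNumber (fineEdge e).1 (fineEdge e).2 = e := by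
  revert e
  decide +kernel

theorem fineEdge_edgeNumber_parent (v : Fin 23) (hv : v ≠ 0) :
    fineEdge (edgeNumber (fineParent v) v) = (fineParent v, v) := by
  revert v
  decide +kernel

theorem fineEdge_edgeNumber_zero (v : Fin 23) (hv : fineParent v ≠ 0) :
    fineEdge (edgeNumber 0 (fineParent v)) = (0, fineParent v) := by
  revert v
  decide +kernel

theorem fineEdge_triangleEdges (t : Fin 6 × Fin 11) :
    fineEdge (triangleEdges t).1 = ((sortedTriangle t).2.1, (sortedTriangle t).2.2) ∧
    fineEdge (triangleEdges t).2.1 = ((sortedTriangle t).1, (sortedTriangle t).2.2) ∧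
    fineEdge (triangleEdges t).2.2 = ((sortedTriangle t).1, (sortedTriangle t).2.1) := by
  revert t
  decide +kernel

theorem sortedTriangle_lt (t : Fin 6 × Fin 11) :
    (sortedTriangle t).1 < (sortedTriangle t).2.1 ∧
      (sortedTriangle t).2.1 < (sortedTriangle t).2.2 := by
  revert t
  decide +kernel

theorem fineTriangle_eq_sortedTriangle (t : Fin 6 × Fin 11) :
    fineTriangle t.1 t.2 = {(sortedTriangle t).1, (sortedTriangle t).2.1, (sortedTriangle t).2.2} := by
  revert t
  decide +kernel

theorem fineEdge_mem (e : Fin 88) :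
    ∃ t : Fin 6 × Fin 11, {(fineEdge e).1, (fineEdge e).2} ⊆ fineTriangle t.1 t.2 := by
  have : ∀ e, ∃ t ∈ (edgeTriangles e).head?,
      {(fineEdge e).1, (fineEdge e).2} ⊆ fineTriangle t.1 t.2.1 := by
    decide +kernel
  obtain ⟨t, -, h⟩ := this e
  exact ⟨(t.1, t.2.1), h⟩

/-- The table `edgeTriangles` is the transposed incidence matrix. An edge meets only two or three
triangles, which keeps the check in `boundary_filling` short. -/
theorem triangleBoundary_eq (t : Fin 6 × Fin 11) (e : Fin 88) :
    triangleBoundary t e =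
      ((edgeTriangles e).map fun r => if (r.1, r.2.1) = t then r.2.2 else 0).sum := by
  revert t e
  decide +kernel

/-- The contraction identity on triangles, where only `h∂` contributes; it kills the second
homology. -/
theorem filling_boundary (t t' : Fin 6 × Fin 11) :
    filling (triangleEdges t).1 t' - filling (triangleEdges t).2.1 t' +
      filling (triangleEdges t).2.2 t' = if t' = t then 1 else 0 := by
  revert t t'
  decide +kernel

/-- The contraction identity on edges: `filling e` bounds the edge closed up by the chosen paths
from the base vertex to its ends. -/
theorem boundary_filling (e e' : Fin 88) :
    ((edgeTriangles e').map fun r => filling e (r.1, r.2.1) * r.2.2).sum +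
      (vertexPath (fineEdge e).2 e' - vertexPath (fineEdge e).1 e') = if e' = e then 1 else 0 := by
  revert e e'
  decide +kernel

/-- The simplex on the vertices of an edge. -/
def edgeSimplex (e : Fin 88) : Finset (Fin 23) := {(fineEdge e).1, (fineEdge e).2}

/-- The 1-chain with the given coefficients. -/
noncomputable def edgeChain : (Fin 88 → ℤ) →ₗ[ℤ] Finset (Fin 23) →₀ ℤ :=
  Fintype.linearCombination ℤ fun e => Finsupp.single (edgeSimplex e) 1

/-- The 2-chain with the given coefficients. -/
noncomputable def triangleChain : (Fin 6 × Fin 11 → ℤ) →ₗ[ℤ] Finset (Fin 23) →₀ ℤ :=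
  Fintype.linearCombination ℤ fun t => Finsupp.single (fineTriangle t.1 t.2) 1

theorem edgeChain_single (e : Fin 88) :
    edgeChain (Pi.single e 1) = Finsupp.single (edgeSimplex e) 1 := by
  simp [edgeChain, Fintype.linearCombination_apply_single]

theorem triangleChain_single (t : Fin 6 × Fin 11) :
    triangleChain (Pi.single t 1) = Finsupp.single (fineTriangle t.1 t.2) 1 := by
  simp [triangleChain, Fintype.linearCombination_apply_single]

theorem card_edgeSimplex (e : Fin 88) : (edgeSimplex e).card = 2 :=
  Finset.card_pair (fineEdge_lt e).ne

theorem edgeSimplex_mem (e : Fin 88) : edgeSimplex e ∈ fineComplex.faces := by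
  obtain ⟨t, ht⟩ := fineEdge_mem e
  exact ⟨Finset.insert_nonempty _ _, _, ⟨t, rfl⟩, ht⟩

theorem fineTriangle_mem_faces (t : Fin 6 × Fin 11) :
    fineTriangle t.1 t.2 ∈ fineComplex.faces :=
  ⟨Finset.card_pos.1 (by rw [card_fineTriangle]; norm_num), _, ⟨t, rfl⟩, subset_rfl⟩

theorem single_mem_augmentedChains {V : Type*} [LinearOrder V] {K : AbstractSimplicialComplex V}
    {s : Finset V} (hs : s ∈ K.faces ∨ s = ∅) :
    Finsupp.single s 1 ∈ augmentedChains K s.card :=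
  Finsupp.single_mem_supported ℤ 1 ⟨hs, rfl⟩

theorem edgeChain_mem (f : Fin 88 → ℤ) : edgeChain f ∈ augmentedChains fineComplex 2 := by
  rw [edgeChain, Fintype.linearCombination_apply]
  refine Submodule.sum_mem _ fun e _ => Submodule.smul_mem _ _ ?_
  rw [← card_edgeSimplex e]
  exact single_mem_augmentedChains (Or.inl (edgeSimplex_mem e))

theorem triangleChain_mem (f : Fin 6 × Fin 11 → ℤ) :
    triangleChain f ∈ augmentedChains fineComplex 3 := by
  rw [triangleChain, Fintype.linearCombination_apply]
  refine Submodule.sum_mem _ fun t _ => Submodule.smul_mem _ _ ?_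
  rw [← card_fineTriangle t.1 t.2]
  exact single_mem_augmentedChains (Or.inl (fineTriangle_mem_faces t))

theorem edgeSimplex_edgeNumber_eq {e : Fin 88} {u v : Fin 23} (h : fineEdge e = (u, v)) :
    edgeSimplex e = {u, v} := by
  rw [edgeSimplex, h]

theorem edgeSimplex_injective : Function.Injective edgeSimplex := by
  intro e e' h
  have h1 := fineEdge_lt e
  have h2 := fineEdge_lt e'
  have h3 : fineEdge e = fineEdge e' := by
    simp only [edgeSimplex, Finset.ext_iff, Finset.mem_insert, Finset.mem_singleton] at h
    have a1 := (h (fineEdge e).1).1 (Or.inl rfl)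
    have a2 := (h (fineEdge e).2).1 (Or.inr rfl)
    have b1 := (h (fineEdge e').1).2 (Or.inl rfl)
    have b2 := (h (fineEdge e').2).2 (Or.inr rfl)
    clear h
    ext1 <;> grind
  rw [← edgeNumber_fineEdge e, h3, edgeNumber_fineEdge]

theorem simplexBoundary_edgeSimplex (e : Fin 88) :
    simplexBoundary (edgeSimplex e) =
      Finsupp.single {(fineEdge e).2} 1 - Finsupp.single {(fineEdge e).1} 1 :=
  simplexBoundary_pair (fineEdge_lt e)

theorem simplexBoundary_fineTriangle (t : Fin 6 × Fin 11) :
    simplexBoundary (fineTriangle t.1 t.2) = edgeChain (triangleBoundary t) := by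
  obtain ⟨h, h'⟩ := sortedTriangle_lt t
  obtain ⟨e1, e2, e3⟩ := fineEdge_triangleEdges t
  rw [fineTriangle_eq_sortedTriangle, simplexBoundary_triple h h', triangleBoundary, map_add,
    map_sub, edgeChain_single, edgeChain_single, edgeChain_single, edgeSimplex_edgeNumber_eq e1,
    edgeSimplex_edgeNumber_eq e2, edgeSimplex_edgeNumber_eq e3]

theorem fineParent_zero : fineParent 0 = 0 := rfl

/-- The chosen paths have length at most two, through `fineParent`, and their boundaries telescope.
-/
theorem chainBoundary_vertexPath (v : Fin 23) :
    chainBoundary (Fin 23) (edgeChain (vertexPath v)) =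
      Finsupp.single {v} 1 - Finsupp.single {0} 1 := by
  have h1 : chainBoundary (Fin 23) (edgeChain
      (if v = 0 then 0 else Pi.single (edgeNumber (fineParent v) v) 1)) =
      Finsupp.single {v} 1 - Finsupp.single {fineParent v} 1 := by
    split_ifs with h
    · subst h
      simp [fineParent_zero]
    · rw [edgeChain_single, chainBoundary_single, simplexBoundary_edgeSimplex,
        fineEdge_edgeNumber_parent v h]
  have h2 : chainBoundary (Fin 23) (edgeChain
      (if fineParent v = 0 then 0 else Pi.single (edgeNumber 0 (fineParent v)) 1)) =
      Finsupp.single {fineParent v} 1 - Finsupp.single {0} 1 := by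
    split_ifs with h
    · simp [h]
    · rw [edgeChain_single, chainBoundary_single, simplexBoundary_edgeSimplex,
        fineEdge_edgeNumber_zero v h]
  rw [vertexPath, map_add, map_add, h1, h2]
  abel

theorem chainBoundary_triangleChain_filling (e : Fin 88) :
    chainBoundary (Fin 23) (triangleChain (filling e)) +
      edgeChain (vertexPath (fineEdge e).2 - vertexPath (fineEdge e).1) =
      Finsupp.single (edgeSimplex e) 1 := by
  have h1 : chainBoundary (Fin 23) (triangleChain (filling e)) =
      edgeChain (∑ t, filling e t • triangleBoundary t) := by
    simp only [triangleChain, Fintype.linearCombination_apply, map_sum, map_smul,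
      chainBoundary_single, simplexBoundary_fineTriangle]
  have h2 : (∑ t, filling e t • triangleBoundary t) +
      (vertexPath (fineEdge e).2 - vertexPath (fineEdge e).1) = Pi.single e 1 := by
    ext e'
    -- The sum over all triangles collapses to the sum over the triangles at the edge.
    have key : ∀ l : List (Fin 6 × Fin 11 × ℤ),
        ∑ t, filling e t * (l.map fun r => if (r.1, r.2.1) = t then r.2.2 else 0).sum =
          (l.map fun r => filling e (r.1, r.2.1) * r.2.2).sum := by
      intro l
      induction l with
      | nil => simp
      | cons r l ih =>
        simp only [List.map_cons, List.sum_cons, mul_add, Finset.sum_add_distrib, ih]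
        simp
    rw [Pi.single_apply, ← boundary_filling e e', ← key]
    simp only [Pi.add_apply, Pi.sub_apply, Finset.sum_apply, Pi.smul_apply, smul_eq_mul,
      triangleBoundary_eq]
  rw [h1, ← map_add, h2, edgeChain_single]

theorem triangleChain_filling (t : Fin 6 × Fin 11) :
    triangleChain (filling (triangleEdges t).1) - triangleChain (filling (triangleEdges t).2.1) +
      triangleChain (filling (triangleEdges t).2.2) =
        Finsupp.single (fineTriangle t.1 t.2) 1 := by
  rw [← triangleChain_single, ← map_sub, ← map_add]
  congr 1
  ext t'
  rw [Pi.single_apply]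
  exact filling_boundary t t'

/-- A chain contraction of the augmented chain complex. -/
noncomputable def fineContraction (s : Finset (Fin 23)) : Finset (Fin 23) →₀ ℤ :=
  if s = ∅ then Finsupp.single {0} 1
  else if s.card = 1 then ∑ v ∈ s, edgeChain (vertexPath v)
  else ∑ e, if edgeSimplex e = s then triangleChain (filling e) else 0

theorem fineContraction_singleton (v : Fin 23) :
    fineContraction {v} = edgeChain (vertexPath v) := by
  simp [fineContraction]

theorem fineContraction_edgeSimplex (e : Fin 88) :
    fineContraction (edgeSimplex e) = triangleChain (filling e) := by
  have h := card_edgeSimplex e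
  rw [fineContraction, if_neg (by rw [← Finset.card_eq_zero, h]; norm_num),
    if_neg (by rw [h]; norm_num)]
  simp [edgeSimplex_injective.eq_iff]

theorem fineContraction_fineTriangle (t : Fin 6 × Fin 11) :
    fineContraction (fineTriangle t.1 t.2) = 0 := by
  have h := card_fineTriangle t.1 t.2
  rw [fineContraction, if_neg (by rw [← Finset.card_eq_zero, h]; norm_num),
    if_neg (by rw [h]; norm_num)]
  refine Finset.sum_eq_zero fun e _ => if_neg fun he => ?_
  have := card_edgeSimplex e
  rw [he, h] at this
  norm_num at this

theorem exists_edgeSimplex_eq (t : Fin 6 × Fin 11) {u v : Fin 23} (hu : u ∈ fineTriangle t.1 t.2)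
    (hv : v ∈ fineTriangle t.1 t.2) (huv : u ≠ v) : ∃ e, edgeSimplex e = {u, v} := by
  obtain ⟨e1, e2, e3⟩ := fineEdge_triangleEdges t
  have h1 := edgeSimplex_edgeNumber_eq e1
  have h2 := edgeSimplex_edgeNumber_eq e2
  have h3 := edgeSimplex_edgeNumber_eq e3
  rw [fineTriangle_eq_sortedTriangle] at hu hv
  simp only [Finset.mem_insert, Finset.mem_singleton] at hu hv
  rcases hu with rfl | rfl | rfl <;> rcases hv with rfl | rfl | rfl
  any_goals exact absurd rfl huv
  · exact ⟨_, h3⟩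
  · exact ⟨_, h2⟩
  · exact ⟨_, h3.trans (Finset.pair_comm _ _)⟩
  · exact ⟨_, h1⟩
  · exact ⟨_, h2.trans (Finset.pair_comm _ _)⟩
  · exact ⟨_, h1.trans (Finset.pair_comm _ _)⟩

theorem fineComplex_face_cases {s : Finset (Fin 23)} (hs : s ∈ fineComplex.faces) :
    (∃ v, s = {v}) ∨ (∃ e, s = edgeSimplex e) ∨ ∃ t : Fin 6 × Fin 11, s = fineTriangle t.1 t.2 := by
  obtain ⟨hne, _, ⟨t, rfl⟩, h⟩ := hs
  have h3 := Finset.card_le_card h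
  rw [card_fineTriangle] at h3
  have h0 := hne.card_pos
  obtain h1 | h2 | h3 : s.card = 1 ∨ s.card = 2 ∨ s.card = 3 := by lia
  · exact Or.inl (Finset.card_eq_one.1 h1)
  · obtain ⟨u, v, huv, rfl⟩ := Finset.card_eq_two.1 h2
    obtain ⟨e, he⟩ := exists_edgeSimplex_eq t (h (by simp)) (h (by simp)) huv
    exact Or.inr (Or.inl ⟨e, he.symm⟩)
  · exact Or.inr (Or.inr ⟨t, Finset.eq_of_subset_of_card_le h (by rw [card_fineTriangle, h3])⟩)

theorem isZAcyclic_fineComplex : IsZAcyclic fineComplex := by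
  apply isZAcyclic_of_contraction fineContraction
  · rintro s (hs | rfl)
    · rcases fineComplex_face_cases hs with ⟨v, rfl⟩ | ⟨e, rfl⟩ | ⟨t, rfl⟩
      · rw [fineContraction_singleton]
        exact edgeChain_mem _
      · rw [fineContraction_edgeSimplex, card_edgeSimplex]
        exact triangleChain_mem _
      · rw [fineContraction_fineTriangle]
        exact zero_mem _
    · rw [fineContraction, if_pos rfl]
      exact single_mem_augmentedChains (Or.inl (fineComplex.singleton_mem 0))
  · rintro s (hs | rfl)
    · rcases fineComplex_face_cases hs with ⟨v, rfl⟩ | ⟨e, rfl⟩ | ⟨t, rfl⟩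
      · rw [fineContraction_singleton, simplexBoundary_singleton, chainBoundary_vertexPath,
          Finsupp.linearCombination_single, one_smul, fineContraction, if_pos rfl, sub_add_cancel]
      · rw [fineContraction_edgeSimplex, simplexBoundary_edgeSimplex, map_sub,
          Finsupp.linearCombination_single, Finsupp.linearCombination_single, one_smul, one_smul,
          fineContraction_singleton, fineContraction_singleton, ← map_sub,
          chainBoundary_triangleChain_filling]
      · rw [fineContraction_fineTriangle, map_zero, zero_add, simplexBoundary_fineTriangle,
          triangleBoundary, map_add, map_sub, edgeChain_single, edgeChain_single,
          edgeChain_single, map_add, map_sub, Finsupp.linearCombination_single,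
          Finsupp.linearCombination_single, Finsupp.linearCombination_single, one_smul, one_smul,
          one_smul, fineContraction_edgeSimplex, fineContraction_edgeSimplex,
          fineContraction_edgeSimplex, triangleChain_filling]
    · rw [fineContraction, if_pos rfl, simplexBoundary_empty, map_zero, add_zero,
        chainBoundary_single, simplexBoundary_singleton]

/-! ### The dodecahedron -/

/-- The ring `ℤ[φ]`. -/
abbrev GoldenInteger : Type := QuadraticAlgebra ℤ 1 1

/-- The embedding of `ℤ[φ]` into the real numbers. -/
noncomputable def goldenReal : GoldenInteger →+* ℝ :=
  (QuadraticAlgebra.lift ⟨φ, by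
    rw [← pow_two, Real.goldenRatio_sq, one_smul, one_smul, add_comm]⟩).toRingHom

theorem goldenReal_apply (x : GoldenInteger) : goldenReal x = x.re + x.im * φ := by
  simp [goldenReal, QuadraticAlgebra.lift]

/-- A sufficient condition for positivity in `ℤ[φ]`. -/
def GoldenInteger.isPositive (x : GoldenInteger) : Bool :=
  decide (0 < 5 * x.re + 8 * x.im) && decide (0 < 8 * x.re + 13 * x.im)

/-- An affine function positive at `8/5` and at `13/8` is positive at `φ`, which lies between these
Fibonacci quotients. -/
theorem GoldenInteger.isPositive.pos {x : GoldenInteger} (h : x.isPositive = true) :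
    0 < goldenReal x := by
  simp only [isPositive, Bool.and_eq_true, decide_eq_true_eq] at h
  have h1 : (0 : ℝ) < 5 * x.re + 8 * x.im := by exact_mod_cast h.1
  have h2 : (0 : ℝ) < 8 * x.re + 13 * x.im := by exact_mod_cast h.2
  rw [goldenReal_apply]
  have h3 := Real.goldenRatio_sq
  have h4 := Real.one_lt_goldenRatio
  have hl : 8 / 5 < φ := by nlinarith
  have hu : φ < 13 / 8 := by nlinarith
  by_cases h0 : (0 : ℝ) ≤ x.im
  · nlinarith
  · nlinarith

/-- The inner product of vectors over `ℤ[φ]`. -/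
def goldenDot (x y : Fin 3 → GoldenInteger) : GoldenInteger :=
  x 0 * y 0 + x 1 * y 1 + x 2 * y 2

/-- The outer normal vectors of the faces. -/
def dodecaNormal : Fin 12 → Fin 3 → GoldenInteger :=
  ![![⟨0, 0⟩, ⟨0, 1⟩, ⟨1, 0⟩], ![⟨1, 0⟩, ⟨0, 0⟩, ⟨0, 1⟩], ![⟨0, 1⟩, ⟨1, 0⟩, ⟨0, 0⟩],
    ![⟨0, 0⟩, ⟨0, 1⟩, ⟨-1, 0⟩], ![⟨-1, 0⟩, ⟨0, 0⟩, ⟨0, 1⟩], ![⟨0, 1⟩, ⟨-1, 0⟩, ⟨0, 0⟩],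
    ![⟨0, 0⟩, ⟨0, -1⟩, ⟨1, 0⟩], ![⟨1, 0⟩, ⟨0, 0⟩, ⟨0, -1⟩], ![⟨0, -1⟩, ⟨1, 0⟩, ⟨0, 0⟩],
    ![⟨0, 0⟩, ⟨0, -1⟩, ⟨-1, 0⟩], ![⟨-1, 0⟩, ⟨0, 0⟩, ⟨0, -1⟩], ![⟨0, -1⟩, ⟨-1, 0⟩, ⟨0, 0⟩]]

/-- The vertices of the dodecahedron. -/
def dodecaVertex : Fin 20 → Fin 3 → GoldenInteger :=
  ![![⟨1, 0⟩, ⟨1, 0⟩, ⟨1, 0⟩], ![⟨1, 0⟩, ⟨1, 0⟩, ⟨-1, 0⟩], ![⟨1, 0⟩, ⟨-1, 0⟩, ⟨1, 0⟩],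
    ![⟨1, 0⟩, ⟨-1, 0⟩, ⟨-1, 0⟩], ![⟨-1, 0⟩, ⟨1, 0⟩, ⟨1, 0⟩], ![⟨-1, 0⟩, ⟨1, 0⟩, ⟨-1, 0⟩],
    ![⟨-1, 0⟩, ⟨-1, 0⟩, ⟨1, 0⟩], ![⟨-1, 0⟩, ⟨-1, 0⟩, ⟨-1, 0⟩], ![⟨0, 1⟩, ⟨0, 0⟩, ⟨-1, 1⟩],
    ![⟨-1, 1⟩, ⟨0, 1⟩, ⟨0, 0⟩], ![⟨0, 0⟩, ⟨-1, 1⟩, ⟨0, 1⟩], ![⟨0, 1⟩, ⟨0, 0⟩, ⟨1, -1⟩],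
    ![⟨1, -1⟩, ⟨0, 1⟩, ⟨0, 0⟩], ![⟨0, 0⟩, ⟨1, -1⟩, ⟨0, 1⟩], ![⟨0, -1⟩, ⟨0, 0⟩, ⟨-1, 1⟩],
    ![⟨-1, 1⟩, ⟨0, -1⟩, ⟨0, 0⟩], ![⟨0, 0⟩, ⟨-1, 1⟩, ⟨0, -1⟩], ![⟨0, -1⟩, ⟨0, 0⟩, ⟨1, -1⟩],
    ![⟨1, -1⟩, ⟨0, -1⟩, ⟨0, 0⟩], ![⟨0, 0⟩, ⟨1, -1⟩, ⟨0, -1⟩]]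

/-- The vertices of the faces, in cyclic order. -/
def dodecaCycle : Fin 12 → Fin 5 → Fin 20 :=
  ![![0, 9, 12, 4, 10], ![0, 10, 13, 2, 8], ![0, 8, 11, 1, 9], ![1, 16, 5, 12, 9],
    ![4, 14, 6, 13, 10], ![2, 15, 3, 11, 8], ![2, 13, 6, 18, 15], ![1, 11, 3, 19, 16],
    ![4, 12, 5, 17, 14], ![3, 15, 18, 7, 19], ![5, 16, 19, 7, 17], ![6, 14, 17, 7, 18]]

/-- The neighbours of the faces, in cyclic order. -/
def dodecaNeighbour : Fin 12 → Fin 5 → Fin 12 :=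
  ![![2, 3, 8, 4, 1], ![0, 4, 6, 5, 2], ![1, 5, 7, 3, 0], ![7, 10, 8, 0, 2], ![8, 11, 6, 1, 0],
    ![6, 9, 7, 2, 1], ![1, 4, 11, 9, 5], ![2, 5, 9, 10, 3], ![0, 3, 10, 11, 4],
    ![5, 6, 11, 10, 7], ![3, 7, 9, 11, 8], ![4, 8, 10, 9, 6]]

/-- The gluings of the faces on the vertices and centres. -/
def dodecaGluing : Fin 12 → Fin 32 → Fin 32 :=
  ![![9, 1, 2, 3, 4, 5, 6, 7, 8, 9, 10, 11, 15, 13, 14, 15, 30, 17, 18, 19, 20, 31, 27, 23, 19, 25, 26, 27, 28, 29, 30, 31],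
    ![0, 10, 2, 3, 4, 5, 6, 7, 8, 9, 10, 11, 17, 13, 31, 15, 16, 17, 18, 19, 28, 21, 29, 23, 24, 19, 26, 27, 28, 29, 30, 31],
    ![0, 1, 11, 3, 4, 5, 6, 7, 8, 9, 10, 11, 18, 29, 14, 15, 16, 17, 18, 19, 30, 26, 22, 19, 24, 25, 26, 27, 28, 29, 30, 31],
    ![0, 1, 2, 6, 4, 5, 6, 7, 8, 9, 10, 11, 12, 27, 14, 15, 16, 18, 18, 19, 20, 14, 22, 23, 25, 25, 26, 27, 30, 29, 30, 31],
    ![0, 1, 2, 3, 7, 5, 6, 7, 8, 9, 10, 11, 12, 13, 14, 15, 28, 17, 15, 19, 20, 21, 13, 23, 24, 23, 31, 27, 28, 29, 30, 31],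
    ![0, 1, 2, 3, 4, 8, 6, 7, 8, 9, 10, 11, 12, 13, 26, 17, 16, 17, 18, 19, 16, 21, 22, 24, 24, 25, 26, 29, 28, 29, 30, 31],
    ![0, 1, 2, 3, 4, 5, 3, 7, 8, 9, 10, 11, 12, 13, 21, 15, 16, 17, 17, 19, 20, 21, 22, 23, 24, 24, 26, 13, 28, 29, 28, 31],
    ![0, 1, 2, 3, 4, 5, 6, 4, 8, 9, 10, 11, 12, 22, 14, 18, 16, 17, 18, 19, 20, 21, 22, 25, 24, 25, 26, 27, 16, 29, 30, 26],
    ![0, 1, 2, 3, 4, 5, 6, 7, 5, 9, 10, 11, 12, 13, 14, 15, 20, 15, 18, 19, 20, 21, 22, 23, 23, 25, 14, 27, 28, 27, 30, 31],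
    ![0, 1, 2, 3, 4, 5, 6, 7, 8, 0, 10, 11, 12, 13, 14, 12, 16, 17, 18, 24, 20, 21, 22, 23, 24, 25, 26, 22, 28, 29, 16, 21],
    ![0, 1, 2, 3, 4, 5, 6, 7, 8, 9, 1, 11, 12, 13, 14, 15, 16, 12, 18, 25, 20, 21, 22, 23, 24, 25, 26, 27, 20, 22, 30, 14],
    ![0, 1, 2, 3, 4, 5, 6, 7, 8, 9, 10, 2, 12, 13, 14, 15, 16, 17, 12, 23, 20, 21, 22, 23, 24, 25, 21, 27, 28, 13, 20, 31]]

/-- The images of the centres and vertices in the 2-skeleton. -/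
def dodecaLabel : Fin 32 → SkeletonVertex :=
  ![.inr 0, .inr 1, .inr 2, .inr 3, .inr 4, .inr 5, .inr 3, .inr 4, .inr 5, .inr 0, .inr 1,
    .inr 2, .inl 0, .inl 3, .inl 2, .inl 0, .inl 4, .inl 0, .inl 0, .inl 1, .inl 4, .inl 2,
    .inl 3, .inl 1, .inl 1, .inl 1, .inl 2, .inl 3, .inl 4, .inl 3, .inl 4, .inl 2]

/-- Five times the positions of the centres and vertices. -/
def dodecaCoordinate (p : Fin 32) : Fin 3 → GoldenInteger :=
  Fin.addCases (m := 12) (n := 20) (fun n k => ⟨2, 1⟩ * dodecaNormal n k)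
    (fun v k => 5 * dodecaVertex v k) p

/-- The number of the centre of a face. -/
def dodecaCentre (n : Fin 12) : Fin 32 := Fin.castAdd 20 n

/-- The number of a vertex of a face. -/
def dodecaCorner (n : Fin 12) (i : Fin 5) : Fin 32 := Fin.natAdd 12 (dodecaCycle n i)

/-- The `i`-th triangle of a face. -/
def dodecaTriangle (t : Fin 12 × Fin 5) : Finset (Fin 32) :=
  {dodecaCentre t.1, dodecaCorner t.1 t.2, dodecaCorner t.1 (t.2 + 1)}

/-- The linear form with the maximum on a triangle, up to a rescaling of the centres. -/
def supportForm (t : Fin 12 × Fin 5) (k : Fin 3) : GoldenInteger :=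
  2 * dodecaNormal t.1 k + dodecaNormal (dodecaNeighbour t.1 t.2) k

/-- At a fixed centre or vertex, the support form of `t` is largest exactly when `t` contains the
point. The maxima for centres and for vertices differ, which is harmless: values are compared only
at one point for different triangles. -/
theorem supportForm_centre (t : Fin 12 × Fin 5) (n : Fin 12) :
    if n = t.1 then goldenDot (supportForm t) (dodecaCoordinate (dodecaCentre n)) = ⟨11, 13⟩
    else (⟨11, 13⟩ - goldenDot (supportForm t) (dodecaCoordinate (dodecaCentre n))).isPositive
      = true := by
  revert t n
  decide +kernel

theorem supportForm_vertex (t : Fin 12 × Fin 5) (v : Fin 20) :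
    if Fin.natAdd 12 v ∈ dodecaTriangle t then
      goldenDot (supportForm t) (dodecaCoordinate (Fin.natAdd 12 v)) = ⟨15, 15⟩
    else (⟨15, 15⟩ - goldenDot (supportForm t) (dodecaCoordinate (Fin.natAdd 12 v))).isPositive
      = true := by
  revert t v
  decide +kernel

/-- Twice the identity matrix, written through the normal and two corners of a triangle and the
basis dual to them up to scale. -/
theorem dodeca_coordinates (t : Fin 12 × Fin 5) (k l : Fin 3) :
    let n := dodecaNormal t.1
    let m := dodecaNormal (dodecaNeighbour t.1 t.2)
    (n l - m l) * n k +
      (m l - dodecaNormal (dodecaNeighbour t.1 (t.2 + 1)) l) * dodecaVertex (dodecaCycle t.1 t.2) k +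
      (m l - dodecaNormal (dodecaNeighbour t.1 (t.2 - 1)) l) *
        dodecaVertex (dodecaCycle t.1 (t.2 + 1)) k = if k = l then 2 else 0 := by
  revert t k l
  decide +kernel

theorem dodecaNormal_dot_coordinate_nonneg (n : Fin 12) (p : Fin 32) :
    goldenDot (dodecaNormal n) (dodecaCoordinate p) = ⟨5, 5⟩ ∨
      (⟨5, 5⟩ - goldenDot (dodecaNormal n) (dodecaCoordinate p)).isPositive = true := by
  revert n p
  decide +kernel

theorem dodecaNormal_dot_coordinate (t : Fin 12 × Fin 5) {p : Fin 32} (hp : p ∈ dodecaTriangle t) :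
    goldenDot (dodecaNormal t.1) (dodecaCoordinate p) = ⟨5, 5⟩ := by
  revert t p
  decide +kernel

/-- The gluing with denominators cleared: `2 cos (π/5) = φ`, `2 sin (π/5) = (φ - 1) ‖n‖`, and `5φ² =
5 + 5φ` for the translation of the rescaled points. -/
theorem dodecaGluing_coordinate (t : Fin 12 × Fin 5) {p : Fin 32} (hp : p ∈ dodecaTriangle t) :
    let n := dodecaNormal t.1
    let x := dodecaCoordinate p
    let y := dodecaCoordinate (dodecaGluing t.1 p)
    2 * y 0 = ⟨0, 1⟩ * x 0 + ⟨-1, 1⟩ * (n 1 * x 2 - n 2 * x 1) - ⟨5, 5⟩ * n 0 ∧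
    2 * y 1 = ⟨0, 1⟩ * x 1 + ⟨-1, 1⟩ * (n 2 * x 0 - n 0 * x 2) - ⟨5, 5⟩ * n 1 ∧
    2 * y 2 = ⟨0, 1⟩ * x 2 + ⟨-1, 1⟩ * (n 0 * x 1 - n 1 * x 0) - ⟨5, 5⟩ * n 2 := by
  revert t p
  decide +kernel

theorem dodecaLabel_gluing (t : Fin 12 × Fin 5) {p : Fin 32} (hp : p ∈ dodecaTriangle t) :
    dodecaLabel (dodecaGluing t.1 p) = dodecaLabel p := by
  revert t p
  decide +kernel

theorem dodecaGluing_triangle (t : Fin 12 × Fin 5) :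
    ∃ t', ∀ p ∈ dodecaTriangle t, dodecaGluing t.1 p ∈ dodecaTriangle t' := by
  revert t
  decide +kernel

theorem dodecaLabel_injOn (t : Fin 12 × Fin 5) {p q : Fin 32} (hp : p ∈ dodecaTriangle t)
    (hq : q ∈ dodecaTriangle t) (h : dodecaLabel p = dodecaLabel q) : p = q := by
  revert t p q
  decide +kernel

theorem dodecaLabel_triangle (t : Fin 12 × Fin 5) :
    ∃ j i, ∀ p ∈ dodecaTriangle t, dodecaLabel p ∈ skeletonTriangle j i := by
  revert t
  decide +kernel

theorem exists_dodecaTriangle (j : Fin 6) (i : Fin 5) :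
    ∃ t, ∀ k ∈ skeletonTriangle j i, ∃ p ∈ dodecaTriangle t, dodecaLabel p = k := by
  revert j i
  decide +kernel

/-- The vertices of the `i`-th triangle of a face. -/
def dodecaList (t : Fin 12 × Fin 5) : List (Fin 32) :=
  [dodecaCentre t.1, dodecaCorner t.1 t.2, dodecaCorner t.1 (t.2 + 1)]

/-- Some simplex spanned by `T` is a face of the simplex `S` up to a gluing. -/
def isRelated (T S : List (Fin 32)) : Bool :=
  T.all (S.contains ·) || (List.finRange 12).any fun m =>
    T.all fun p => S.contains (dodecaGluing m p) &&
      (p == dodecaCentre m || (List.finRange 5).any fun i => p == dodecaCorner m i)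

/-- This makes the fibres of the labelling exactly the gluing classes: if the labels of a face `T`
of one triangle all occur in another triangle, then `T` is contained in the latter or a single
gluing carries it there. Chains of gluings never have to be considered. -/
theorem isRelated_of_label (n : Fin 12) (i : Fin 5) (n' : Fin 12) (i' : Fin 5) :
    (dodecaList (n, i)).sublists.all (fun T =>
      !(T.all fun p => (dodecaList (n', i')).any fun q => decide (dodecaLabel q = dodecaLabel p)) ||
        isRelated T (dodecaList (n', i'))) = true := by
  revert n i n' i'
  decide +kernel

/-! ### The triangulated boundary in Euclidean space -/

/-- A vector with coordinates in `ℤ[φ]`. -/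
noncomputable def goldenVector (a : Fin 3 → GoldenInteger) : EuclideanSpace ℝ (Fin 3) :=
  WithLp.toLp 2 fun k => goldenReal (a k)

theorem goldenVector_apply (a : Fin 3 → GoldenInteger) (k : Fin 3) :
    goldenVector a k = goldenReal (a k) :=
  rfl

theorem inner_goldenVector (a : Fin 3 → GoldenInteger) (x : EuclideanSpace ℝ (Fin 3)) :
    ⟪goldenVector a, x⟫_ℝ =
      goldenReal (a 0) * x 0 + goldenReal (a 1) * x 1 + goldenReal (a 2) * x 2 := by
  simp [goldenVector, PiLp.inner_apply, Fin.sum_univ_three, mul_comm]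

/-- The positions of the centres and vertices. -/
noncomputable def dodecaPoint (p : Fin 32) : EuclideanSpace ℝ (Fin 3) :=
  (1 / 5 : ℝ) • goldenVector (dodecaCoordinate p)

theorem inner_dodecaPoint (a : Fin 3 → GoldenInteger) (p : Fin 32) :
    ⟪goldenVector a, dodecaPoint p⟫_ℝ = goldenReal (goldenDot a (dodecaCoordinate p)) / 5 := by
  rw [dodecaPoint, inner_smul_right, inner_goldenVector]
  simp only [goldenVector_apply, goldenDot, map_add, map_mul]
  ring

/-- The outer normal vectors of the faces. -/
noncomputable def faceNormal (n : Fin 12) : EuclideanSpace ℝ (Fin 3) :=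
  goldenVector (dodecaNormal n)

theorem icosahedronVertices_eq : icosahedronVertices = Set.range faceNormal := by
  ext x
  constructor
  · rintro ⟨a, b, rfl | rfl, rfl | rfl, rfl | rfl | rfl⟩
    · exact ⟨0, by ext k; fin_cases k <;> simp [faceNormal, goldenVector, dodecaNormal, goldenReal_apply]⟩
    · exact ⟨1, by ext k; fin_cases k <;> simp [faceNormal, goldenVector, dodecaNormal, goldenReal_apply]⟩
    · exact ⟨2, by ext k; fin_cases k <;> simp [faceNormal, goldenVector, dodecaNormal, goldenReal_apply]⟩
    · exact ⟨3, by ext k; fin_cases k <;> simp [faceNormal, goldenVector, dodecaNormal, goldenReal_apply]⟩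
    · exact ⟨4, by ext k; fin_cases k <;> simp [faceNormal, goldenVector, dodecaNormal, goldenReal_apply]⟩
    · exact ⟨5, by ext k; fin_cases k <;> simp [faceNormal, goldenVector, dodecaNormal, goldenReal_apply]⟩
    · exact ⟨6, by ext k; fin_cases k <;> simp [faceNormal, goldenVector, dodecaNormal, goldenReal_apply]⟩
    · exact ⟨7, by ext k; fin_cases k <;> simp [faceNormal, goldenVector, dodecaNormal, goldenReal_apply]⟩
    · exact ⟨8, by ext k; fin_cases k <;> simp [faceNormal, goldenVector, dodecaNormal, goldenReal_apply]⟩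
    · exact ⟨9, by ext k; fin_cases k <;> simp [faceNormal, goldenVector, dodecaNormal, goldenReal_apply]⟩
    · exact ⟨10, by ext k; fin_cases k <;> simp [faceNormal, goldenVector, dodecaNormal, goldenReal_apply]⟩
    · exact ⟨11, by ext k; fin_cases k <;> simp [faceNormal, goldenVector, dodecaNormal, goldenReal_apply]⟩
  · rintro ⟨n, rfl⟩
    have key : ∀ n, ∃ a b : ℤ, (a = 1 ∨ a = -1) ∧ (b = 1 ∨ b = -1) ∧
        (dodecaNormal n = ![⟨0, 0⟩, ⟨0, a⟩, ⟨b, 0⟩] ∨ dodecaNormal n = ![⟨b, 0⟩, ⟨0, 0⟩, ⟨0, a⟩] ∨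
          dodecaNormal n = ![⟨0, a⟩, ⟨b, 0⟩, ⟨0, 0⟩]) := by
      have : ∀ n, ∃ a ∈ ({1, -1} : Finset ℤ), ∃ b ∈ ({1, -1} : Finset ℤ),
        (dodecaNormal n = ![⟨0, 0⟩, ⟨0, a⟩, ⟨b, 0⟩] ∨ dodecaNormal n = ![⟨b, 0⟩, ⟨0, 0⟩, ⟨0, a⟩] ∨
          dodecaNormal n = ![⟨0, a⟩, ⟨b, 0⟩, ⟨0, 0⟩]) := by decide +kernel
      intro n
      obtain ⟨a, ha, b, hb, h⟩ := this n
      exact ⟨a, b, by simpa using ha, by simpa using hb, h⟩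
    obtain ⟨a, b, ha, hb, h⟩ := key n
    refine ⟨a, b, by exact_mod_cast ha, by exact_mod_cast hb, ?_⟩
    rcases h with h | h | h
    · left
      ext k
      fin_cases k <;> simp [faceNormal, goldenVector, h, goldenReal_apply]
    · right; left
      ext k
      fin_cases k <;> simp [faceNormal, goldenVector, h, goldenReal_apply]
    · right; right
      ext k
      fin_cases k <;> simp [faceNormal, goldenVector, h, goldenReal_apply]

theorem faceNormal_mem (n : Fin 12) : faceNormal n ∈ icosahedronVertices := by
  rw [icosahedronVertices_eq]
  exact ⟨n, rfl⟩

/-- The triangles of the pentakis dodecahedron. -/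
def dodecaFacets : Set (Finset (Fin 32)) := Set.range dodecaTriangle

theorem dodeca_support (p : Fin 32) : ∃ M : ℝ,
    (∀ t, p ∈ dodecaTriangle t → ⟪goldenVector (supportForm t), dodecaPoint p⟫_ℝ = M) ∧
      ∀ t, p ∉ dodecaTriangle t → ⟪goldenVector (supportForm t), dodecaPoint p⟫_ℝ < M := by
  have key : ∀ (M x : GoldenInteger), (M - x).isPositive = true →
      goldenReal x / 5 < goldenReal M / 5 := fun M x h => by
    have := GoldenInteger.isPositive.pos h
    rw [map_sub] at this
    linarith
  induction p using Fin.addCases (m := 12) (n := 20) with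
  | left n =>
    refine ⟨goldenReal ⟨11, 13⟩ / 5, fun t ht => ?_, fun t ht => ?_⟩
    · have hn : n = t.1 := by
        revert t n
        decide +kernel
      have := supportForm_centre t n
      rw [if_pos hn] at this
      rw [inner_dodecaPoint]
      exact congrArg (fun x => goldenReal x / 5) this
    · have hn : n ≠ t.1 := by
        rintro rfl
        exact ht (by simp [dodecaTriangle, dodecaCentre])
      have := supportForm_centre t n
      rw [if_neg hn] at this
      rw [inner_dodecaPoint]
      exact key _ _ this
  | right v =>
    refine ⟨goldenReal ⟨15, 15⟩ / 5, fun t ht => ?_, fun t ht => ?_⟩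
    · have := supportForm_vertex t v
      rw [if_pos ht] at this
      rw [inner_dodecaPoint, this]
    · have := supportForm_vertex t v
      rw [if_neg ht] at this
      rw [inner_dodecaPoint]
      exact key _ _ this

/-- For each vertex of a triangle, a form that agrees on the other two but not there: this is the
nondegeneracy in the separation criterion. -/
theorem dodeca_dual (t : Fin 12 × Fin 5) :
    let m := dodecaNormal (dodecaNeighbour t.1 t.2)
    let a := fun k => m k - dodecaNormal (dodecaNeighbour t.1 (t.2 + 1)) k
    let b := fun k => m k - dodecaNormal (dodecaNeighbour t.1 (t.2 - 1)) k
    let c := dodecaCoordinate (dodecaCentre t.1)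
    let v := dodecaCoordinate (dodecaCorner t.1 t.2)
    let v' := dodecaCoordinate (dodecaCorner t.1 (t.2 + 1))
    (goldenDot m c = ⟨1, 3⟩ ∧ goldenDot m v = ⟨5, 5⟩ ∧ goldenDot m v' = ⟨5, 5⟩) ∧
    (goldenDot a c = 0 ∧ goldenDot a v = 10 ∧ goldenDot a v' = 0) ∧
    (goldenDot b c = 0 ∧ goldenDot b v = 0 ∧ goldenDot b v' = 10) := by
  revert t
  decide +kernel

theorem isEmbeddedPlacement_dodecaPoint : IsEmbeddedPlacement dodecaFacets dodecaPoint := by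
  apply isEmbeddedPlacement_of_separated
  · rintro _ ⟨t, rfl⟩ _ ⟨t', rfl⟩ -
    -- The difference of the support forms is at most 0 on `t` and at least 0 on `t'`, with value 0
    -- only at common vertices.
    refine ⟨innerₛₗ ℝ (goldenVector (supportForm t') - goldenVector (supportForm t)),
      fun a ha b hb => ?_⟩
    simp only [innerₛₗ_apply_apply, inner_sub_left]
    obtain ⟨M, h1, h2⟩ := dodeca_support a
    obtain ⟨N, k1, k2⟩ := dodeca_support b
    have e1 := h1 t ha
    have e2 := k1 t' hb
    by_cases ha' : a ∈ dodecaTriangle t'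
    · have e3 := h1 t' ha'
      by_cases hb' : b ∈ dodecaTriangle t
      · have e4 := k1 t hb'
        exact Or.inl ⟨ha', hb', by linarith⟩
      · have e4 := k2 t hb'
        exact Or.inr (by linarith)
    · have e3 := h2 t' ha'
      by_cases hb' : b ∈ dodecaTriangle t
      · have e4 := k1 t hb'
        exact Or.inr (by linarith)
      · have e4 := k2 t hb'
        exact Or.inr (by linarith)
  · rintro _ ⟨t, rfl⟩ p hp
    obtain ⟨⟨a1, a2, a3⟩, ⟨b1, b2, b3⟩, c1, c2, c3⟩ := dodeca_dual t
    have h10 : goldenReal 10 = 10 := map_ofNat goldenReal 10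
    have hφ := Real.goldenRatio_pos
    simp only [dodecaTriangle, Finset.mem_insert, Finset.mem_singleton] at hp
    rcases hp with rfl | rfl | rfl
    · refine ⟨innerₛₗ ℝ (goldenVector (dodecaNormal (dodecaNeighbour t.1 t.2))), goldenReal ⟨5, 5⟩ / 5, ?_,
        fun u hu hne => ?_⟩
      · rw [innerₛₗ_apply_apply, inner_dodecaPoint, a1, goldenReal_apply, goldenReal_apply]
        push_cast
        intro h
        linarith
      · simp only [dodecaTriangle, Finset.mem_insert, Finset.mem_singleton] at hu
        rcases hu with rfl | rfl | rfl
        · exact absurd rfl hne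
        · rw [innerₛₗ_apply_apply, inner_dodecaPoint, a2]
        · rw [innerₛₗ_apply_apply, inner_dodecaPoint, a3]
    · refine ⟨innerₛₗ ℝ (goldenVector fun k => dodecaNormal (dodecaNeighbour t.1 t.2) k -
        dodecaNormal (dodecaNeighbour t.1 (t.2 + 1)) k), 0, ?_, fun u hu hne => ?_⟩
      · rw [innerₛₗ_apply_apply, inner_dodecaPoint, b2, h10]
        norm_num
      · simp only [dodecaTriangle, Finset.mem_insert, Finset.mem_singleton] at hu
        rcases hu with rfl | rfl | rfl
        · rw [innerₛₗ_apply_apply, inner_dodecaPoint, b1, map_zero, zero_div]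
        · exact absurd rfl hne
        · rw [innerₛₗ_apply_apply, inner_dodecaPoint, b3, map_zero, zero_div]
    · refine ⟨innerₛₗ ℝ (goldenVector fun k => dodecaNormal (dodecaNeighbour t.1 t.2) k -
        dodecaNormal (dodecaNeighbour t.1 (t.2 - 1)) k), 0, ?_, fun u hu hne => ?_⟩
      · rw [innerₛₗ_apply_apply, inner_dodecaPoint, c3, h10]
        norm_num
      · simp only [dodecaTriangle, Finset.mem_insert, Finset.mem_singleton] at hu
        rcases hu with rfl | rfl | rfl
        · rw [innerₛₗ_apply_apply, inner_dodecaPoint, c1, map_zero, zero_div]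
        · rw [innerₛₗ_apply_apply, inner_dodecaPoint, c2, map_zero, zero_div]
        · exact absurd rfl hne

/-- The star of the centre of a face. -/
def faceStar (n : Fin 12) : Set (Fin 32) := {p | ∃ i, p ∈ dodecaTriangle (n, i)}

theorem inner_faceNormal_dodecaPoint_le (n : Fin 12) (p : Fin 32) :
    ⟪faceNormal n, dodecaPoint p⟫_ℝ ≤ φ ^ 2 := by
  have hM : goldenReal ⟨5, 5⟩ = 5 * φ ^ 2 := by
    rw [goldenReal_apply, Real.goldenRatio_sq]
    push_cast
    ring
  rw [faceNormal, inner_dodecaPoint]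
  rcases dodecaNormal_dot_coordinate_nonneg n p with h | h
  · rw [h, hM]
    linarith
  · have := GoldenInteger.isPositive.pos h
    rw [map_sub, hM] at this
    linarith

theorem inner_faceNormal_dodecaPoint {n : Fin 12} {p : Fin 32} (h : p ∈ faceStar n) :
    ⟪faceNormal n, dodecaPoint p⟫_ℝ = φ ^ 2 := by
  obtain ⟨i, hi⟩ := h
  rw [faceNormal, inner_dodecaPoint, dodecaNormal_dot_coordinate (n, i) hi, goldenReal_apply,
    Real.goldenRatio_sq]
  push_cast
  ring

theorem sum_mem_solidDodecahedron {w : Fin 32 → ℝ} (hw : w ∈ stdSimplex ℝ (Fin 32)) :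
    ∑ p, w p • dodecaPoint p ∈ solidDodecahedron := by
  intro n hn
  rw [icosahedronVertices_eq] at hn
  obtain ⟨n, rfl⟩ := hn
  rw [inner_sum, ← one_mul (φ ^ 2), ← hw.2, Finset.sum_mul]
  refine Finset.sum_le_sum fun p _ => ?_
  rw [inner_smul_right]
  exact mul_le_mul_of_nonneg_left (inner_faceNormal_dodecaPoint_le n p) (hw.1 p)

theorem sum_mem_dodecahedronFace {w : Fin 32 → ℝ} (hw : w ∈ stdSimplex ℝ (Fin 32)) {n : Fin 12}
    (hn : ∀ p ∉ faceStar n, w p = 0) :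
    ∑ p, w p • dodecaPoint p ∈ dodecahedronFace (faceNormal n) := by
  refine ⟨sum_mem_solidDodecahedron hw, ?_⟩
  rw [inner_sum, ← one_mul (φ ^ 2), ← hw.2, Finset.sum_mul]
  refine Finset.sum_congr rfl fun p _ => ?_
  rw [inner_smul_right]
  by_cases hp : p ∈ faceStar n
  · rw [inner_faceNormal_dodecaPoint hp]
  · rw [hn p hp, zero_mul, zero_mul]

theorem mem_faceStar_centre (n : Fin 12) : dodecaCentre n ∈ faceStar n :=
  ⟨0, by simp [dodecaTriangle]⟩

theorem mem_faceStar_corner (n : Fin 12) (i : Fin 5) : dodecaCorner n i ∈ faceStar n :=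
  ⟨i, by simp [dodecaTriangle]⟩

/-- Since `(φ + 2)² = 5φ²` and `‖n‖² = φ + 2`, this multiple of the normal lies in the plane of the
face; hence the scaling of coordinates by five. -/
theorem dodecaPoint_centre (n : Fin 12) :
    dodecaPoint (dodecaCentre n) = ((φ + 2) / 5) • faceNormal n := by
  ext k
  have : goldenReal ⟨2, 1⟩ = φ + 2 := by
    rw [goldenReal_apply]
    push_cast
    ring
  simp only [dodecaPoint, PiLp.smul_apply, smul_eq_mul, goldenVector_apply, faceNormal,
    dodecaCoordinate, dodecaCentre, Fin.addCases_left, map_mul, this]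
  ring

theorem dodecaPoint_corner (n : Fin 12) (i : Fin 5) :
    dodecaPoint (dodecaCorner n i) = goldenVector (dodecaVertex (dodecaCycle n i)) := by
  ext k
  simp only [dodecaPoint, PiLp.smul_apply, smul_eq_mul, goldenVector_apply,
    dodecaCoordinate, dodecaCorner, Fin.addCases_right, map_mul, map_ofNat]
  ring

/-- Barycentric coordinates in a triangle of a face. -/
theorem eq_barycentric (n : Fin 12) (i : Fin 5) (x : EuclideanSpace ℝ (Fin 3)) :
    x = ((⟪faceNormal n, x⟫_ℝ - ⟪faceNormal (dodecaNeighbour n i), x⟫_ℝ) * (5 / (2 * (φ + 2)))) •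
        dodecaPoint (dodecaCentre n) +
      ((⟪faceNormal (dodecaNeighbour n i), x⟫_ℝ -
        ⟪faceNormal (dodecaNeighbour n (i + 1)), x⟫_ℝ) / 2) • dodecaPoint (dodecaCorner n i) +
      ((⟪faceNormal (dodecaNeighbour n i), x⟫_ℝ -
        ⟪faceNormal (dodecaNeighbour n (i - 1)), x⟫_ℝ) / 2) •
          dodecaPoint (dodecaCorner n (i + 1)) := by
  have hφ : φ + 2 ≠ 0 := by have := Real.goldenRatio_pos; positivity
  have h2 : goldenReal 2 = 2 := map_ofNat goldenReal 2
  rw [dodecaPoint_centre, dodecaPoint_corner, dodecaPoint_corner, smul_smul,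
    show ∀ a : ℝ, a * (5 / (2 * (φ + 2))) * ((φ + 2) / 5) = a / 2 by intro a; field_simp]
  ext k
  have h := fun l => congrArg goldenReal (dodeca_coordinates (n, i) k l)
  simp only [map_add, map_mul, map_sub] at h
  have hk : x k = ∑ l, goldenReal (if k = l then 2 else 0) / 2 * x l := by
    rw [Finset.sum_eq_single k]
    · rw [if_pos rfl, h2]
      ring
    · intro l _ hl
      rw [if_neg hl.symm, map_zero]
      ring
    · simp
  rw [hk, Fin.sum_univ_three, ← h, ← h, ← h]
  simp only [faceNormal, inner_goldenVector, PiLp.add_apply, PiLp.smul_apply, smul_eq_mul,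
    goldenVector_apply]
  ring

theorem exists_weights_of_mem_face {n : Fin 12} {x : EuclideanSpace ℝ (Fin 3)}
    (hx : x ∈ dodecahedronFace (faceNormal n)) :
    ∃ i, ∃ w ∈ stdSimplex ℝ (Fin 32), (∀ p ∉ dodecaTriangle (n, i), w p = 0) ∧
      ∑ p, w p • dodecaPoint p = x := by
  -- The triangle containing `x` is the one at the neighbouring face whose normal has the largest
  -- inner product with `x`; maximality makes the corner weights nonnegative.
  obtain ⟨i, hi⟩ := exists_eq_ciSup_of_finite (f := fun i => ⟪faceNormal (dodecaNeighbour n i), x⟫_ℝ)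
  have hmax : ∀ l, ⟪faceNormal (dodecaNeighbour n l), x⟫_ℝ ≤ ⟪faceNormal (dodecaNeighbour n i), x⟫_ℝ :=
    fun l => (le_ciSup (Set.finite_range _).bddAbove l).trans_eq hi.symm
  have hn := hx.2
  have hm := hx.1 _ (faceNormal_mem (dodecaNeighbour n i))
  have hφ := Real.goldenRatio_pos
  have e := eq_barycentric n i x
  set a := (⟪faceNormal n, x⟫_ℝ - ⟪faceNormal (dodecaNeighbour n i), x⟫_ℝ) * (5 / (2 * (φ + 2)))
    with ha
  set b := (⟪faceNormal (dodecaNeighbour n i), x⟫_ℝ -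
        ⟪faceNormal (dodecaNeighbour n (i + 1)), x⟫_ℝ) / 2 with hb
  set c := (⟪faceNormal (dodecaNeighbour n i), x⟫_ℝ -
        ⟪faceNormal (dodecaNeighbour n (i - 1)), x⟫_ℝ) / 2 with hc
  have ha0 : 0 ≤ a := mul_nonneg (by linarith) (by positivity)
  have hb0 : 0 ≤ b := by linarith [hmax (i + 1)]
  have hc0 : 0 ≤ c := by linarith [hmax (i - 1)]
  -- The point and the three vertices all have inner product `φ ^ 2` with the normal.
  have hsum : a + b + c = 1 := by
    have h := congrArg (fun y => ⟪faceNormal n, y⟫_ℝ) e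
    simp only [inner_add_right, inner_smul_right,
      inner_faceNormal_dodecaPoint (mem_faceStar_centre n),
      inner_faceNormal_dodecaPoint (mem_faceStar_corner n _), hn] at h
    have : φ ^ 2 * (a + b + c - 1) = 0 := by linarith
    have := (mul_eq_zero.1 this).resolve_left (by positivity)
    linarith
  refine ⟨i, a • Pi.single (dodecaCentre n) 1 + b • Pi.single (dodecaCorner n i) 1 +
    c • Pi.single (dodecaCorner n (i + 1)) 1, ⟨fun p => ?_, ?_⟩, fun p hp => ?_, ?_⟩
  · have hs : ∀ q, 0 ≤ (Pi.single q 1 : Fin 32 → ℝ) p := fun q => by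
      rw [Pi.single_apply]; split_ifs <;> norm_num
    exact add_nonneg (add_nonneg (mul_nonneg ha0 (hs _)) (mul_nonneg hb0 (hs _)))
      (mul_nonneg hc0 (hs _))
  · simpa [Finset.sum_add_distrib, ← Finset.mul_sum, Finset.sum_pi_single'] using hsum
  · simp only [dodecaTriangle, Finset.mem_insert, Finset.mem_singleton, not_or] at hp
    simp [hp.1, hp.2.1, hp.2.2]
  · conv_rhs => rw [e]
    simp [add_smul, Finset.sum_add_distrib, Pi.single_apply]

/-! ### The gluing in coordinates -/

/-- The gluing of a face, as an affine expression. -/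
noncomputable def gluingFormula (n x : EuclideanSpace ℝ (Fin 3)) : EuclideanSpace ℝ (Fin 3) :=
  (φ / 2) • x + ((φ - 1) / 2) • WithLp.toLp 2 (crossProduct n.ofLp x.ofLp) - (φ ^ 2 / 2) • n

theorem norm_sq_faceNormal (n : Fin 12) : ‖faceNormal n‖ ^ 2 = φ + 2 := by
  have h : ∀ n, goldenDot (dodecaNormal n) (dodecaNormal n) = ⟨2, 1⟩ := by decide +kernel
  rw [← real_inner_self_eq_norm_sq, faceNormal, inner_goldenVector]
  simp only [goldenVector_apply, ← map_mul, ← map_add]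
  have := h n
  rw [goldenDot] at this
  rw [this, goldenReal_apply]
  push_cast
  ring

theorem sin_pi_div_five_eq (n : Fin 12) :
    Real.sin (Real.pi / 5) = (φ - 1) / 2 * ‖faceNormal n‖ := by
  have hφ := Real.goldenRatio_sq
  have h1 := Real.one_lt_goldenRatio
  have hc : Real.cos (Real.pi / 5) = φ / 2 := by
    rw [Real.cos_pi_div_five, Real.goldenRatio]
    ring
  have hs : 0 ≤ Real.sin (Real.pi / 5) :=
    Real.sin_nonneg_of_nonneg_of_le_pi (by positivity) (by linarith [Real.pi_pos])
  rw [← abs_of_nonneg hs, ← abs_of_nonneg (mul_nonneg (by linarith : 0 ≤ (φ - 1) / 2)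
    (norm_nonneg (faceNormal n))), ← sq_eq_sq_iff_abs_eq_abs, mul_pow, norm_sq_faceNormal,
    Real.sin_sq, hc]
  generalize φ = p at hφ
  linear_combination (-(p + 2) / 4 : ℝ) * hφ

/-- On the plane of the face the component along the axis is constant, and the translation does not
affect the cross product; so Rodrigues' formula becomes affine with coefficients in `ℚ(φ)`. -/
theorem oppositeFaceGluing_eq {n : Fin 12} {x : EuclideanSpace ℝ (Fin 3)}
    (hx : ⟪faceNormal n, x⟫_ℝ = φ ^ 2) :
    oppositeFaceGluing (faceNormal n) x = gluingFormula (faceNormal n) x := by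
  have hφ := Real.goldenRatio_sq
  have hφ0 := Real.goldenRatio_pos
  have hn := norm_sq_faceNormal n
  have hn0 : ‖faceNormal n‖ ≠ 0 := by
    intro h
    rw [h] at hn
    norm_num at hn
    linarith
  have hc : Real.cos (Real.pi / 5) = φ / 2 := by
    rw [Real.cos_pi_div_five, Real.goldenRatio]
    ring
  rw [oppositeFaceGluing, axisRotation, gluingFormula, hc, sin_pi_div_five_eq n]
  have hcr : WithLp.toLp 2 (crossProduct (‖faceNormal n‖⁻¹ • faceNormal n).ofLp
      (x - (2 * φ ^ 2 / ‖faceNormal n‖ ^ 2) • faceNormal n).ofLp) =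
      ‖faceNormal n‖⁻¹ • WithLp.toLp 2 (crossProduct (faceNormal n).ofLp x.ofLp) := by
    rw [WithLp.ofLp_smul, WithLp.ofLp_sub, WithLp.ofLp_smul, map_smul, LinearMap.smul_apply, map_sub,
      map_smul, cross_self, smul_zero, sub_zero]
    rfl
  rw [hcr, inner_smul_left, inner_sub_right, inner_smul_right, real_inner_self_eq_norm_sq, hx,
    smul_smul, mul_assoc, mul_inv_cancel₀ hn0, mul_one, smul_smul]
  have hk : (1 - φ / 2) * ((starRingEnd ℝ) ‖faceNormal n‖⁻¹ *
      (φ ^ 2 - 2 * φ ^ 2 / ‖faceNormal n‖ ^ 2 * ‖faceNormal n‖ ^ 2)) * ‖faceNormal n‖⁻¹ =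
      φ / 2 * (2 * φ ^ 2 / ‖faceNormal n‖ ^ 2) - φ ^ 2 / 2 := by
    rw [div_mul_cancel₀ _ (pow_ne_zero 2 hn0), conj_trivial,
      show ∀ a : ℝ, (1 - φ / 2) * (‖faceNormal n‖⁻¹ * a) * ‖faceNormal n‖⁻¹ =
        (1 - φ / 2) * a / ‖faceNormal n‖ ^ 2 by intro a; field_simp, hn]
    have : φ + 2 ≠ 0 := by positivity
    field_simp
    ring
  rw [hk]
  module

theorem gluingFormula_sum (n : EuclideanSpace ℝ (Fin 3)) {w : Fin 32 → ℝ} (hw : ∑ p, w p = 1)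
    (y : Fin 32 → EuclideanSpace ℝ (Fin 3)) :
    gluingFormula n (∑ p, w p • y p) = ∑ p, w p • gluingFormula n (y p) := by
  simp only [gluingFormula, smul_sub, smul_add, Finset.sum_sub_distrib, Finset.sum_add_distrib]
  congr 1
  · congr 1
    · rw [Finset.smul_sum]
      exact Finset.sum_congr rfl fun p _ => smul_comm _ _ _
    · rw [WithLp.ofLp_sum, map_sum]
      simp only [WithLp.ofLp_smul, map_smul]
      rw [WithLp.toLp_sum, Finset.smul_sum]
      exact Finset.sum_congr rfl fun p _ => by rw [WithLp.toLp_smul, smul_comm]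
  · rw [← Finset.sum_smul, hw, one_smul]

theorem gluingFormula_dodecaPoint {n : Fin 12} {p : Fin 32} (hp : p ∈ faceStar n) :
    gluingFormula (faceNormal n) (dodecaPoint p) = dodecaPoint (dodecaGluing n p) := by
  obtain ⟨i, hi⟩ := hp
  obtain ⟨h0, h1, h2⟩ := dodecaGluing_coordinate (n, i) hi
  have e2 : goldenReal 2 = 2 := map_ofNat goldenReal 2
  have eφ : goldenReal ⟨0, 1⟩ = φ := by rw [goldenReal_apply]; push_cast; ring
  have eφ1 : goldenReal ⟨-1, 1⟩ = φ - 1 := by rw [goldenReal_apply]; push_cast; ring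
  have e5 : goldenReal ⟨5, 5⟩ = 5 * (φ + 1) := by rw [goldenReal_apply]; push_cast; ring
  replace h0 := congrArg goldenReal h0
  replace h1 := congrArg goldenReal h1
  replace h2 := congrArg goldenReal h2
  simp only [map_mul, map_add, map_sub, e2, eφ, eφ1, e5] at h0 h1 h2
  ext k
  simp only [gluingFormula, dodecaPoint, faceNormal, PiLp.sub_apply, PiLp.add_apply,
    PiLp.smul_apply, smul_eq_mul, WithLp.ofLp_smul, map_smul, Pi.smul_apply, cross_apply,
    goldenVector]
  fin_cases k
  · simp
    linarith
  · simp
    linarith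
  · simp
    linarith

/-! ### Pushing weights along vertex maps -/

section PushWeights

variable {ι κ μ : Type*} [Fintype ι] [DecidableEq κ] [DecidableEq μ]

/-- The pushforward of weights along a map. -/
noncomputable def pushWeights (f : ι → κ) : (ι → ℝ) →ₗ[ℝ] κ → ℝ :=
  Fintype.linearCombination ℝ fun i => Pi.single (f i) 1

theorem pushWeights_apply (f : ι → κ) (w : ι → ℝ) (k : κ) :
    pushWeights f w k = ∑ i, if f i = k then w i else 0 := by
  simp [pushWeights, Fintype.linearCombination_apply, Pi.single_apply, eq_comm]

theorem sum_pushWeights_smul [Fintype κ] {E : Type*} [AddCommGroup E] [Module ℝ E] (f : ι → κ) (w : ι → ℝ)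
    (y : κ → E) : ∑ k, pushWeights f w k • y k = ∑ i, w i • y (f i) := by
  simp only [pushWeights_apply, Finset.sum_smul, ite_smul, zero_smul]
  rw [Finset.sum_comm]
  simp

theorem pushWeights_comp [Fintype κ] (f : ι → κ) (g : κ → μ) (w : ι → ℝ) :
    pushWeights g (pushWeights f w) = pushWeights (g ∘ f) w := by
  exact sum_pushWeights_smul f w fun k => (Pi.single (g k) 1 : μ → ℝ)

theorem pushWeights_congr {f g : ι → κ} {w : ι → ℝ} (h : ∀ i, w i ≠ 0 → f i = g i) :
    pushWeights f w = pushWeights g w := by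
  ext k
  rw [pushWeights_apply, pushWeights_apply]
  refine Finset.sum_congr rfl fun i _ => ?_
  by_cases hi : w i = 0
  · simp [hi]
  · rw [h i hi]

theorem pushWeights_mem_stdSimplex [Fintype κ] (f : ι → κ) {w : ι → ℝ} (hw : w ∈ stdSimplex ℝ ι) :
    pushWeights f w ∈ stdSimplex ℝ κ := by
  rw [pushWeights, Fintype.linearCombination_apply]
  exact (convex_stdSimplex ℝ κ).sum_mem (fun i _ => hw.1 i) hw.2 fun i _ =>
    single_mem_stdSimplex ℝ _

theorem pushWeights_eq_zero {f : ι → κ} {w : ι → ℝ} {T : Set κ}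
    (h : ∀ i, w i ≠ 0 → f i ∈ T) {k : κ} (hk : k ∉ T) : pushWeights f w k = 0 := by
  rw [pushWeights_apply]
  refine Finset.sum_eq_zero fun i _ => ?_
  split_ifs with hi
  · by_contra hne
    exact hk (hi ▸ h i hne)
  · rfl

/-- Weights are nonnegative, so nothing cancels. -/
theorem pushWeights_ne_zero (f : ι → κ) {w : ι → ℝ} (hw : w ∈ stdSimplex ℝ ι) {i : ι}
    (hi : w i ≠ 0) : pushWeights f w (f i) ≠ 0 := by
  rw [pushWeights_apply]
  refine (Finset.sum_pos' (fun j _ => ?_) ⟨i, Finset.mem_univ i, ?_⟩).ne'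
  · split_ifs
    exacts [hw.1 j, le_rfl]
  · rw [if_pos rfl]
    exact (hw.1 i).lt_of_ne hi.symm

theorem pushWeights_injOn {f : ι → κ} {S : Set ι} (hf : Set.InjOn f S) {w w' : ι → ℝ}
    (hw : ∀ i ∉ S, w i = 0) (hw' : ∀ i ∉ S, w' i = 0) (h : pushWeights f w = pushWeights f w') :
    w = w' := by
  have key : ∀ w : ι → ℝ, (∀ i ∉ S, w i = 0) → ∀ i ∈ S, pushWeights f w (f i) = w i := by
    intro w hw i hi
    rw [pushWeights_apply, Finset.sum_eq_single i]
    · rw [if_pos rfl]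
    · intro j _ hj
      split_ifs with he
      · by_contra hne
        exact hj (hf (by_contra fun h => hne (hw j h)) hi he)
      · rfl
    · simp
  ext i
  by_cases hi : i ∈ S
  · rw [← key w hw i hi, h, key w' hw' i hi]
  · rw [hw i hi, hw' i hi]

end PushWeights

/-! ### Comparing gluing classes with labels -/

/-- The boundary of the dodecahedron, in barycentric coordinates. -/
abbrev DodecaSpace : Type := barycentricRealization dodecaFacets

/-- The map to the boundary of the dodecahedron. -/
noncomputable def dodecaMap (w : DodecaSpace) : solidDodecahedron :=
  ⟨∑ p, w.1 p • dodecaPoint p, sum_mem_solidDodecahedron w.2.1⟩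

/-- The map to the 2-skeleton of the quotient. -/
noncomputable def labelMap (w : DodecaSpace) : SkeletonSpace :=
  ⟨pushWeights dodecaLabel w.1, linearCombination_mem_barycentricRealization
    (fun _ => single_mem_stdSimplex ℝ _) (by
      rintro _ ⟨t, rfl⟩
      obtain ⟨j, i, h⟩ := dodecaLabel_triangle t
      refine ⟨_, skeletonTriangle_mem j i, fun p hp k hk => ?_⟩
      rw [Pi.single_eq_of_ne]
      rintro rfl
      exact hk (h p hp)) w.2⟩

theorem continuous_dodecaMap : Continuous dodecaMap := by
  refine Continuous.subtype_mk (continuous_finsetSum _ fun p _ => ?_) _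
  exact ((continuous_apply p).comp continuous_subtype_val).smul continuous_const

theorem continuous_labelMap : Continuous labelMap :=
  Continuous.subtype_mk ((LinearMap.continuous_of_finiteDimensional _).comp
    continuous_subtype_val) _

theorem injective_dodecaMap : Function.Injective dodecaMap := by
  rintro ⟨w, hw, S, hS, hwS⟩ ⟨w', hw', T, hT, hwT⟩ e
  exact Subtype.ext (isEmbeddedPlacement_dodecaPoint S hS T hT w w' hw.1 hw'.1 hwS hwT
    (hw.2.trans hw'.2.symm) (congrArg Subtype.val e))

theorem exists_skeletonTriangle_lift (j : Fin 6) (i : Fin 5) :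
    ∃ (t : Fin 12 × Fin 5) (s : SkeletonVertex → Fin 32),
      ∀ k ∈ skeletonTriangle j i, s k ∈ dodecaTriangle t ∧ dodecaLabel (s k) = k := by
  obtain ⟨t, ht⟩ := exists_dodecaTriangle j i
  choose! s hs using ht
  exact ⟨t, s, hs⟩

theorem exists_labelMap_eq {j : Fin 6} {i : Fin 5} {t : Fin 12 × Fin 5}
    {s : SkeletonVertex → Fin 32}
    (hs : ∀ k ∈ skeletonTriangle j i, s k ∈ dodecaTriangle t ∧ dodecaLabel (s k) = k)
    {u : SkeletonSpace} (hu : ∀ k ∉ skeletonTriangle j i, u.1 k = 0) :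
    ∃ w, labelMap w = u ∧ w.1 = pushWeights s u.1 ∧ ∀ p ∉ dodecaTriangle t, w.1 p = 0 := by
  have hne : ∀ k, u.1 k ≠ 0 → k ∈ skeletonTriangle j i := fun k hk =>
    by_contra fun h => hk (hu k h)
  have hw : ∀ p ∉ dodecaTriangle t, pushWeights s u.1 p = 0 := fun p hp =>
    pushWeights_eq_zero (T := (dodecaTriangle t : Set (Fin 32)))
      (fun k hk => (hs k (hne k hk)).1) hp
  refine ⟨⟨_, pushWeights_mem_stdSimplex s u.2.1, _, ⟨t, rfl⟩, hw⟩, Subtype.ext ?_, rfl, hw⟩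
  change pushWeights dodecaLabel (pushWeights s u.1) = u.1
  rw [pushWeights_comp, pushWeights_congr (f := dodecaLabel ∘ s) (g := id)
    fun k hk => (hs k (hne k hk)).2]
  ext k
  simp [pushWeights_apply]

theorem surjective_labelMap : Function.Surjective labelMap := by
  intro u
  obtain ⟨_, _, ⟨⟨j, i⟩, rfl⟩, h⟩ := u.2
  obtain ⟨t, s, hs⟩ := exists_skeletonTriangle_lift j i
  obtain ⟨w, hw, -⟩ := exists_labelMap_eq hs h
  exact ⟨w, hw⟩

theorem pushWeights_gluing_mem {n : Fin 12} {i : Fin 5} {w : Fin 32 → ℝ}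
    (hw : w ∈ stdSimplex ℝ (Fin 32)) (h : ∀ p ∉ dodecaTriangle (n, i), w p = 0) :
    pushWeights (dodecaGluing n) w ∈ barycentricRealization dodecaFacets := by
  obtain ⟨t, ht⟩ := dodecaGluing_triangle (n, i)
  refine ⟨pushWeights_mem_stdSimplex _ hw, _, ⟨t, rfl⟩, fun p hp => ?_⟩
  exact pushWeights_eq_zero (T := (dodecaTriangle t : Set (Fin 32)))
    (fun k hk => ht k (by_contra fun h' => hk (h k h'))) hp

theorem pushWeights_label_gluing {n : Fin 12} {w : Fin 32 → ℝ} (h : ∀ p ∉ faceStar n, w p = 0) :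
    pushWeights dodecaLabel (pushWeights (dodecaGluing n) w) = pushWeights dodecaLabel w := by
  rw [pushWeights_comp]
  refine pushWeights_congr fun p hp => ?_
  obtain ⟨i, hi⟩ : p ∈ faceStar n := by_contra fun h' => hp (h p h')
  exact dodecaLabel_gluing (n, i) hi

theorem oppositeFaceGluing_sum {n : Fin 12} {w : Fin 32 → ℝ} (hw : w ∈ stdSimplex ℝ (Fin 32))
    (h : ∀ p ∉ faceStar n, w p = 0) :
    oppositeFaceGluing (faceNormal n) (∑ p, w p • dodecaPoint p) =
      ∑ p, pushWeights (dodecaGluing n) w p • dodecaPoint p := by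
  rw [oppositeFaceGluing_eq (sum_mem_dodecahedronFace hw h).2, gluingFormula_sum _ hw.2,
    sum_pushWeights_smul]
  refine Finset.sum_congr rfl fun p _ => ?_
  by_cases hp : p ∈ faceStar n
  · rw [gluingFormula_dodecaPoint hp]
  · rw [h p hp, zero_smul, zero_smul]

theorem faceStar_eq_zero {n : Fin 12} {i : Fin 5} {w : Fin 32 → ℝ}
    (h : ∀ p ∉ dodecaTriangle (n, i), w p = 0) : ∀ p ∉ faceStar n, w p = 0 :=
  fun p hp => h p fun h' => hp ⟨i, h'⟩

/-- The part of the boundary over a set in the 2-skeleton is invariant under the gluing. -/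
theorem mem_boundary_iff_of_mk_eq (C : Set SkeletonSpace) {x y : solidDodecahedron}
    (h : SphericalDodecahedralSpace.mk x = SphericalDodecahedralSpace.mk y) :
    (∃ w, dodecaMap w = x ∧ labelMap w ∈ C) ↔ ∃ w, dodecaMap w = y ∧ labelMap w ∈ C := by
  -- Stated as an equality of propositions, so that it descends to the quotient and covers the whole
  -- equivalence relation generated by the gluings.
  have key : ∀ x y : solidDodecahedron, (∃ n ∈ icosahedronVertices,
      x.1 ∈ dodecahedronFace n ∧ y.1 = oppositeFaceGluing n x.1) →
      (∃ w, dodecaMap w = x ∧ labelMap w ∈ C) = ∃ w, dodecaMap w = y ∧ labelMap w ∈ C := by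
    rintro x y ⟨n, hn, hx, hy⟩
    rw [icosahedronVertices_eq] at hn
    obtain ⟨n, rfl⟩ := hn
    obtain ⟨i, w, hw, hwn, hwx⟩ := exists_weights_of_mem_face hx
    let w₁ : DodecaSpace := ⟨w, hw, _, ⟨(n, i), rfl⟩, hwn⟩
    let w₂ : DodecaSpace := ⟨_, pushWeights_gluing_mem hw hwn⟩
    have e₁ : dodecaMap w₁ = x := Subtype.ext hwx
    have e₂ : dodecaMap w₂ = y := Subtype.ext (by
      rw [hy, ← hwx, oppositeFaceGluing_sum hw (faceStar_eq_zero hwn)]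
      rfl)
    have e₃ : labelMap w₂ = labelMap w₁ :=
      Subtype.ext (pushWeights_label_gluing (faceStar_eq_zero hwn))
    refine propext ⟨?_, ?_⟩
    · rintro ⟨v, hv, hvC⟩
      rw [← e₁] at hv
      exact ⟨w₂, e₂, by rwa [e₃, ← injective_dodecaMap hv]⟩
    · rintro ⟨v, hv, hvC⟩
      rw [← e₂] at hv
      exact ⟨w₁, e₁, by rwa [← e₃, ← injective_dodecaMap hv]⟩
  exact (congrArg (Quot.lift _ key) h).to_iff

/-- The invariance of boundary parts, applied to a single label point. -/
theorem labelMap_eq_of_mk_eq {w w' : DodecaSpace}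
    (h : SphericalDodecahedralSpace.mk (dodecaMap w) =
      SphericalDodecahedralSpace.mk (dodecaMap w')) : labelMap w = labelMap w' := by
  obtain ⟨v, hv, hv'⟩ := (mem_boundary_iff_of_mk_eq {labelMap w} h).1 ⟨w, rfl, rfl⟩
  rw [injective_dodecaMap hv] at hv'
  exact hv'.symm

theorem mem_dodecaList {t : Fin 12 × Fin 5} {p : Fin 32} :
    p ∈ dodecaList t ↔ p ∈ dodecaTriangle t := by
  simp [dodecaList, dodecaTriangle]

/-- The support of `w` is a face whose labels occur in the triangle carrying `w'`, so it lies there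
or one gluing moves it there. Labels are injective on a triangle, so the weights must then agree
with `w'`. -/
theorem mk_eq_of_labelMap_eq {w w' : DodecaSpace} (h : labelMap w = labelMap w') :
    SphericalDodecahedralSpace.mk (dodecaMap w) = SphericalDodecahedralSpace.mk (dodecaMap w') := by
  obtain ⟨w, hw, _, ⟨t, rfl⟩, hwt⟩ := w
  obtain ⟨w', hw', _, ⟨t', rfl⟩, hwt'⟩ := w'
  have h' : pushWeights dodecaLabel w = pushWeights dodecaLabel w' := congrArg Subtype.val h
  have hinj : Set.InjOn dodecaLabel (dodecaTriangle t' : Set (Fin 32)) :=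
    fun p hp q hq e => dodecaLabel_injOn t' hp hq e
  have hr := isRelated_of_label t.1 t.2 t'.1 t'.2
  rw [List.all_eq_true] at hr
  have hT := hr ((dodecaList t).filter fun p => decide (w p ≠ 0))
    (List.mem_sublists.2 List.filter_sublist)
  have hmem : ∀ p, p ∈ (dodecaList t).filter (fun p => decide (w p ≠ 0)) ↔ w p ≠ 0 := by
    intro p
    rw [List.mem_filter, mem_dodecaList, decide_eq_true_eq]
    exact ⟨And.right, fun hp => ⟨by_contra fun h => hp (hwt p h), hp⟩⟩
  have hall : ∀ p, w p ≠ 0 → ∃ q ∈ dodecaTriangle t', dodecaLabel q = dodecaLabel p := by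
    intro p hp
    have h1 := pushWeights_ne_zero dodecaLabel hw hp
    rw [h'] at h1
    by_contra! hne
    refine h1 (pushWeights_eq_zero (T := {dodecaLabel p}ᶜ) (fun q hq => ?_) (by simp))
    exact hne q (by_contra fun h => hq (hwt' q h))
  generalize (dodecaList t).filter (fun p => decide (w p ≠ 0)) = T at hT hmem
  rw [Bool.or_eq_true, Bool.not_eq_true', ← Bool.not_eq_true, List.all_eq_true] at hT
  have hT' := hT.resolve_left fun hn => hn fun p hp => by
    obtain ⟨q, hq, hqp⟩ := hall p ((hmem p).1 hp)
    exact List.any_eq_true.2 ⟨q, mem_dodecaList.2 hq, decide_eq_true hqp⟩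
  simp only [isRelated, Bool.or_eq_true, List.all_eq_true, List.any_eq_true, Bool.and_eq_true,
    List.contains_iff_mem, mem_dodecaList, beq_iff_eq, hmem] at hT'
  rcases hT' with hS | ⟨m, -, hm⟩
  · have e : w = w' := pushWeights_injOn hinj
      (fun p hp => by_contra fun h => hp (hS p h)) hwt' h'
    subst e
    rfl
  · have hstar : ∀ p ∉ faceStar m, w p = 0 := fun p hp => by
      by_contra hne
      rcases (hm p hne).2 with rfl | ⟨i, -, rfl⟩
      · exact hp (mem_faceStar_centre m)
      · exact hp (mem_faceStar_corner m i)
    have e : pushWeights (dodecaGluing m) w = w' := pushWeights_injOn hinj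
      (fun p hp => pushWeights_eq_zero (T := (dodecaTriangle t' : Set (Fin 32)))
        (fun q hq => (hm q hq).1) hp) hwt' ((pushWeights_label_gluing hstar).trans h')
    subst e
    refine Quot.sound ⟨faceNormal m, faceNormal_mem m, sum_mem_dodecahedronFace hw hstar, ?_⟩
    exact (oppositeFaceGluing_sum hw hstar).symm

theorem mem_dodecahedralTwoSkeleton_iff {p : SphericalDodecahedralSpace} :
    p ∈ dodecahedralTwoSkeleton ↔
      ∃ w, SphericalDodecahedralSpace.mk (dodecaMap w) = p := by
  constructor
  · rintro ⟨n, hn, x, hx, rfl⟩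
    rw [icosahedronVertices_eq] at hn
    obtain ⟨n, rfl⟩ := hn
    obtain ⟨i, w, hw, hwn, hwx⟩ := exists_weights_of_mem_face hx
    exact ⟨⟨w, hw, _, ⟨(n, i), rfl⟩, hwn⟩, congrArg _ (Subtype.ext hwx)⟩
  · rintro ⟨⟨w, hw, _, ⟨⟨n, i⟩, rfl⟩, hwn⟩, rfl⟩
    exact ⟨_, faceNormal_mem n, _, sum_mem_dodecahedronFace hw (faceStar_eq_zero hwn), rfl⟩

/-! ### The 2-skeleton of the spherical dodecahedral space -/

instance : CompactSpace DodecaSpace :=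
  isCompact_iff_compactSpace.1 (isCompact_barycentricRealization _)

/-- The map from the combinatorial 2-skeleton to the quotient of the dodecahedron. -/
noncomputable def skeletonMap (u : SkeletonSpace) : dodecahedralTwoSkeleton :=
  ⟨SphericalDodecahedralSpace.mk (dodecaMap (surjective_labelMap u).choose),
    mem_dodecahedralTwoSkeleton_iff.2 ⟨_, rfl⟩⟩

theorem skeletonMap_labelMap (w : DodecaSpace) :
    (skeletonMap (labelMap w)).1 = SphericalDodecahedralSpace.mk (dodecaMap w) :=
  mk_eq_of_labelMap_eq (surjective_labelMap (labelMap w)).choose_spec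

theorem bijective_skeletonMap : Function.Bijective skeletonMap := by
  constructor
  · intro u v h
    obtain ⟨u, rfl⟩ := surjective_labelMap u
    obtain ⟨v, rfl⟩ := surjective_labelMap v
    refine labelMap_eq_of_mk_eq ?_
    rw [← skeletonMap_labelMap, ← skeletonMap_labelMap, h]
  · rintro ⟨p, hp⟩
    obtain ⟨w, rfl⟩ := mem_dodecahedralTwoSkeleton_iff.1 hp
    exact ⟨labelMap w, Subtype.ext (skeletonMap_labelMap w)⟩

/-- Continuity is tested after `labelMap`, a closed surjection from a compact space and so a
quotient map. -/
theorem continuous_skeletonMap : Continuous skeletonMap := by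
  have hq : Topology.IsQuotientMap labelMap :=
    continuous_labelMap.isClosedMap.isQuotientMap continuous_labelMap surjective_labelMap
  rw [hq.continuous_iff, continuous_induced_rng]
  have e : Subtype.val ∘ skeletonMap ∘ labelMap = SphericalDodecahedralSpace.mk ∘ dodecaMap :=
    funext skeletonMap_labelMap
  rw [e]
  exact continuous_quot_mk.comp continuous_dodecaMap

/-- Closedness is tested in the solid dodecahedron, where the part of the boundary over `C` is
compact and already saturated. The Hausdorff property of the quotient is not needed. -/
theorem isClosedMap_skeletonMap : IsClosedMap skeletonMap := by
  intro C hC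
  have e : skeletonMap '' C = Subtype.val ⁻¹'
      (SphericalDodecahedralSpace.mk '' (dodecaMap '' (labelMap ⁻¹' C))) := by
    ext p
    obtain ⟨u, rfl⟩ := bijective_skeletonMap.2 p
    obtain ⟨w, rfl⟩ := surjective_labelMap u
    rw [bijective_skeletonMap.1.mem_set_image, Set.mem_preimage, skeletonMap_labelMap]
    constructor
    · exact fun h => ⟨_, ⟨w, h, rfl⟩, rfl⟩
    · rintro ⟨_, ⟨v, hv, rfl⟩, h⟩
      rwa [← labelMap_eq_of_mk_eq h]
  rw [e]
  refine IsClosed.preimage continuous_subtype_val ?_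
  have hq : Topology.IsQuotientMap SphericalDodecahedralSpace.mk := isQuotientMap_quot_mk
  rw [← hq.isClosed_preimage]
  have e' : SphericalDodecahedralSpace.mk ⁻¹'
      (SphericalDodecahedralSpace.mk '' (dodecaMap '' (labelMap ⁻¹' C))) =
      dodecaMap '' (labelMap ⁻¹' C) := by
    refine Set.Subset.antisymm ?_ (Set.subset_preimage_image _ _)
    rintro x ⟨_, ⟨w, hw, rfl⟩, h⟩
    obtain ⟨v, hv, hvC⟩ := (mem_boundary_iff_of_mk_eq C h).1 ⟨w, rfl, hw⟩
    exact ⟨v, hvC, hv⟩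
  rw [e']
  exact continuous_dodecaMap.isClosedMap _ (hC.preimage continuous_labelMap)

/-- The combinatorial 2-skeleton is the 2-skeleton of the spherical dodecahedral space. -/
noncomputable def skeletonHomeomorph : SkeletonSpace ≃ₜ dodecahedralTwoSkeleton :=
  (Equiv.ofBijective skeletonMap bijective_skeletonMap).toHomeomorphOfContinuousClosed
    continuous_skeletonMap isClosedMap_skeletonMap

theorem AffineMap.map_sum_smul {ι E V : Type*} [Fintype ι] [AddCommGroup E] [Module ℝ E]
    [AddCommGroup V] [Module ℝ V] (g : E →ᵃ[ℝ] V) {w : ι → ℝ} (hw : ∑ i, w i = 1) (x : ι → E) :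
    g (∑ i, w i • x i) = ∑ i, w i • g (x i) := by
  rw [← Finset.univ.affineCombination_eq_linear_combination x w hw,
    Finset.univ.map_affineCombination x w hw,
    Finset.univ.affineCombination_eq_linear_combination _ w hw]
  rfl

/-- Affine maps may be prescribed on a simplex. -/
theorem exists_affineMap_sum_smul {ι E V : Type*} [Fintype ι] [AddCommGroup E] [Module ℝ E]
    [AddCommGroup V] [Module ℝ V] {x : ι → E} {S : Finset ι}
    (hx : AffineIndependent ℝ fun i : S => x i) (t : ι → V) :
    ∃ g : E →ᵃ[ℝ] V, ∀ w : ι → ℝ, ∑ i, w i = 1 → (∀ i ∉ S, w i = 0) →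
      g (∑ i, w i • x i) = ∑ i, w i • t i := by
  obtain ⟨g, hg⟩ := hx.exists_affineMap fun i : S => t i
  refine ⟨g, fun w hw hS => ?_⟩
  rw [g.map_sum_smul hw]
  refine Finset.sum_congr rfl fun i _ => ?_
  by_cases hi : i ∈ S
  · rw [hg ⟨i, hi⟩]
  · rw [hS i hi, zero_smul, zero_smul]

theorem geometricHomeomorph_sum (w : barycentricRealization fineFacets)
    (hw : ∑ v, w.1 v • finePoint v ∈ fineGeometricComplex.space) :
    geometricHomeomorph ⟨_, hw⟩ = fineToSkeleton w := by
  have e : (⟨_, hw⟩ : fineGeometricComplex.space) = fineHomeomorph w := rfl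
  rw [e]
  exact congrArg fineToSkeleton (fineHomeomorph.symm_apply_apply w)

/-- Each fine triangle lies in one coarse triangle, which lifts to a triangle of a single pentagon.
The affine map is prescribed at the vertices by this lift and agrees with the homeomorphism by
linearity in the weights. -/
theorem subdividesDodecahedralTwoSkeleton_fineGeometricComplex :
    SubdividesDodecahedralTwoSkeleton fineGeometricComplex := by
  refine ⟨geometricHomeomorph.trans skeletonHomeomorph, ?_⟩
  rintro _ ⟨S, ⟨-, _, ⟨⟨j, i⟩, rfl⟩, hS⟩, rfl⟩
  obtain ⟨i', hi'⟩ := fineWeight_support j i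
  obtain ⟨⟨n, l⟩, s, hs⟩ := exists_skeletonTriangle_lift j i'
  obtain ⟨g, hg⟩ := exists_affineMap_sum_smul
    (isEmbeddedPlacement_finePoint.affineIndependent (fineTriangle_mem j i))
    fun v => ∑ p, pushWeights s (fineBarycentric v) p • dodecaPoint p
  refine ⟨faceNormal n, faceNormal_mem n, g, ?_⟩
  rintro ⟨y, hy⟩ hyS
  obtain ⟨w, hw, hwS, rfl⟩ := (mem_convexHull_map_iff _).1 hyS
  have hwT : ∀ v ∉ fineTriangle j i, w v = 0 := fun v hv => hwS v fun h => hv (hS h)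
  let w₁ : barycentricRealization fineFacets := ⟨w, hw, _, fineTriangle_mem j i, hwT⟩
  have hu : ∀ k ∉ skeletonTriangle j i', (fineToSkeleton w₁).1 k = 0 := by
    intro k hk
    change Fintype.linearCombination ℝ fineBarycentric w k = 0
    rw [Fintype.linearCombination_apply, Finset.sum_apply]
    refine Finset.sum_eq_zero fun v _ => ?_
    by_cases hv : v ∈ fineTriangle j i
    · simp [fineBarycentric, hi' v hv k hk]
    · simp [hwT v hv]
  obtain ⟨W, hlabel, hWs, hW⟩ := exists_labelMap_eq hs hu
  refine ⟨dodecaMap W, ?_, sum_mem_dodecahedronFace W.2.1 (faceStar_eq_zero hW), ?_⟩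
  · rw [hg w hw.2 hwT]
    change ∑ p, W.1 p • dodecaPoint p = _
    rw [hWs]
    change ∑ p, pushWeights s (Fintype.linearCombination ℝ fineBarycentric w) p • dodecaPoint p = _
    rw [Fintype.linearCombination_apply, map_sum]
    simp only [map_smul, Finset.sum_apply, Pi.smul_apply, smul_eq_mul, Finset.sum_smul,
      Finset.smul_sum, smul_smul]
    exact Finset.sum_comm
  · rw [← skeletonMap_labelMap, hlabel, ← geometricHomeomorph_sum w₁ hy]
    rfl

/-- All singletons are faces of an `AbstractSimplicialComplex`, so the vertex type `Fin 23` makes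
the number of vertices exactly 23. -/
theorem mainTheorem1 :
    ∃ (K : AbstractSimplicialComplex (Fin 23)) (A : Fin 23)
      (x : Fin 23 → EuclideanSpace ℝ (Fin 4))
      (G : Geometry.SimplicialComplex ℝ (EuclideanSpace ℝ (Fin 4))),
      HasDimension K 2 ∧
      IsZAcyclic K ∧
      IsPolyhedralRealization K x G ∧
      ¬ ContractibleSpace G.space ∧
      (∀ v i, ∃ m : ℤ, -4 ≤ m ∧ m ≤ 4 ∧ x v i = m) ∧
      x A = !₂[0, 0, 0, 1] ∧
      (∀ v, v ≠ A → x v 3 = 0) ∧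
      SubdividesDodecahedralTwoSkeleton G ∧
      (∀ p : G.space, Nonempty (FundamentalGroup G.space p ≃* binaryIcosahedralGroup)) :=
  ⟨fineComplex, 0, finePoint, fineGeometricComplex, hasDimension_fineComplex,
    isZAcyclic_fineComplex, isEmbeddedPlacement_finePoint.isPolyhedralRealization exists_fineFacet,
    not_contractibleSpace_fineGeometricComplex, finePoint_coordinate, finePoint_zero,
    fun _ hv => finePoint_ne_zero hv, subdividesDodecahedralTwoSkeleton_fineGeometricComplex,
    nonempty_fundamentalGroup_mulEquiv⟩
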